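/- **Setting.** Let $G$ be a finitely generated abelian group of rank one with a partial order $\le$ such that $x\le y$ implies $x+z\le y+z$, and such that the set $G_{\ge 0}$ of non-negative elements generates the group $G$. Let $\Gamma=\bigoplus_{i\in\mathbb Z,\,g\in G}\Gamma^i_g$ be a $G_{\ge0}$-graded dg ring: a $G$-graded dg ring (differential of degree $(1,0)$) with $\Gamma_g=0$ unless $g\ge 0$. Let $\Gamma^{\mathrm{op}}$ be the opposite dg ring, and let $\mathcal D^G(\Gamma)$ be the derived category of $G$-graded right dg $\Gamma$-modules, i.e. the Verdier quotient of their homotopy category by the acyclic dg modules. Write $X(g)$ for the grading shift, $X(g)_h=X_{g+h}$. For a subset $I\subseteq G$ and $X\in\mathcal D^G(\Gamma)$ let $\mathrm{thick}^I X$ be the smallest full triangulated subcategory of $\mathcal D^G(\Gamma)$ which is closed under direct summands and contains $X(-g)$ for all $g\in I$. Put $\mathrm{per}^I\Gamma:=\mathrm{thick}^I\Gamma$; in particular $\mathrm{per}^G\Gamma=\mathrm{thick}^G\Gamma$. Let $\Gamma_0$ be the right dg module $\Gamma/\bigoplus_{g\neq0}\Gamma_g$, and similarly for $\Gamma^{\mathrm{op}}$.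 Say that $\Gamma$ has Gorenstein parameter $p\in G$ if $\mathrm{RHom}_\Gamma(-,\Gamma)$ sends every $X\in\mathcal D^G(\Gamma)$ whose cohomology is concentrated in $G$-degree $0$ to an object of $\mathcal D^G(\Gamma^{\mathrm{op}})$ whose cohomology is concentrated in $G$-degree $-p$. Assume: * (D1) $\Gamma_0\in\mathrm{per}^G\Gamma$ and $(\Gamma^{\mathrm{op}})_0\in\mathrm{per}^G\Gamma^{\mathrm{op}}$; * (D2) there is $p\in G$ with $p>0$ such that $\Gamma$ and $\Gamma^{\mathrm{op}}$ both have Gorenstein parameter $p$. Let $\mathcal C^G(\Gamma):=\mathrm{per}^G\Gamma/\mathrm{thick}^G\Gamma_0$ (Verdier quotient). Let $I\subseteq G$ be a non-trivial upper set ($I\ne\emptyset$, $I\neq G$, and $x\in I$, $x\le y$ imply $y\in I$), write $I^c=G\setminus I$ and $J(I):=I\cap(I^c+p)$. **Theorem.** 1. There is a weak semi-orthogonal decomposition $$\mathrm{per}^G\Gamma=\mathrm{thick}^I\Gamma_0\perp\mathrm{per}^{J(I)}\Gamma\perp\mathrm{thick}^{I^c}\Gamma_0 .$$ Here $\mathcal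 T=\mathcal X\perp\mathcal Y\perp\mathcal Z$ means that $\mathcal X,\mathcal Y,\mathcal Z$ are thick subcategories with $\mathrm{Hom}(\mathcal X,\mathcal Y)=\mathrm{Hom}(\mathcal X,\mathcal Z)=\mathrm{Hom}(\mathcal Y,\mathcal Z)=0$ and $\mathcal T=\mathcal X*\mathcal Y*\mathcal Z$, where $\mathcal X*\mathcal Y$ consists of the objects $E$ that occur in a distinguished triangle $X\to E\to Y\to X[1]$ with $X\in\mathcal X$, $Y\in\mathcal Y$. 2. The composite $\mathrm{per}^{J(I)}\Gamma\hookrightarrow\mathrm{per}^G\Gamma\to\mathcal C^G(\Gamma)$ of the inclusion and the quotient functor is a triangle equivalence. Moreover $J(I)$ is finite, and for the dg ring $A:=[\Gamma_{g-h}]_{g,h\in J(I)}$ of matrices whose $(g,h)$ entry lies in $\Gamma_{g-h}$ (with matrix multiplication) there is a triangle equivalence $$\mathcal C^G(\Gamma)\simeq\mathrm{per}\,A ,$$ where $\mathrm{per}\,A$ is the thick subcategory of the derived category of right dg $A$-modules generated by $A$. The same holds for the matrix dg ring $[\Gamma_{h-g}]_{g,h\in J(I)}$. -/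

import Mathlib

open CategoryTheory CategoryTheory.Limits CategoryTheory.Pretriangulated

universe u

noncomputable section

/-- The sign `(-1)^i`. -/
def dgSign (i : ℤ) : ℤ := (i.negOnePow : ℤ)

namespace dgSign

lemma add (i j : ℤ) : dgSign (i + j) = dgSign i * dgSign j := by
  simp [dgSign, Int.negOnePow_add]

@[simp] lemma zero : dgSign 0 = 1 := by simp [dgSign]

@[simp] lemma one : dgSign 1 = -1 := by simp [dgSign]

lemma mul_self (i : ℤ) : dgSign i * dgSign i = 1 := by
  rw [dgSign, ← Units.val_mul, Int.units_mul_self, Units.val_one]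

end dgSign

/-- A `G`-graded dg ring (cohomological convention): abelian groups `Γ^i_g`, a differential of degree
`(1, 0)`, and an associative unital multiplication `Γ^i_g × Γ^j_h → Γ^{i+j}_{g+h}` satisfying the
graded Leibniz rule.  The target degree of each operation is an argument constrained by an
equation, so that no transport along equalities of degrees is needed. -/
structure DGRing (G : Type u) [AddCommGroup G] where
  X : ℤ → G → Type u
  [grp : ∀ i g, AddCommGroup (X i g)]
  d : ∀ {i j : ℤ} (_ : i + 1 = j) (g : G), X i g →+ X j g
  one : X 0 0
  mul : ∀ {i j k : ℤ} {g h l : G} (_ : i + j = k) (_ : g + h = l), X i g →+ X j h →+ X k l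
  d_d : ∀ {i j k : ℤ} (hi : i + 1 = j) (hj : j + 1 = k) (g : G) (x : X i g), d hj g (d hi g x) = 0
  one_mul : ∀ {i : ℤ} {g : G} (x : X i g), mul (zero_add i) (zero_add g) one x = x
  mul_one : ∀ {i : ℤ} {g : G} (x : X i g), mul (add_zero i) (add_zero g) x one = x
  mul_assoc : ∀ {i₁ i₂ i₃ i₁₂ i₂₃ i : ℤ} {g₁ g₂ g₃ g₁₂ g₂₃ g : G}
    (h₁₂ : i₁ + i₂ = i₁₂) (h₂₃ : i₂ + i₃ = i₂₃) (h : i₁₂ + i₃ = i) (h' : i₁ + i₂₃ = i)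
    (e₁₂ : g₁ + g₂ = g₁₂) (e₂₃ : g₂ + g₃ = g₂₃) (e : g₁₂ + g₃ = g) (e' : g₁ + g₂₃ = g)
    (x : X i₁ g₁) (y : X i₂ g₂) (z : X i₃ g₃),
    mul h e (mul h₁₂ e₁₂ x y) z = mul h' e' x (mul h₂₃ e₂₃ y z)
  d_mul : ∀ {i i' j j' k k' : ℤ} {g h l : G} (hi : i + 1 = i') (hj : j + 1 = j') (hk : k + 1 = k')
    (h₁ : i + j = k) (h₂ : i' + j = k') (h₃ : i + j' = k') (e : g + h = l)
    (x : X i g) (y : X j h),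
    d hk l (mul h₁ e x y) = mul h₂ e (d hi g x) y + dgSign i • mul h₃ e x (d hj h y)

attribute [instance] DGRing.grp

variable {G : Type u} [AddCommGroup G]

/-- A `G`-graded right dg module over a `G`-graded dg ring. -/
structure DGMod (Γ : DGRing G) where
  X : ℤ → G → Type u
  [grp : ∀ i g, AddCommGroup (X i g)]
  d : ∀ {i j : ℤ} (_ : i + 1 = j) (g : G), X i g →+ X j g
  act : ∀ {i j k : ℤ} {g h l : G} (_ : i + j = k) (_ : g + h = l), X i g →+ Γ.X j h →+ X k l
  d_d : ∀ {i j k : ℤ} (hi : i + 1 = j) (hj : j + 1 = k) (g : G) (x : X i g), d hj g (d hi g x) = 0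
  act_one : ∀ {i : ℤ} {g : G} (x : X i g), act (add_zero i) (add_zero g) x Γ.one = x
  act_assoc : ∀ {i₁ i₂ i₃ i₁₂ i₂₃ i : ℤ} {g₁ g₂ g₃ g₁₂ g₂₃ g : G}
    (h₁₂ : i₁ + i₂ = i₁₂) (h₂₃ : i₂ + i₃ = i₂₃) (h : i₁₂ + i₃ = i) (h' : i₁ + i₂₃ = i)
    (e₁₂ : g₁ + g₂ = g₁₂) (e₂₃ : g₂ + g₃ = g₂₃) (e : g₁₂ + g₃ = g) (e' : g₁ + g₂₃ = g)
    (x : X i₁ g₁) (a : Γ.X i₂ g₂) (b : Γ.X i₃ g₃),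
    act h e (act h₁₂ e₁₂ x a) b = act h' e' x (Γ.mul h₂₃ e₂₃ a b)
  d_act : ∀ {i i' j j' k k' : ℤ} {g h l : G} (hi : i + 1 = i') (hj : j + 1 = j') (hk : k + 1 = k')
    (h₁ : i + j = k) (h₂ : i' + j = k') (h₃ : i + j' = k') (e : g + h = l)
    (x : X i g) (a : Γ.X j h),
    d hk l (act h₁ e x a) = act h₂ e (d hi g x) a + dgSign i • act h₃ e x (Γ.d hj h a)

attribute [instance] DGMod.grp

namespace DGMod

variable {Γ : DGRing G}

/-- The group of morphisms of dg modules: homogeneous additive maps of degree `(0, 0)` commuting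
with the differentials and the action. -/
def homs (M N : DGMod Γ) : AddSubgroup (∀ i g, M.X i g →+ N.X i g) where
  carrier := {f | (∀ {i j : ℤ} (h : i + 1 = j) (g : G) (x : M.X i g),
      f j g (M.d h g x) = N.d h g (f i g x)) ∧
    ∀ {i j k : ℤ} {g h l : G} (hi : i + j = k) (hg : g + h = l) (x : M.X i g) (a : Γ.X j h),
      f k l (M.act hi hg x a) = N.act hi hg (f i g x) a}
  add_mem' {a b} ha hb := ⟨fun h g x ↦ by simp [ha.1, hb.1], fun hi hg x c ↦ by simp [ha.2, hb.2]⟩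
  zero_mem' := ⟨by simp, by simp⟩
  neg_mem' {a} ha := ⟨fun h g x ↦ by simp [ha.1], fun hi hg x c ↦ by simp [ha.2]⟩

instance : Category (DGMod Γ) where
  Hom M N := homs M N
  id M := ⟨fun _ _ ↦ AddMonoidHom.id _, by simp, by simp⟩
  comp f g := ⟨fun i k ↦ (g.1 i k).comp (f.1 i k),
    by simp [f.2.1, g.2.1], by simp [f.2.2, g.2.2]⟩

variable {M N P : DGMod Γ}

/-- The underlying maps of a morphism of dg modules. -/
def app (f : M ⟶ N) (i : ℤ) (g : G) : M.X i g →+ N.X i g := f.1 i g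

/-- Constructor for morphisms of dg modules. -/
def mkHom (f : ∀ i g, M.X i g →+ N.X i g)
    (hd : ∀ {i j : ℤ} (h : i + 1 = j) (g : G) (x : M.X i g),
      f j g (M.d h g x) = N.d h g (f i g x))
    (ha : ∀ {i j k : ℤ} {g h l : G} (hi : i + j = k) (hg : g + h = l) (x : M.X i g) (a : Γ.X j h),
      f k l (M.act hi hg x a) = N.act hi hg (f i g x) a) : M ⟶ N := ⟨f, hd, ha⟩

@[simp] lemma app_mkHom (f : ∀ i g, M.X i g →+ N.X i g) (hd) (ha) :
    app (mkHom (M := M) (N := N) f hd ha) = f := rfl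

lemma app_d (f : M ⟶ N) {i j : ℤ} (h : i + 1 = j) (g : G) (x : M.X i g) :
    app f j g (M.d h g x) = N.d h g (app f i g x) := f.2.1 h g x

lemma app_act (f : M ⟶ N) {i j k : ℤ} {g h l : G} (hi : i + j = k) (hg : g + h = l)
    (x : M.X i g) (a : Γ.X j h) :
    app f k l (M.act hi hg x a) = N.act hi hg (app f i g x) a := f.2.2 hi hg x a

@[ext] lemma hom_ext {f f' : M ⟶ N} (h : ∀ i g x, app f i g x = app f' i g x) : f = f' :=
  Subtype.ext (funext fun i ↦ funext fun g ↦ AddMonoidHom.ext (h i g))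

instance : Preadditive (DGMod Γ) where
  homGroup M N := inferInstanceAs (AddCommGroup (homs M N))
  add_comp P Q R f f' g := by
    apply hom_ext; intro i k x; exact map_add (g.1 i k) (f.1 i k x) (f'.1 i k x)
  comp_add P Q R f g g' := by
    apply hom_ext; intro i k x; rfl

@[simp] lemma app_id (i : ℤ) (g : G) (x : M.X i g) : app (𝟙 M) i g x = x := rfl
@[simp] lemma app_comp (f : M ⟶ N) (f' : N ⟶ P) (i : ℤ) (g : G) (x : M.X i g) :
    app (f ≫ f') i g x = app f' i g (app f i g x) := rfl
@[simp] lemma app_add (f f' : M ⟶ N) (i : ℤ) (g : G) (x : M.X i g) :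
    app (f + f') i g x = app f i g x + app f' i g x := rfl
@[simp] lemma app_neg (f : M ⟶ N) (i : ℤ) (g : G) (x : M.X i g) :
    app (-f) i g x = -app f i g x := rfl
@[simp] lemma app_sub (f f' : M ⟶ N) (i : ℤ) (g : G) (x : M.X i g) :
    app (f - f') i g x = app f i g x - app f' i g x := rfl
@[simp] lemma app_zero (i : ℤ) (g : G) (x : M.X i g) : app (0 : M ⟶ N) i g x = 0 := rfl

/-- The zero dg module. -/
def zeroMod (Γ : DGRing G) : DGMod Γ where
  X _ _ := PUnit
  d _ _ := 0
  act _ _ := 0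
  d_d _ _ _ _ := rfl
  act_one _ := rfl
  act_assoc _ _ _ _ _ _ _ _ _ _ _ := rfl
  d_act _ _ _ _ _ _ _ _ _ := rfl

lemma isZero_zeroMod (Γ : DGRing G) : IsZero (zeroMod Γ) := by
  rw [IsZero.iff_id_eq_zero]
  ext i g x
  rfl

instance : HasZeroObject (DGMod Γ) := ⟨_, isZero_zeroMod Γ⟩

/-! ### The shift -/

/-- Transport along an equality of cohomological degrees. -/
def castHom (M : DGMod Γ) {i j : ℤ} (h : i = j) (g : G) : M.X i g →+ M.X j g :=
  h ▸ AddMonoidHom.id _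

@[simp] lemma castHom_rfl (M : DGMod Γ) {i : ℤ} (g : G) (x : M.X i g) :
    M.castHom rfl g x = x := rfl

@[simp] lemma castHom_castHom (M : DGMod Γ) {i j k : ℤ} (h : i = j) (h' : j = k) (g : G)
    (x : M.X i g) : M.castHom h' g (M.castHom h g x) = M.castHom (h.trans h') g x := by
  subst h h'; rfl

lemma castHom_d (M : DGMod Γ) {i j i' j' : ℤ} (h : i + 1 = j) (h' : i' + 1 = j') (hi : i = i')
    (hj : j = j') (g : G) (x : M.X i g) :
    M.castHom hj g (M.d h g x) = M.d h' g (M.castHom hi g x) := by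
  subst hi hj; rfl

lemma castHom_act (M : DGMod Γ) {i i' j k k' : ℤ} {g h l : G} (e : i + j = k) (e' : i' + j = k')
    (hi : i = i') (hk : k = k') (hg : g + h = l) (x : M.X i g) (a : Γ.X j h) :
    M.castHom hk l (M.act e hg x a) = M.act e' hg (M.castHom hi g x) a := by
  subst hi hk; rfl

lemma app_castHom (f : M ⟶ N) {i j : ℤ} (h : i = j) (g : G) (x : M.X i g) :
    app f j g (M.castHom h g x) = N.castHom h g (app f i g x) := by
  subst h; rfl

/-- The shifted dg module `M[n]`: `M[n]^i_g = M^{i+n}_g`, with differential `(-1)^n d` and the same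
right action. -/
@[reducible] def shiftObj (M : DGMod Γ) (n : ℤ) : DGMod Γ where
  X i g := M.X (i + n) g
  d {i j} h g := dgSign n • M.d (by omega) g
  act hi hg := M.act (by omega) hg
  d_d _ _ _ _ := by simp [M.d_d]
  act_one {i g} x := by
    have := M.act_one x
    simpa using this
  act_assoc _ _ _ _ _ _ _ _ x a b := M.act_assoc _ _ _ _ _ _ _ _ x a b
  d_act {i i' j j' k k' g h l} hi hj hk h₁ h₂ h₃ e x a := by
    have := M.d_act (i := i + n) (i' := i' + n) (k := k + n) (k' := k' + n) (by omega) hj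
      (by omega) (by omega) (by omega) (by omega) e x a
    have h1 := dgSign.mul_self n
    simp only [AddMonoidHom.smul_apply, this, map_zsmul, dgSign.add, smul_add, smul_smul]
    congr 2
    linear_combination (dgSign i) * h1

lemma shiftObj_d (M : DGMod Γ) (n : ℤ) {i j : ℤ} (h : i + 1 = j) (g : G) (x : M.X (i + n) g) :
    (M.shiftObj n).d h g x = dgSign n • M.d (show i + n + 1 = j + n by omega) g x := rfl

lemma castHom_shiftObj (M : DGMod Γ) (n : ℤ) {i j : ℤ} (h : i = j) (g : G) (x : M.X (i + n) g) :
    (M.shiftObj n).castHom h g x = M.castHom (show i + n = j + n by omega) g x := by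
  subst h; rfl

/-- The shift functors on dg modules. -/
def shiftFun (Γ : DGRing G) (n : ℤ) : DGMod Γ ⥤ DGMod Γ where
  obj M := M.shiftObj n
  map {M N} f := mkHom (M := M.shiftObj n) (N := N.shiftObj n) (fun i g ↦ app f (i + n) g)
    (fun {i j} h g x ↦ by
      change app f (j + n) g (dgSign n • M.d _ g x) = dgSign n • N.d _ g (app f (i + n) g x)
      rw [map_zsmul, app_d])
    (fun hi hg x a ↦ app_act f _ hg x a)

/-- Isomorphisms of dg modules from homogeneous components. -/
def mkIso (f : M ⟶ N) (f' : N ⟶ M) (h : ∀ i g x, app f' i g (app f i g x) = x)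
    (h' : ∀ i g x, app f i g (app f' i g x) = x) : M ≅ N where
  hom := f
  inv := f'
  hom_inv_id := by ext; simp [h]
  inv_hom_id := by ext; simp [h']

/-- Transport `M[a] → M[b][c]` of degrees, when `a = b + c`. -/
def shiftCast (M : DGMod Γ) {a b c : ℤ} (h : a = b + c) :
    M.shiftObj a ≅ (M.shiftObj b).shiftObj c := by
  refine mkIso (mkHom (M := M.shiftObj a) (N := (M.shiftObj b).shiftObj c)
      (fun i g ↦ M.castHom (by omega) g) ?_ ?_)
    (mkHom (N := M.shiftObj a) (M := (M.shiftObj b).shiftObj c)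
      (fun i g ↦ M.castHom (by omega) g) ?_ ?_) ?_ ?_
  · intro i j hij g x
    change M.castHom _ g (dgSign a • M.d _ g x) = dgSign c • dgSign b • M.d _ g _
    rw [map_zsmul, smul_smul, show dgSign a = dgSign c * dgSign b by
      rw [h, add_comm, dgSign.add], castHom_d]
  · intro i j k g h l hi hg x a
    exact castHom_act M _ _ _ _ _ _ _
  · intro i j hij g x
    change M.castHom _ g (dgSign c • dgSign b • M.d _ g x) = dgSign a • M.d _ g _
    rw [map_zsmul, map_zsmul, smul_smul, show dgSign a = dgSign c * dgSign b by
      rw [h, add_comm, dgSign.add], castHom_d]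
  · intro i j k g h l hi hg x a
    exact castHom_act M _ _ _ _ _ _ _
  · intro i g x
    exact castHom_castHom M _ _ _ _
  · intro i g x
    exact castHom_castHom M _ _ _ _

/-- The isomorphism `M[0] ≅ M`. -/
def shiftZero (M : DGMod Γ) : M.shiftObj 0 ≅ M := by
  refine mkIso (mkHom (M := M.shiftObj 0) (fun i g ↦ M.castHom (by omega) g) ?_ ?_)
    (mkHom (N := M.shiftObj 0) (fun i g ↦ M.castHom (by omega) g) ?_ ?_) ?_ ?_
  · intro i j hij g x
    change M.castHom _ g (dgSign 0 • M.d _ g x) = M.d _ g _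
    rw [map_zsmul, dgSign.zero, one_smul, castHom_d]
  · intro i j k g h l hi hg x a
    exact castHom_act M _ _ _ _ _ _ _
  · intro i j hij g x
    change M.castHom _ g (M.d _ g x) = dgSign 0 • M.d _ g _
    rw [dgSign.zero, one_smul]
    exact castHom_d M _ _ _ _ _ _
  · intro i j k g h l hi hg x a
    exact castHom_act M _ _ _ _ _ _ _
  · intro i g x
    exact castHom_castHom M _ _ _ _
  · intro i g x
    exact castHom_castHom M _ _ _ _

lemma app_eqToHom_shift (M : DGMod Γ) {a b : ℤ} (h : a = b) (i : ℤ) (g : G) (x : M.X (i + a) g) :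
    app (eqToHom (congrArg M.shiftObj h)) i g x = M.castHom (by omega) g x := by
  subst h; rfl

instance : HasShift (DGMod Γ) ℤ := hasShiftMk _ _
  { F := shiftFun Γ
    zero := NatIso.ofComponents shiftZero (fun f ↦ by
      ext i g x; exact (app_castHom f _ g x).symm)
    add := fun n m ↦ NatIso.ofComponents (fun M ↦ M.shiftCast rfl) (fun f ↦ by
      ext i g x; exact (app_castHom f _ g x).symm)
    assoc_hom_app := fun m₁ m₂ m₃ M ↦ by
      ext i g x
      have := app_eqToHom_shift M (add_assoc m₁ m₂ m₃) i g x
      rw [app_comp, app_comp, app_comp]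
      erw [this]
      change M.castHom _ g (M.castHom _ g x) =
        (M.shiftObj m₁).castHom _ g (M.castHom _ g (M.castHom _ g x))
      exact (castHom_castHom M _ _ _ _).trans (((castHom_shiftObj M _ _ _ _).trans
        ((castHom_castHom M _ _ _ _).trans (castHom_castHom M _ _ _ _))).symm)
    zero_add_hom_app := fun n M ↦ by
      ext i g x
      have := app_eqToHom_shift M (zero_add n) i g x
      rw [app_comp]
      erw [this]
      exact (castHom_castHom M _ _ _ _).symm
    add_zero_hom_app := fun n M ↦ by
      ext i g x
      have := app_eqToHom_shift M (add_zero n) i g x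
      rw [app_comp]
      erw [this]
      exact ((castHom_shiftObj M _ _ _ _).trans (castHom_castHom M _ _ _ _)).symm }

lemma shiftFunctor_map_app (f : M ⟶ N) (n i : ℤ) (g : G) (x : M.X (i + n) g) :
    app (f⟦n⟧') i g x = app f (i + n) g x := rfl

lemma shiftFunctorAdd'_hom_app_app (n m k : ℤ) (h : n + m = k) (i : ℤ) (g : G)
    (x : M.X (i + k) g) : app ((shiftFunctorAdd' (DGMod Γ) n m k h).hom.app M) i g x =
      M.castHom (show i + k = i + m + n by omega) g x := by
  subst h; rw [shiftFunctorAdd'_eq_shiftFunctorAdd]; rfl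

lemma shiftFunctorAdd'_inv_app_app (n m k : ℤ) (h : n + m = k) (i : ℤ) (g : G)
    (x : M.X (i + m + n) g) : app ((shiftFunctorAdd' (DGMod Γ) n m k h).inv.app M) i g x =
      M.castHom (show i + m + n = i + k by omega) g x := by
  subst h; rw [shiftFunctorAdd'_eq_shiftFunctorAdd]; rfl

lemma shiftFunctorComm_hom_app_app (n m i : ℤ) (g : G) (x : M.X (i + m + n) g) :
    app ((shiftFunctorComm (DGMod Γ) n m).hom.app M) i g x =
      M.castHom (show i + m + n = i + n + m by omega) g x := by
  rw [shiftFunctorComm_eq _ n m (n + m) rfl]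
  change app ((shiftFunctorAdd' (DGMod Γ) m n (n + m) (add_comm m n)).hom.app M) i g
    (app ((shiftFunctorAdd' (DGMod Γ) n m (n + m) rfl).inv.app M) i g x) = _
  exact (congrArg _ (shiftFunctorAdd'_inv_app_app _ _ _ _ _ _ _)).trans
    ((shiftFunctorAdd'_hom_app_app _ _ _ _ _ _ _).trans (castHom_castHom _ _ _ _ _))

instance (n : ℤ) : (shiftFunctor (DGMod Γ) n).Additive where
  map_add := by intros; ext; rfl

/-! ### The homotopy category -/

/-- The null-homotopic morphisms: those of the form `dh + hd`, for a homogeneous `Γ`-linear map `h` of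
degree `(-1, 0)`. -/
def nullHomotopic (M N : DGMod Γ) : AddSubgroup (M ⟶ N) where
  carrier := {f | ∃ s : ∀ {i j : ℤ} (_ : j + 1 = i) (g : G), M.X i g →+ N.X j g,
    (∀ {i i' j k k' : ℤ} {g h l : G} (hi : i' + 1 = i) (hk : k' + 1 = k) (e : i + j = k)
      (e' : i' + j = k') (hg : g + h = l) (x : M.X i g) (a : Γ.X j h),
      s hk l (M.act e hg x a) = N.act e' hg (s hi g x) a) ∧
    ∀ {i j k : ℤ} (hj : j + 1 = i) (hk : i + 1 = k) (g : G) (x : M.X i g),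
      app f i g x = N.d hj g (s hj g x) + s hk g (M.d hk g x)}
  add_mem' := by
    rintro f f' ⟨s, hs, hs'⟩ ⟨t, ht, ht'⟩
    refine ⟨fun h g ↦ s h g + t h g, ?_, ?_⟩
    · intro i i' j k k' g h l hi hk e e' hg x a
      simp [hs hi hk e e', ht hi hk e e']
    · intro i j k hj hk g x
      simp only [app_add, hs' hj hk, ht' hj hk, AddMonoidHom.add_apply, map_add]
      abel
  zero_mem' := ⟨fun _ _ ↦ 0, by intros; simp, by intros; simp⟩
  neg_mem' := by
    rintro f ⟨s, hs, hs'⟩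
    refine ⟨fun h g ↦ -s h g, ?_, ?_⟩
    · intro i i' j k k' g h l hi hk e e' hg x a
      simp [hs hi hk e e']
    · intro i j k hj hk g x
      simp only [app_neg, hs' hj hk, AddMonoidHom.neg_apply, map_neg]
      abel

/-- The homotopy relation on morphisms of dg modules. -/
def homotopic (Γ : DGRing G) : HomRel (DGMod Γ) := fun M N f f' ↦ f - f' ∈ nullHomotopic M N

lemma comp_mem_nullHomotopic {f : M ⟶ N} (f' : N ⟶ P) (hf : f ∈ nullHomotopic M N) :
    f ≫ f' ∈ nullHomotopic M P := by
  obtain ⟨s, hs, hs'⟩ := hf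
  refine ⟨fun {i j} h g ↦ (app f' j g).comp (s h g), ?_, ?_⟩
  · intro i i' j k k' g h l hi hk e e' hg x a
    simp [hs hi hk e e', app_act]
  · intro i j k hj hk g x
    simp [hs' hj hk, app_d]

lemma comp_mem_nullHomotopic' (f : M ⟶ N) {f' : N ⟶ P} (hf : f' ∈ nullHomotopic N P) :
    f ≫ f' ∈ nullHomotopic M P := by
  obtain ⟨s, hs, hs'⟩ := hf
  refine ⟨fun {i j} h g ↦ (s h g).comp (app f i g), ?_, ?_⟩
  · intro i i' j k k' g h l hi hk e e' hg x a
    simp [hs hi hk e e', app_act]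
  · intro i j k hj hk g x
    simp [hs' hj hk, app_d]

instance : Congruence (homotopic Γ) where
  equivalence :=
    { refl := fun f ↦ by simp [homotopic, zero_mem]
      symm := fun {f f'} h ↦ by simpa [homotopic] using neg_mem h
      trans := fun {f f' f''} h h' ↦ by simpa [homotopic] using add_mem h h' }
  comp_left f _ _ h := by
    simpa [homotopic, Preadditive.comp_sub] using comp_mem_nullHomotopic' f h
  comp_right f h := by
    simpa [homotopic, Preadditive.sub_comp] using comp_mem_nullHomotopic f h

instance : (homotopic Γ).IsCompatibleWithShift ℤ where
  condition n M N f f' h := by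
    obtain ⟨s, hs, hs'⟩ := h
    refine ⟨fun {i j} h g ↦ dgSign n • s (show j + n + 1 = i + n by omega) g, ?_, ?_⟩
    · intro i i' j k k' g h l hi hk e e' hg x a
      have := hs (show i' + n + 1 = i + n by omega) (show k' + n + 1 = k + n by omega)
        (show i + n + j = k + n by omega) (show i' + n + j = k' + n by omega) hg x a
      change dgSign n • s _ l (M.act _ hg x a) = N.act _ hg (dgSign n • s _ g x) a
      rw [this, map_zsmul]; rfl
    · intro i j k hj hk g x
      have := hs' (show j + n + 1 = i + n by omega) (show i + n + 1 = k + n by omega) g x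
      change app (f - f') (i + n) g x = dgSign n • N.d _ g (dgSign n • s _ g x) +
        dgSign n • s _ g (dgSign n • M.d _ g x)
      rw [this, map_zsmul, map_zsmul, smul_smul, smul_smul, dgSign.mul_self, one_smul, one_smul]
      rfl

/-- The homotopy category of `G`-graded right dg modules. -/
abbrev HoCat (Γ : DGRing G) := CategoryTheory.Quotient (homotopic Γ)

/-- The functor from dg modules to the homotopy category. -/
abbrev toHo (Γ : DGRing G) : DGMod Γ ⥤ HoCat Γ := Quotient.functor (homotopic Γ)

lemma homotopic_add ⦃X Y : DGMod Γ⦄ (f₁ f₂ g₁ g₂ : X ⟶ Y) (h₁ : homotopic Γ f₁ f₂)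
    (h₂ : homotopic Γ g₁ g₂) : homotopic Γ (f₁ + g₁) (f₂ + g₂) := by
  have := add_mem h₁ h₂
  rwa [← add_sub_add_comm] at this

instance : Preadditive (HoCat Γ) := Quotient.preadditive _ homotopic_add

instance : (toHo Γ).Additive := Quotient.functor_additive _ homotopic_add

instance (n : ℤ) : (shiftFunctor (HoCat Γ) n).Additive := by
  have : (toHo Γ ⋙ shiftFunctor _ n).Additive :=
    Functor.additive_of_iso ((toHo Γ).commShiftIso n)
  exact Functor.additive_of_full_essSurj_comp (toHo Γ) _

instance : HasZeroObject (HoCat Γ) := (toHo Γ).hasZeroObject_of_additive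

lemma toHo_map_eq_zero_iff (f : M ⟶ N) : (toHo Γ).map f = 0 ↔ f ∈ nullHomotopic M N := by
  rw [← (toHo Γ).map_zero, Quotient.functor_map_eq_iff]
  simp [homotopic]

/-! ### Mapping cones -/

/-- The mapping cone of `f : M ⟶ N`: `N ⊕ M[1]` with differential `(y, x) ↦ (dy + f x, -dx)`. -/
@[reducible] def cone (f : M ⟶ N) : DGMod Γ where
  X i g := N.X i g × M.X (i + 1) g
  d {i j} h g :=
    { toFun := fun y ↦ (N.d h g y.1 + N.castHom h g (app f (i + 1) g y.2),
        -M.d (by omega) g y.2)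
      map_zero' := by simp
      map_add' := fun y z ↦ by
        ext
        · simp only [Prod.fst_add, Prod.snd_add, map_add]; abel
        · simp only [Prod.snd_add, map_add, neg_add] }
  act hi hg :=
    { toFun := fun y ↦ (N.act hi hg y.1).prod (M.act (by omega) hg y.2)
      map_zero' := by ext <;> simp
      map_add' := fun y z ↦ by ext <;> simp }
  d_d {i j k} hi hj g y := by
    subst hi hj
    ext <;> simp [N.d_d, M.d_d, app_d]
  act_one {i g} y := by
    ext
    · exact N.act_one y.1
    · simpa using M.act_one y.2
  act_assoc _ _ _ _ _ _ _ _ x a b := by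
    ext
    · exact N.act_assoc _ _ _ _ _ _ _ _ _ _ _
    · exact M.act_assoc _ _ _ _ _ _ _ _ _ _ _
  d_act {i i' j j' k k' g h l} hi hj hk h₁ h₂ h₃ e x a := by
    subst hi hk
    ext
    · simp [N.d_act rfl hj rfl h₁ h₂ h₃ e, app_act]
      abel
    · simp [M.d_act (i := i + 1) (i' := i + 1 + 1) (k := k + 1) (k' := k + 1 + 1) rfl hj rfl
        (by omega) (by omega) (show i + 1 + j' = k + 1 + 1 by omega) e, dgSign.add]
      abel

/-- The inclusion `N ⟶ cone f`. -/
def coneIn (f : M ⟶ N) : N ⟶ cone f :=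
  mkHom (N := cone f) (fun _ _ ↦ AddMonoidHom.inl _ _) (by intros; ext <;> simp)
    (by intros; ext <;> simp)

/-- The projection `cone f ⟶ M[1]`. -/
def coneOut (f : M ⟶ N) : cone f ⟶ M⟦(1 : ℤ)⟧ :=
  mkHom (M := cone f) (N := M.shiftObj 1) (fun _ _ ↦ AddMonoidHom.snd _ _)
    (by intros; simp) (by intros; simp)

/-- The standard triangle `M ⟶ N ⟶ cone f ⟶ M[1]`. -/
def coneTriangle (f : M ⟶ N) : Triangle (DGMod Γ) :=
  Triangle.mk f (coneIn f) (coneOut f)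

lemma id_cone_mem (M : DGMod Γ) : 𝟙 (cone (𝟙 M)) ∈ nullHomotopic _ _ := by
  refine ⟨fun {i j} h g ↦
    { toFun := fun y ↦ ((0 : M.X j g), M.castHom h.symm g y.1)
      map_zero' := by ext <;> simp
      map_add' := fun y z ↦ by ext <;> simp }, ?_, ?_⟩
  · intro i i' j k k' g h l hi hk e e' hg x a
    subst hi hk
    ext <;> simp
  · intro i j k hj hk g x
    subst hj hk
    ext
    · simp only [AddMonoidHom.coe_mk, ZeroHom.coe_mk]
      simp
      rfl
    · simp only [AddMonoidHom.coe_mk, ZeroHom.coe_mk]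
      simp
      rfl

/-- The morphism of cones induced by a square commuting up to homotopy. -/
lemma exists_coneMap {M' N' : DGMod Γ} (f : M ⟶ N) (f' : M' ⟶ N') (a : M ⟶ M') (b : N ⟶ N')
    (h : f ≫ b - a ≫ f' ∈ nullHomotopic M N') :
    ∃ c : cone f ⟶ cone f', coneIn f ≫ c = b ≫ coneIn f' ∧
      coneOut f ≫ a⟦(1 : ℤ)⟧' = c ≫ coneOut f' := by
  obtain ⟨s, hs, hs'⟩ := h
  refine ⟨mkHom (M := cone f) (N := cone f') (fun i g ↦
    { toFun := fun y ↦ (app b i g y.1 + s rfl g y.2, app a (i + 1) g y.2)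
      map_zero' := by ext <;> simp
      map_add' := fun y z ↦ by
        ext
        · simp only [Prod.fst_add, Prod.snd_add, map_add]; abel
        · simp }) ?_ ?_, ?_, ?_⟩
  · intro i j hij g x
    subst hij
    ext
    · have := hs' (i := i + 1) rfl rfl g x.2
      simp only [app_sub, app_comp] at this
      have h3 : app b (i + 1) g (app f (i + 1) g x.2) = app f' (i + 1) g (app a (i + 1) g x.2) +
        (N'.d rfl g (s rfl g x.2) + s rfl g (M.d rfl g x.2)) := by
        rw [← this]; abel
      simp [app_d, h3]
      abel
    · simp [app_d]
  · intro i j k g h l hi hg x c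
    ext
    · simp [app_act, hs (show i + 1 = i + 1 from rfl) (show k + 1 = k + 1 from rfl)
        (show i + 1 + j = k + 1 by omega) hi]
    · simp [app_act]
  · ext i g x
    · change app b i g x + s rfl g 0 = app b i g x
      simp
    · change app a (i + 1) g 0 = 0
      simp
  · ext i g x
    rfl

/-! ### Homotopy equivalences used to verify the axioms of triangulated categories -/

/-- An isomorphism in the homotopy category. -/
def isoOfHomotopy (a : M ⟶ N) (b : N ⟶ M) (h : a ≫ b = 𝟙 M)
    (h' : b ≫ a - 𝟙 N ∈ nullHomotopic N N) : (toHo Γ).obj M ≅ (toHo Γ).obj N where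
  hom := (toHo Γ).map a
  inv := (toHo Γ).map b
  hom_inv_id := by rw [← CategoryTheory.Functor.map_comp, h, CategoryTheory.Functor.map_id]
  inv_hom_id := by
    rw [← CategoryTheory.Functor.map_comp, ← CategoryTheory.Functor.map_id]
    exact CategoryTheory.Quotient.sound _ h'

/-- The morphism of cones induced by a commutative square. -/
def coneMap {M' N' : DGMod Γ} (f : M ⟶ N) (f' : M' ⟶ N') (a : M ⟶ M') (b : N ⟶ N')
    (h : f ≫ b = a ≫ f') : cone f ⟶ cone f' :=
  mkHom (M := cone f) (N := cone f')
    (fun i g ↦ AddMonoidHom.prodMap (app b i g) (app a (i + 1) g))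
    (fun {i j} hij g x ↦ by
      subst hij
      have := congrArg (fun φ ↦ app φ (i + 1) g x.2) h
      simp only [app_comp] at this
      ext
      · simp [app_d, this]
      · simp [app_d])
    (fun hi hg x a ↦ by ext <;> simp [app_act])

/-- The morphism comparing the rotated triangle of `f` with the triangle of `coneIn f`. -/
def rotateHom (f : M ⟶ N) : M⟦(1 : ℤ)⟧ ⟶ cone (coneIn f) :=
  mkHom (M := M.shiftObj 1) (N := cone (coneIn f))
    (fun i g ↦ AddMonoidHom.prod (AddMonoidHom.prod 0 (AddMonoidHom.id _)) (-(app f (i + 1) g)))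
    (fun {i j} hij g x ↦ by
      subst hij
      ext
      · change (0 : N.X (i + 1) g) = N.d rfl g 0 + app f (i + 1) g x + -app f (i + 1) g x
        simp
      · change dgSign 1 • M.d rfl g x = -M.d rfl g x + 0
        simp
      · change - app f (i + 1 + 1) g (dgSign 1 • M.d rfl g x) = - N.d rfl g (-app f (i + 1) g x)
        simp [app_d])
    (fun hi hg x a ↦ by ext <;> simp [app_act])

/-- The homotopy inverse of `rotateHom`. -/
def rotateInv (f : M ⟶ N) : cone (coneIn f) ⟶ M⟦(1 : ℤ)⟧ :=
  mkHom (M := cone (coneIn f)) (N := M.shiftObj 1)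
    (fun i g ↦ (AddMonoidHom.snd _ _).comp (AddMonoidHom.fst _ _))
    (fun {i j} hij g x ↦ by
      subst hij
      change -M.d rfl g x.1.2 + 0 = dgSign 1 • M.d rfl g x.1.2
      simp)
    (fun hi hg x a ↦ by simp)

lemma rotate_homotopy (f : M ⟶ N) :
    rotateInv f ≫ rotateHom f - 𝟙 _ ∈ nullHomotopic (cone (coneIn f)) (cone (coneIn f)) := by
  refine ⟨fun {i j} h g ↦
    { toFun := fun y ↦ ((0 : (cone f).X j g), -N.castHom h.symm g y.1.1)
      map_zero' := by ext <;> simp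
      map_add' := fun y z ↦ by
        ext
        · simp
        · simp
        · simp; abel }, ?_, ?_⟩
  · intro i i' j k k' g h l hi hk e e' hg x a
    subst hi hk
    ext <;> simp
  · intro i j k hj hk g x
    subst hj hk
    ext
    · change (0 : N.X _ g) - x.1.1 = N.d rfl g 0 + app f _ g 0 + -x.1.1 + 0
      simp
    · change x.1.2 - x.1.2 = -M.d rfl g 0 + 0 + 0
      simp
    · change - app f _ g x.1.2 - x.2 = _
      simp [coneIn]
      abel

/-- The rotated triangle of `f` is isomorphic to the triangle of `coneIn f`. -/
def rotateIso (f : M ⟶ N) : (toHo Γ).mapTriangle.obj (coneTriangle f).rotate ≅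
    (toHo Γ).mapTriangle.obj (coneTriangle (coneIn f)) :=
  Triangle.isoMk _ _ (Iso.refl _) (Iso.refl _)
    (isoOfHomotopy (rotateHom f) (rotateInv f) (by ext i g x; rfl) (rotate_homotopy f))
    ((Category.comp_id _).trans (Category.id_comp _).symm)
    (by
      have h : coneOut f = coneIn (coneIn f) ≫ rotateInv f := rfl
      have h1 : (toHo Γ).map (coneOut f) ≫ (toHo Γ).map (rotateHom f) =
          (toHo Γ).map (coneIn (coneIn f)) := by
        have h2 : (toHo Γ).map (rotateInv f) ≫ (toHo Γ).map (rotateHom f) = 𝟙 _ :=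
          (isoOfHomotopy (rotateHom f) (rotateInv f) (by ext i g x; rfl)
            (rotate_homotopy f)).inv_hom_id
        rw [h, CategoryTheory.Functor.map_comp, Category.assoc, h2, Category.comp_id]
      exact h1.trans (Category.id_comp _).symm)
    (by
      have h : -(f⟦(1 : ℤ)⟧') = rotateHom f ≫ coneOut (coneIn f) := by ext i g x; rfl
      have h1 : (toHo Γ).map (-(f⟦(1 : ℤ)⟧')) ≫ ((toHo Γ).commShiftIso (1 : ℤ)).hom.app N =
        (toHo Γ).map (rotateHom f) ≫
        (toHo Γ).map (coneOut (coneIn f)) ≫ ((toHo Γ).commShiftIso (1 : ℤ)).hom.app N := by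
        rw [h, CategoryTheory.Functor.map_comp, Category.assoc]
      refine Eq.trans ?_ h1
      refine (congrArg _ (CategoryTheory.Functor.map_id _ _)).trans (Category.comp_id _))

/-- Multiplication by `(-1)^n`, as an automorphism. -/
def signIso (M : DGMod Γ) (n : ℤ) : M ≅ M := by
  refine ⟨dgSign n • 𝟙 M, dgSign n • 𝟙 M, ?_, ?_⟩ <;>
  simp [smul_smul, dgSign.mul_self]

lemma app_zsmul (m : ℤ) (f : M ⟶ N) (i : ℤ) (g : G) (x : M.X i g) :
    app (m • f) i g x = m • app f i g x := by
  have h : (AddMonoidHom.mk' (fun φ : M ⟶ N ↦ app φ i g x) (fun _ _ ↦ rfl)) (m • f) =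
    m • (AddMonoidHom.mk' (fun φ : M ⟶ N ↦ app φ i g x) (fun _ _ ↦ rfl)) f := map_zsmul _ _ _
  exact h

/-- An isomorphism of dg modules from a morphism which is bijective in each degree. -/
def isoOfInverse (f : M ⟶ N) (f' : ∀ i g, N.X i g → M.X i g)
    (h : ∀ i g x, f' i g (app f i g x) = x) (h' : ∀ i g x, app f i g (f' i g x) = x) : M ≅ N :=
  have inj {i g} {x y : M.X i g} (hxy : app f i g x = app f i g y) : x = y := by
    rw [← h i g x, hxy, h]
  mkIso f
    (mkHom (fun i g ↦ AddMonoidHom.mk' (f' i g) (fun x y ↦ inj (by rw [h', map_add, h', h'])))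
      (fun hij g x ↦ inj (by
        rw [app_d]
        exact (h' _ _ _).trans (congrArg _ (h' _ _ _).symm)))
      (fun hi hg x a ↦ inj (by
        rw [app_act]
        exact (h' _ _ _).trans (congrArg (fun y ↦ N.act hi hg y a) (h' _ _ _).symm))))
    h h'

/-- The cone of a shifted morphism. -/
def shiftConeIso (f : M ⟶ N) (n : ℤ) : (cone f)⟦n⟧ ≅ cone (f⟦n⟧') :=
  isoOfInverse
    (mkHom (M := (cone f).shiftObj n) (N := cone (f⟦n⟧'))
      (fun i g ↦ AddMonoidHom.prodMap (AddMonoidHom.id _)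
        (dgSign n • M.castHom (show i + n + 1 = i + 1 + n by omega) g))
      (fun {i j} hij g x ↦ by
        subst hij
        ext
        · change dgSign n • (N.d _ g x.1 + N.castHom _ g (app f _ g x.2)) = dgSign n • N.d _ g x.1 +
            app f (i + 1 + n) g (dgSign n • M.castHom _ g x.2)
          rw [map_zsmul, app_castHom, smul_add]
        · change dgSign n • M.castHom _ g (dgSign n • - M.d _ g x.2) =
            -(dgSign n • M.d _ g (dgSign n • M.castHom _ g x.2))
          rw [map_zsmul, map_zsmul, smul_smul, smul_smul, map_neg, smul_neg,
            ← castHom_d])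
      (fun {i j k g h l} hi hg x a ↦ by
        ext
        · rfl
        · change dgSign n • M.castHom _ _ (M.act _ hg x.2 a) =
            M.act _ hg (dgSign n • M.castHom _ g x.2) a
          rw [map_zsmul, castHom_act M _ (show i + 1 + n + j = k + 1 + n by omega) _ _ hg x.2 a]
          rfl))
    (fun i g x ↦ (x.1, dgSign n • M.castHom (show i + 1 + n = i + n + 1 by omega) g x.2))
    (fun i g ⟨y, (x : M.X (i + n + 1) g)⟩ ↦ by
      refine Prod.ext rfl ?_
      change dgSign n • M.castHom (show i + 1 + n = i + n + 1 by omega) g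
        (dgSign n • M.castHom (show i + n + 1 = i + 1 + n by omega) g x) = x
      rw [map_zsmul, smul_smul, dgSign.mul_self, one_smul, castHom_castHom, castHom_rfl])
    (fun i g ⟨y, x⟩ ↦ by
      have h (x : M.X (i + 1 + n) g) : dgSign n • M.castHom (show i + n + 1 = i + 1 + n by omega) g
          (dgSign n • M.castHom (show i + 1 + n = i + n + 1 by omega) g x) = x := by
        rw [map_zsmul, smul_smul, dgSign.mul_self, one_smul, castHom_castHom, castHom_rfl]
      exact Prod.ext rfl (h x))

/-- A shift of the triangle of `f` is isomorphic to the triangle of the shift of `f`. -/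
def shiftTriangleIso (f : M ⟶ N) (n : ℤ) : (Triangle.shiftFunctor _ n).obj (coneTriangle f) ≅
    coneTriangle (f⟦n⟧') :=
  Triangle.isoMk _ _ (Iso.refl _) (signIso _ n) (shiftConeIso f n)
    (by
      have h : (n.negOnePow • f⟦n⟧') ≫ (dgSign n • 𝟙 (N⟦n⟧)) = f⟦n⟧' := by
        rw [Units.smul_def]
        change (dgSign n • f⟦n⟧') ≫ _ = _
        simp [smul_smul, dgSign.mul_self]
      exact h.trans (Category.id_comp _).symm)
    (by
      have h : (n.negOnePow • (coneIn f)⟦n⟧') ≫ (shiftConeIso f n).hom =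
          (dgSign n • 𝟙 (N⟦n⟧)) ≫ coneIn (f⟦n⟧') := by
        rw [Units.smul_def]
        change (dgSign n • (coneIn f)⟦n⟧') ≫ _ = _
        rw [Preadditive.zsmul_comp, Preadditive.zsmul_comp]
        congr 1
        ext i g x
        · rfl
        · change dgSign n • M.castHom (show i + n + 1 = i + 1 + n by omega) g 0 = 0
          simp
      exact h)
    (by
      have h : (n.negOnePow • (coneOut f)⟦n⟧' ≫ (shiftFunctorComm (DGMod Γ) 1 n).hom.app M) =
          (shiftConeIso f n).hom ≫ coneOut (f⟦n⟧') := by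
        rw [Units.smul_def]
        change dgSign n • _ = _
        ext i g ⟨y, x⟩
        refine (app_zsmul _ _ _ _ _).trans ?_
        refine congrArg (dgSign n • ·) ?_
        exact shiftFunctorComm_hom_app_app 1 n i g x
      refine Eq.trans ?_ h
      refine (congrArg _ (CategoryTheory.Functor.map_id _ _)).trans (Category.comp_id _))

/-! ### The triangulated structure on the homotopy category -/

/-- The triangles of the homotopy category isomorphic to the triangle of a mapping cone. -/
def distinguished (Γ : DGRing G) : Set (Triangle (HoCat Γ)) :=
  {T | ∃ (M N : DGMod Γ) (f : M ⟶ N),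
    Nonempty (T ≅ (toHo Γ).mapTriangle.obj (coneTriangle f))}

lemma isomorphic_distinguished (T₁ : Triangle (HoCat Γ)) (hT₁ : T₁ ∈ distinguished Γ)
    (T₂ : Triangle (HoCat Γ)) (e : T₂ ≅ T₁) : T₂ ∈ distinguished Γ := by
  obtain ⟨X, Y, f, ⟨e'⟩⟩ := hT₁
  exact ⟨X, Y, f, ⟨e ≪≫ e'⟩⟩

lemma isZero_cone_id (M : DGMod Γ) : IsZero ((toHo Γ).obj (cone (𝟙 M))) := by
  rw [IsZero.iff_id_eq_zero, ← CategoryTheory.Functor.map_id, toHo_map_eq_zero_iff]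
  exact id_cone_mem M

lemma contractible_distinguished (X : HoCat Γ) : contractibleTriangle X ∈ distinguished Γ := by
  obtain ⟨M⟩ := X
  refine ⟨_, _, 𝟙 M, ⟨?_⟩⟩
  refine Triangle.isoMk _ _ (Iso.refl _) (Iso.refl _) (isZero_cone_id M).isoZero.symm
    ?_ ((isZero_cone_id M).eq_of_tgt _ _) ?_
  · have : 𝟙 ((toHo Γ).obj M) = (toHo Γ).map (𝟙 M) := (CategoryTheory.Functor.map_id _ _).symm
    exact (Category.comp_id _).trans (this.trans (Category.id_comp _).symm)
  · exact (isZero_zero _).eq_of_src _ _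

lemma coneTriangle_distinguished (f : M ⟶ N) :
    (toHo Γ).mapTriangle.obj (coneTriangle f) ∈ distinguished Γ := ⟨_, _, f, ⟨Iso.refl _⟩⟩

lemma distinguished_cocone_triangle {X Y : HoCat Γ} (f : X ⟶ Y) :
    ∃ (Z : HoCat Γ) (g : Y ⟶ Z) (h : Z ⟶ X⟦(1 : ℤ)⟧), Triangle.mk f g h ∈ distinguished Γ := by
  obtain ⟨f, rfl⟩ := (toHo Γ).map_surjective f
  exact ⟨_, _, _, coneTriangle_distinguished f⟩

lemma rotate_distinguished (T : Triangle (HoCat Γ)) (hT : T ∈ distinguished Γ) :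
    T.rotate ∈ distinguished Γ := by
  obtain ⟨K, L, φ, ⟨e⟩⟩ := hT
  exact ⟨_, _, _, ⟨(rotate _).mapIso e ≪≫ ((toHo Γ).mapTriangleRotateIso).app (coneTriangle φ) ≪≫
    rotateIso φ⟩⟩

lemma shift_distinguished (T : Triangle (HoCat Γ)) (hT : T ∈ distinguished Γ) (n : ℤ) :
    (Triangle.shiftFunctor _ n).obj T ∈ distinguished Γ := by
  obtain ⟨K, L, φ, ⟨e⟩⟩ := hT
  exact ⟨_, _, _, ⟨Functor.mapIso _ e ≪≫
    ((toHo Γ).mapTriangle.commShiftIso n).symm.app (coneTriangle φ) ≪≫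
    (toHo Γ).mapTriangle.mapIso (shiftTriangleIso φ n)⟩⟩

lemma invRotate_distinguished (T : Triangle (HoCat Γ)) (hT : T ∈ distinguished Γ) :
    T.invRotate ∈ distinguished Γ :=
  isomorphic_distinguished _
    (shift_distinguished _ (rotate_distinguished _ (rotate_distinguished _ hT)) _) _
    ((invRotateIsoRotateRotateShiftFunctorNegOne _).app T)

lemma complete_of_iso {C : Type*} [Category C] [HasShift C ℤ] {T₁ T₂ S₁ S₂ : Triangle C}
    (e₁ : T₁ ≅ S₁) (e₂ : T₂ ≅ S₂)
    (h : ∀ (a : S₁.obj₁ ⟶ S₂.obj₁) (b : S₁.obj₂ ⟶ S₂.obj₂), S₁.mor₁ ≫ b = a ≫ S₂.mor₁ →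
      ∃ m : S₁ ⟶ S₂, m.hom₁ = a ∧ m.hom₂ = b)
    (a : T₁.obj₁ ⟶ T₂.obj₁) (b : T₁.obj₂ ⟶ T₂.obj₂) (fac : T₁.mor₁ ≫ b = a ≫ T₂.mor₁) :
    ∃ (c : T₁.obj₃ ⟶ T₂.obj₃), T₁.mor₂ ≫ c = b ≫ T₂.mor₂ ∧
      T₁.mor₃ ≫ a⟦(1 : ℤ)⟧' = c ≫ T₂.mor₃ := by
  obtain ⟨m, hm₁, hm₂⟩ := h (e₁.inv.hom₁ ≫ a ≫ e₂.hom.hom₁) (e₁.inv.hom₂ ≫ b ≫ e₂.hom.hom₂) (by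
    have c₁ := e₁.inv.comm₁
    have c₂ := e₂.hom.comm₁
    rw [← Category.assoc, c₁, Category.assoc, Category.assoc, Category.assoc, ← c₂,
      ← Category.assoc T₁.mor₁, fac, Category.assoc])
  let γ := e₁.hom ≫ m ≫ e₂.inv
  have h₁ : γ.hom₁ = a := by simp [γ, hm₁]
  have h₂ : γ.hom₂ = b := by simp [γ, hm₂]
  refine ⟨γ.hom₃, ?_, ?_⟩
  · rw [γ.comm₂, h₂]
  · rw [← γ.comm₃, h₁]

lemma complete_distinguished (T₁ T₂ : Triangle (HoCat Γ))
    (hT₁ : T₁ ∈ distinguished Γ) (hT₂ : T₂ ∈ distinguished Γ)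
    (a : T₁.obj₁ ⟶ T₂.obj₁) (b : T₁.obj₂ ⟶ T₂.obj₂) (fac : T₁.mor₁ ≫ b = a ≫ T₂.mor₁) :
    ∃ (c : T₁.obj₃ ⟶ T₂.obj₃), T₁.mor₂ ≫ c = b ≫ T₂.mor₂ ∧
      T₁.mor₃ ≫ a⟦(1 : ℤ)⟧' = c ≫ T₂.mor₃ := by
  obtain ⟨M₁, N₁, f₁, ⟨e₁⟩⟩ := hT₁
  obtain ⟨M₂, N₂, f₂, ⟨e₂⟩⟩ := hT₂
  refine complete_of_iso e₁ e₂ (fun a' b' hab ↦ ?_) a b fac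
  obtain ⟨a'', rfl⟩ := (toHo Γ).map_surjective (X := M₁) (Y := M₂) a'
  obtain ⟨b'', rfl⟩ := (toHo Γ).map_surjective (X := N₁) (Y := N₂) b'
  have hab' : (toHo Γ).map f₁ ≫ (toHo Γ).map b'' = (toHo Γ).map a'' ≫ (toHo Γ).map f₂ := hab
  have H : f₁ ≫ b'' - a'' ≫ f₂ ∈ nullHomotopic M₁ N₂ := by
    rw [← toHo_map_eq_zero_iff, CategoryTheory.Functor.map_sub, sub_eq_zero,
      CategoryTheory.Functor.map_comp, CategoryTheory.Functor.map_comp, hab']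
  obtain ⟨c, hc₂, hc₃⟩ := exists_coneMap f₁ f₂ a'' b'' H
  have hc₂' : (toHo Γ).map (coneIn f₁) ≫ (toHo Γ).map c =
      (toHo Γ).map b'' ≫ (toHo Γ).map (coneIn f₂) := by
    rw [← CategoryTheory.Functor.map_comp, ← CategoryTheory.Functor.map_comp, hc₂]
  have hc₃' : ((toHo Γ).map (coneOut f₁) ≫ ((toHo Γ).commShiftIso (1 : ℤ)).hom.app M₁) ≫
      ((toHo Γ).map a'')⟦(1 : ℤ)⟧' = (toHo Γ).map c ≫
      ((toHo Γ).map (coneOut f₂) ≫ ((toHo Γ).commShiftIso (1 : ℤ)).hom.app M₂) := by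
    rw [Category.assoc, ← Functor.commShiftIso_hom_naturality]
    rw [← Category.assoc, ← CategoryTheory.Functor.map_comp, hc₃, CategoryTheory.Functor.map_comp,
      Category.assoc]
  exact ⟨{ hom₁ := (toHo Γ).map a'', hom₂ := (toHo Γ).map b'', hom₃ := (toHo Γ).map c
           comm₁ := hab, comm₂ := hc₂', comm₃ := hc₃' }, rfl, rfl⟩

instance : Pretriangulated (HoCat Γ) where
  distinguishedTriangles := distinguished Γ
  isomorphic_distinguished := isomorphic_distinguished
  contractible_distinguished := contractible_distinguished
  distinguished_cocone_triangle := distinguished_cocone_triangle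
  rotate_distinguished_triangle T := ⟨rotate_distinguished T, fun hT ↦
    isomorphic_distinguished _ (invRotate_distinguished T.rotate hT) _
      ((triangleRotation _).unitIso.app T)⟩
  complete_distinguished_triangle_morphism := complete_distinguished

/-- The comparison between the cone of `g` and the cone of `cone f ⟶ cone (f ≫ g)`. -/
def octaHom (f : M ⟶ N) (g : N ⟶ P) :
    cone g ⟶ cone (coneMap f (f ≫ g) (𝟙 M) g (by simp)) :=
  mkHom (M := cone g) (N := cone (coneMap f (f ≫ g) (𝟙 M) g (by simp)))
    (fun i _ ↦ AddMonoidHom.prodMap (AddMonoidHom.inl _ _) (AddMonoidHom.inl _ _))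
    (fun {i j} hij h x ↦ by
      subst hij
      ext
      · change P.d rfl h x.1 + app g _ h x.2 = P.d rfl h x.1 + app g _ h (app f _ h 0) +
          app g _ h x.2
        simp
      · change (0 : M.X _ h) = -M.d rfl h 0 + 0
        simp
      · change - N.d rfl h x.2 = -(N.d rfl h x.2 + app f _ h 0)
        simp
      · change (0 : M.X _ h) = -(-M.d rfl h 0)
        simp)
    (fun hi hg x a ↦ by
      ext
      · rfl
      · change 0 = M.act _ hg 0 a
        simp
      · rfl
      · change 0 = M.act _ hg 0 a
        simp)

/-- The homotopy inverse of `octaHom`. -/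
def octaInv (f : M ⟶ N) (g : N ⟶ P) :
    cone (coneMap f (f ≫ g) (𝟙 M) g (by simp)) ⟶ cone g :=
  mkHom (N := cone g) (M := cone (coneMap f (f ≫ g) (𝟙 M) g (by simp)))
    (fun i h ↦ AddMonoidHom.prod ((AddMonoidHom.fst _ _).comp (AddMonoidHom.fst _ _))
      ((AddMonoidHom.fst _ _).comp (AddMonoidHom.snd _ _) +
        (app f (i + 1) h).comp ((AddMonoidHom.snd _ _).comp (AddMonoidHom.fst _ _))))
    (fun {i j} hij h x ↦ by
      subst hij
      obtain ⟨⟨z, x⟩, ⟨y, x'⟩⟩ := x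
      ext
      · change P.d rfl h z + app g _ h (app f _ h x) + app g _ h y =
          P.d rfl h z + app g _ h (y + app f _ h x)
        rw [map_add]; abel
      · change -(N.d rfl h y + app f _ h x') + app f _ h (- M.d rfl h x + x') =
          -N.d rfl h (y + app f _ h x)
        simp only [map_add, map_neg, app_d]; abel)
    (fun hi hg x a ↦ by
      ext
      · rfl
      · simp [app_act])

lemma octa_homotopy (f : M ⟶ N) (g : N ⟶ P) :
    octaInv f g ≫ octaHom f g - 𝟙 _ ∈ nullHomotopic _ _ := by
  refine ⟨fun {i j} h l ↦
    { toFun := fun y ↦ ((0 : (cone (f ≫ g)).X j l), ((0 : N.X (j + 1) l),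
        -M.castHom (show i + 1 = j + 1 + 1 by omega) l y.1.2))
      map_zero' := by ext <;> simp
      map_add' := fun y z ↦ by
        ext
        · simp
        · simp
        · simp
        · simp; abel }, ?_, ?_⟩
  · intro i i' j k k' g h l hi hk e e' hg x a
    subst hi hk
    ext <;> simp
  · intro i j k hj hk l x
    subst hj hk
    obtain ⟨⟨z, x⟩, ⟨y, x'⟩⟩ := x
    ext
    · change z - z = P.d rfl l 0 + app g _ l (app f _ l 0) + app g _ l 0 + 0
      simp
    · change 0 - x = - M.d rfl l 0 + - x + 0
      simp
    · change y + app f _ l x - y = -(N.d rfl l 0 + app f _ l (-x)) + 0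
      simp
    · change 0 - x' = - - M.d rfl l (-x) + -(-M.d rfl l x + x')
      simp

lemma octa_distinguished (f : M ⟶ N) (g : N ⟶ P) :
    (toHo Γ).mapTriangle.obj (Triangle.mk (coneMap f (f ≫ g) (𝟙 M) g (by simp))
      (coneMap (f ≫ g) g f (𝟙 P) (by simp)) (coneOut g ≫ (coneIn f)⟦(1 : ℤ)⟧')) ∈
      distinguished Γ := by
  refine ⟨_, _, coneMap f (f ≫ g) (𝟙 M) g (by simp), ⟨?_⟩⟩
  have h0 : octaHom f g ≫ octaInv f g = 𝟙 _ := by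
    ext i h x
    · rfl
    · change x.2 + app f _ h 0 = x.2
      simp
  refine Triangle.isoMk _ _ (Iso.refl _) (Iso.refl _)
    (isoOfHomotopy (octaHom f g) (octaInv f g) h0 (octa_homotopy f g)) ?_ ?_ ?_
  · exact (Category.comp_id _).trans (Category.id_comp _).symm
  · have h1 : coneMap (f ≫ g) g f (𝟙 P) (by simp) =
      coneIn (coneMap f (f ≫ g) (𝟙 M) g (by simp)) ≫ octaInv f g := by
      ext i h x
      · rfl
      · change app f _ h x.2 = 0 + app f _ h x.2
        simp
    have h2 : (toHo Γ).map (octaInv f g) ≫ (toHo Γ).map (octaHom f g) = 𝟙 _ :=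
      (isoOfHomotopy (octaHom f g) (octaInv f g) h0 (octa_homotopy f g)).inv_hom_id
    have h3 : (toHo Γ).map (coneMap (f ≫ g) g f (𝟙 P) (by simp)) ≫ (toHo Γ).map (octaHom f g) =
        (toHo Γ).map (coneIn (coneMap f (f ≫ g) (𝟙 M) g (by simp))) := by
      rw [h1, CategoryTheory.Functor.map_comp, Category.assoc, h2, Category.comp_id]
    exact h3.trans (Category.id_comp _).symm
  · have h1 : coneOut g ≫ (coneIn f)⟦(1 : ℤ)⟧' =
      octaHom f g ≫ coneOut (coneMap f (f ≫ g) (𝟙 M) g (by simp)) := rfl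
    have h3 : (toHo Γ).map (coneOut g ≫ (coneIn f)⟦(1 : ℤ)⟧') ≫
        ((toHo Γ).commShiftIso (1 : ℤ)).hom.app (cone f) = (toHo Γ).map (octaHom f g) ≫
        (toHo Γ).map (coneOut (coneMap f (f ≫ g) (𝟙 M) g (by simp))) ≫
        ((toHo Γ).commShiftIso (1 : ℤ)).hom.app (cone f) := by
      rw [h1, CategoryTheory.Functor.map_comp, Category.assoc]
    refine Eq.trans ?_ h3
    exact (congrArg _ (CategoryTheory.Functor.map_id _ _)).trans (Category.comp_id _)

lemma coneTriangle_mem (f : M ⟶ N) : Triangle.mk ((toHo Γ).map f) ((toHo Γ).map (coneIn f))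
    ((toHo Γ).map (coneOut f) ≫ ((toHo Γ).commShiftIso (1 : ℤ)).hom.app M) ∈ distTriang (HoCat Γ) :=
  coneTriangle_distinguished f

lemma coneTriangle_mem' (f : M ⟶ N) (g : N ⟶ P) :
    Triangle.mk ((toHo Γ).map f ≫ (toHo Γ).map g) ((toHo Γ).map (coneIn (f ≫ g)))
    ((toHo Γ).map (coneOut (f ≫ g)) ≫ ((toHo Γ).commShiftIso (1 : ℤ)).hom.app M) ∈
      distTriang (HoCat Γ) := by
  rw [← CategoryTheory.Functor.map_comp]
  exact coneTriangle_mem _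

lemma map_comp_eq {A B B' C : DGMod Γ} {a : A ⟶ B} {b : B ⟶ C} {a' : A ⟶ B'} {b' : B' ⟶ C}
    (h : a ≫ b = a' ≫ b') : (toHo Γ).map a ≫ (toHo Γ).map b =
      (toHo Γ).map a' ≫ (toHo Γ).map b' := by
  rw [← CategoryTheory.Functor.map_comp, h, CategoryTheory.Functor.map_comp]

/-- The octahedron of two composable morphisms. -/
def octahedron (f : M ⟶ N) (g : N ⟶ P) : Triangulated.Octahedron rfl (coneTriangle_mem f)
    (coneTriangle_mem g) (coneTriangle_mem' f g) where
  m₁ := (toHo Γ).map (coneMap f (f ≫ g) (𝟙 M) g (by simp))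
  m₃ := (toHo Γ).map (coneMap (f ≫ g) g f (𝟙 P) (by simp))
  comm₁ := map_comp_eq rfl
  comm₂ := by
    have h : coneMap f (f ≫ g) (𝟙 M) g (by simp) ≫ coneOut (f ≫ g) = coneOut f := rfl
    exact (Category.assoc _ _ _).symm.trans
      (congrArg (· ≫ _) ((CategoryTheory.Functor.map_comp _ _ _).symm.trans (congrArg _ h)))
  comm₃ := by
    have h : coneIn (f ≫ g) ≫ coneMap (f ≫ g) g f (𝟙 P) (by simp) = coneIn g := by
      ext i l x
      · rfl
      · change app f _ l 0 = 0
        simp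
    exact (CategoryTheory.Functor.map_comp _ _ _).symm.trans (congrArg _ h)
  comm₄ := by
    have h : coneOut (f ≫ g) ≫ f⟦(1 : ℤ)⟧' = coneMap (f ≫ g) g f (𝟙 P) (by simp) ≫ coneOut g := rfl
    change ((toHo Γ).map (coneOut (f ≫ g)) ≫ ((toHo Γ).commShiftIso (1 : ℤ)).hom.app M) ≫
      ((toHo Γ).map f)⟦(1 : ℤ)⟧' = (toHo Γ).map (coneMap (f ≫ g) g f (𝟙 P) (by simp)) ≫
        ((toHo Γ).map (coneOut g) ≫ ((toHo Γ).commShiftIso (1 : ℤ)).hom.app N)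
    rw [Category.assoc, ← Functor.commShiftIso_hom_naturality, ← Category.assoc, map_comp_eq h,
      Category.assoc]
  mem := by
    have := octa_distinguished f g
    have h : (toHo Γ).map (coneOut g ≫ (coneIn f)⟦(1 : ℤ)⟧') ≫
        ((toHo Γ).commShiftIso (1 : ℤ)).hom.app (cone f) =
        ((toHo Γ).map (coneOut g) ≫ ((toHo Γ).commShiftIso (1 : ℤ)).hom.app N) ≫
        ((toHo Γ).map (coneIn f))⟦(1 : ℤ)⟧' := by
      rw [CategoryTheory.Functor.map_comp, Category.assoc, Category.assoc,
        ← Functor.commShiftIso_hom_naturality]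
    change Triangle.mk _ _ ((toHo Γ).map (coneOut g ≫ (coneIn f)⟦(1 : ℤ)⟧') ≫
        ((toHo Γ).commShiftIso (1 : ℤ)).hom.app (cone f)) ∈ _ at this
    rw [h] at this
    exact this

instance : IsTriangulated (HoCat Γ) :=
  IsTriangulated.mk' (by
    rintro ⟨X₁⟩ ⟨X₂⟩ ⟨X₃⟩ u₁₂' u₂₃'
    obtain ⟨f, rfl⟩ := (toHo Γ).map_surjective (X := X₁) (Y := X₂) u₁₂'
    obtain ⟨g, rfl⟩ := (toHo Γ).map_surjective (X := X₂) (Y := X₃) u₂₃'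
    exact ⟨_, _, _, _, _, _, _, _, Iso.refl _, Iso.refl _, Iso.refl _,
        (Category.comp_id _).trans (Category.id_comp _).symm,
        (Category.comp_id _).trans (Category.id_comp _).symm,
        _, _, coneTriangle_mem f, _, _, coneTriangle_mem g,
        _, _, coneTriangle_mem' f g, ⟨octahedron f g⟩⟩)

end DGMod

/-! ### Thick subcategories, weak semi-orthogonal decompositions, Verdier quotients -/

section Triangulated

variable {C : Type*} [Category C] [HasZeroObject C] [HasShift C ℤ] [Preadditive C]
  [∀ n : ℤ, (shiftFunctor C n).Additive] [Pretriangulated C]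

/-- The thick subcategory generated by a class of objects: the intersection of all triangulated
subcategories stable under direct summands which contain it. -/
def thick (S : ObjectProperty C) : ObjectProperty C := fun X ↦
  ∀ Q : ObjectProperty C, Q.IsTriangulated → Q.IsStableUnderRetracts → S ≤ Q → Q X

lemma thick_mono {S S' : ObjectProperty C} (h : S ≤ S') : thick S ≤ thick S' :=
  fun _ hX Q hQ hQ' hS ↦ hX Q hQ hQ' (h.trans hS)

instance (S : ObjectProperty C) : (thick S).IsStableUnderRetracts where
  of_retract r hY Q hQ hQ' hS := hQ'.of_retract r (hY Q hQ hQ' hS)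

instance (S : ObjectProperty C) : (thick S).IsTriangulated where
  exists_zero := ⟨_, isZero_zero C, fun Q _ _ _ ↦ Q.prop_of_isZero (isZero_zero C)⟩
  isStableUnderShiftBy a := ⟨fun _ hX Q hQ hQ' hS ↦ Q.le_shift a _ (hX Q hQ hQ' hS)⟩
  toIsTriangulatedClosed₂ := .mk' fun T hT h₁ h₃ Q hQ hQ' hS ↦
    Q.ext_of_isTriangulatedClosed₂ T hT (h₁ Q hQ hQ' hS) (h₃ Q hQ hQ' hS)

/-- The full subcategories `X`, `Y`, `Z` of a triangulated category form a weak semi-orthogonal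
decomposition `T = X ⊥ Y ⊥ Z`: they are thick subcategories of `T`, there are no nonzero morphisms
from `X` to `Y`, from `X` to `Z` and from `Y` to `Z`, and `T = X * Y * Z`, where an object `E`
belongs to `X * Y` if it is the middle term of a distinguished triangle whose first term is in `X`
and whose third term is in `Y`. -/
structure IsWeakSOD (T X Y Z : ObjectProperty C) : Prop where
  isTriangulated₁ : X.IsTriangulated
  isTriangulated₂ : Y.IsTriangulated
  isTriangulated₃ : Z.IsTriangulated
  isStableUnderRetracts₁ : X.IsStableUnderRetracts
  isStableUnderRetracts₂ : Y.IsStableUnderRetracts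
  isStableUnderRetracts₃ : Z.IsStableUnderRetracts
  hom_eq_zero₁₂ : ∀ {E F : C}, X E → Y F → ∀ f : E ⟶ F, f = 0
  hom_eq_zero₁₃ : ∀ {E F : C}, X E → Z F → ∀ f : E ⟶ F, f = 0
  hom_eq_zero₂₃ : ∀ {E F : C}, Y E → Z F → ∀ f : E ⟶ F, f = 0
  eq_extensionProduct : T = (X.extensionProduct Y).extensionProduct Z

/-- Two triangulated categories are triangle equivalent. -/
def TriangleEquivalent (C D : Type*) [Category C] [HasZeroObject C] [HasShift C ℤ] [Preadditive C]
    [∀ n : ℤ, (shiftFunctor C n).Additive] [Pretriangulated C] [Category D] [HasZeroObject D]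
    [HasShift D ℤ] [Preadditive D] [∀ n : ℤ, (shiftFunctor D n).Additive] [Pretriangulated D] :
    Prop :=
  ∃ (F : C ⥤ D) (_ : F.CommShift ℤ), F.IsTriangulated ∧ F.IsEquivalence

variable [IsTriangulated C] (P : ObjectProperty C) [P.IsTriangulated]

/-- The Verdier quotient of a triangulated category by a triangulated subcategory: the localization
at the morphisms whose cone belongs to the subcategory. -/
abbrev VerdierQuotient := P.trW.Localization

/-- The quotient functor. -/
abbrev verdierQ : C ⥤ VerdierQuotient P := P.trW.Q

instance (n : ℤ) : (shiftFunctor (VerdierQuotient P) n).Additive := inferInstance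

instance : Pretriangulated (VerdierQuotient P) := inferInstance

instance : IsTriangulated (VerdierQuotient P) := inferInstance

instance : (verdierQ P).IsTriangulated := inferInstance

end Triangulated

/-! ### Constructions with graded dg rings -/

namespace DGRing

/-- The opposite graded dg ring, with multiplication `a * b = (-1)^{|a||b|} b a`. -/
def op (Γ : DGRing G) : DGRing G where
  X := Γ.X
  d := Γ.d
  one := Γ.one
  mul {i j k g h l} hi hg :=
    dgSign (i * j) • (Γ.mul ((add_comm j i).trans hi) ((add_comm h g).trans hg)).flip
  d_d := Γ.d_d
  one_mul x := by
    simpa using Γ.mul_one x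
  mul_one x := by
    simpa using Γ.one_mul x
  mul_assoc {i₁ i₂ i₃ i₁₂ i₂₃ i g₁ g₂ g₃ g₁₂ g₂₃ g} h₁₂ h₂₃ h h' e₁₂ e₂₃ e e' x y z := by
    simp only [AddMonoidHom.smul_apply, AddMonoidHom.flip_apply, map_zsmul, smul_smul]
    rw [Γ.mul_assoc (i₁₂ := i₂₃) (i₂₃ := i₁₂) (g₁₂ := g₂₃) (g₂₃ := g₁₂) (by omega) (by omega)
      (by omega) (by omega) (by rw [add_comm, e₂₃]) (by rw [add_comm, e₁₂]) (by rw [add_comm, e'])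
      (by rw [add_comm, e]) z y x, ← dgSign.add, ← dgSign.add]
    congr 2
    subst h₁₂ h₂₃
    ring
  d_mul {i i' j j' k k' g h l} hi hj hk h₁ h₂ h₃ e x y := by
    simp only [AddMonoidHom.smul_apply, AddMonoidHom.flip_apply, map_zsmul, smul_smul]
    rw [Γ.d_mul hj hi hk (by omega) (by omega) (by omega) (by rw [add_comm, e]) y x, smul_add,
      smul_smul, add_comm, ← dgSign.add, ← dgSign.add]
    subst hi hj
    congr 2
    · congr 1; ring
    · rw [show i + i * (j + 1) = i * j + (i + i) by ring, dgSign.add _ (i + i), dgSign.add i i,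
        dgSign.mul_self, _root_.mul_one]

/-- The dg ring `Γ` vanishes outside the non-negative part of the grading group. -/
def IsNonneg [PartialOrder G] (Γ : DGRing G) : Prop :=
  ∀ (i : ℤ) (g : G), ¬ 0 ≤ g → ∀ x : Γ.X i g, x = 0

lemma IsNonneg.op [PartialOrder G] {Γ : DGRing G} (h : Γ.IsNonneg) : Γ.op.IsNonneg := h

/-- The unit, as an element of degree `g` when `g = 0`. -/
def oneOf (Γ : DGRing G) {g : G} (h : 0 = g) : Γ.X 0 g := h ▸ Γ.one

lemma oneOf_mul (Γ : DGRing G) {i : ℤ} {g h : G} (e : 0 = g) (e' : g + h = h) (x : Γ.X i h) :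
    Γ.mul (zero_add i) e' (Γ.oneOf e) x = x := by
  subst e; exact Γ.one_mul x

lemma mul_oneOf (Γ : DGRing G) {i : ℤ} {g h : G} (e : 0 = g) (e' : h + g = h) (x : Γ.X i h) :
    Γ.mul (add_zero i) e' x (Γ.oneOf e) = x := by
  subst e; exact Γ.mul_one x

open Classical in
/-- The dg ring of matrices with rows and columns indexed by the finite set `s`, whose `(a, b)`
entries are the elements of `Γ` of degree `w a - w b`.  It carries no grading besides the cohomological one,
i.e. it is graded by the trivial group. -/
def matrix (Γ : DGRing G) (s : Finset G) (w : G → G) : DGRing PUnit.{u + 1} where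
  X i _ := ∀ a b : s, Γ.X i (w a - w b)
  d h _ := AddMonoidHom.mk' (fun x a b ↦ Γ.d h _ (x a b)) (by intros; ext; simp)
  one a b := if h : a = b then Γ.oneOf (by rw [h, sub_self]) else 0
  mul hi _ := AddMonoidHom.mk' (fun x ↦ AddMonoidHom.mk'
      (fun y a c ↦ ∑ b, Γ.mul hi (sub_add_sub_cancel _ _ _) (x a b) (y b c))
      (by intros; ext; simp [Finset.sum_add_distrib]))
      (by intros; ext; simp [Finset.sum_add_distrib])
  d_d hi hj _ x := by ext; simp [Γ.d_d]
  one_mul {i _} x := by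
    ext a c
    refine (Finset.sum_eq_single a (fun b _ hb ↦ ?_) (by simp)).trans ?_
    · simp [dif_neg (Ne.symm hb)]
    · simp only [dite_true]
      exact Γ.oneOf_mul _ _ _
  mul_one {i _} x := by
    ext a c
    refine (Finset.sum_eq_single c (fun b _ hb ↦ ?_) (by simp)).trans ?_
    · simp [dif_neg hb]
    · simp only [dite_true]
      exact Γ.mul_oneOf _ _ _
  mul_assoc h₁₂ h₂₃ h h' _ _ _ _ x y z := by
    ext a c
    simp only [AddMonoidHom.mk'_apply, map_sum, AddMonoidHom.finsetSum_apply]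
    rw [Finset.sum_comm]
    refine Finset.sum_congr rfl fun b _ ↦ Finset.sum_congr rfl fun b' _ ↦ ?_
    exact Γ.mul_assoc _ _ _ _ _ _ _ _ _ _ _
  d_mul hi hj hk h₁ h₂ h₃ _ x y := by
    ext a c
    simp only [AddMonoidHom.mk'_apply, map_sum, Pi.add_apply, Pi.smul_apply, Finset.smul_sum,
      ← Finset.sum_add_distrib]
    refine Finset.sum_congr rfl fun b _ ↦ ?_
    exact Γ.d_mul _ _ _ _ _ _ _ _ _

end DGRing

namespace DGMod

variable {Γ : DGRing G} {M N P : DGMod Γ}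

/-! ### Acyclic dg modules and the derived category -/

/-- The cohomology of `M` vanishes in degree `g` of the grading group. -/
def ExactAt (M : DGMod Γ) (g : G) : Prop :=
  ∀ {i j k : ℤ} (hi : i + 1 = j) (hj : j + 1 = k) (x : M.X j g), M.d hj g x = 0 →
    ∃ y : M.X i g, M.d hi g y = x

/-- The cohomology of `M` vanishes in all degrees outside `S`. -/
def SupportedOn (M : DGMod Γ) (S : Set G) : Prop := ∀ g ∉ S, M.ExactAt g

/-- A dg module is acyclic if its cohomology vanishes. -/
def Acyclic (M : DGMod Γ) : Prop := ∀ g, M.ExactAt g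

lemma exactAt_of_homotopy (a : M ⟶ N) (b : N ⟶ M) (h : b ≫ a - 𝟙 N ∈ nullHomotopic N N) {g : G}
    (hM : M.ExactAt g) : N.ExactAt g := by
  obtain ⟨s, hs, hs'⟩ := h
  intro i j k hi hj x hx
  obtain ⟨y, hy⟩ := hM hi hj (app b j g x) (by rw [← app_d, hx, map_zero])
  refine ⟨app a i g y - s hi g x, ?_⟩
  have h := hs' hi hj g x
  have h' : app a j g (app b j g x) - x = app (b ≫ a - 𝟙 N) j g x := rfl
  rw [hx, map_zero, add_zero] at h
  rw [map_sub, ← app_d, hy, ← h, ← h', sub_sub_cancel]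

/-- The full subcategory of acyclic dg modules in the homotopy category. -/
def acyclic (Γ : DGRing G) : ObjectProperty (HoCat Γ) := fun X ↦ Acyclic X.as

instance : (acyclic Γ).IsClosedUnderIsomorphisms where
  of_iso {X Y} e hX := by
    obtain ⟨M⟩ := X
    obtain ⟨N⟩ := Y
    obtain ⟨a, ha⟩ := (toHo Γ).map_surjective (X := M) (Y := N) e.hom
    obtain ⟨b, hb⟩ := (toHo Γ).map_surjective (X := N) (Y := M) e.inv
    have h : b ≫ a - 𝟙 N ∈ nullHomotopic N N := by
      rw [← toHo_map_eq_zero_iff, CategoryTheory.Functor.map_sub, sub_eq_zero,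
        CategoryTheory.Functor.map_comp, ha, hb, CategoryTheory.Functor.map_id]
      exact e.inv_hom_id
    exact fun g ↦ exactAt_of_homotopy a b h (hX g)

lemma acyclic_shiftObj (h : M.Acyclic) (n : ℤ) : (M.shiftObj n).Acyclic := by
  intro g i j k hi hj x hx
  obtain ⟨y, hy⟩ := h g (show i + n + 1 = j + n by omega) (show j + n + 1 = k + n by omega) x (by
    have : dgSign n • (M.shiftObj n).d hj g x = 0 := by rw [hx, smul_zero]
    rw [shiftObj_d, smul_smul, dgSign.mul_self, one_smul] at this
    exact this)
  refine ⟨dgSign n • y, ?_⟩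
  rw [shiftObj_d, map_zsmul, smul_smul, dgSign.mul_self, one_smul, hy]

lemma acyclic_of_cone (f : M ⟶ N) (hM : M.Acyclic) (hf : (cone f).Acyclic) : N.Acyclic := by
  intro g i j k hi hj x hx
  subst hi hj
  obtain ⟨⟨y, m⟩, h⟩ := hf g rfl rfl ((x, 0) : (cone f).X (i + 1) g) (by
    ext
    · change N.d rfl g x + app f _ g 0 = 0
      simp [hx]
    · change - M.d rfl g 0 = 0
      simp)
  have h₁ : N.d rfl g y + app f (i + 1) g m = x := congrArg Prod.fst h
  have h₂ : - M.d rfl g m = 0 := congrArg Prod.snd h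
  obtain ⟨m', hm'⟩ := hM g (show i + 1 = i + 1 from rfl) rfl m (neg_eq_zero.1 h₂)
  exact ⟨y + app f i g m', by rw [map_add, ← app_d, hm', h₁]⟩

instance : (acyclic Γ).IsTriangulated where
  exists_zero := ⟨(toHo Γ).obj (zeroMod Γ), (toHo Γ).map_isZero (isZero_zeroMod Γ),
    fun _ _ _ _ _ _ _ _ ↦ ⟨0, rfl⟩⟩
  isStableUnderShiftBy n := ⟨fun X hX ↦
    (acyclic Γ).prop_of_iso (((toHo Γ).commShiftIso n).app X.as) (acyclic_shiftObj hX n)⟩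
  toIsTriangulatedClosed₂ := .mk' (by
    rintro T ⟨M, N, f, ⟨e⟩⟩ h₁ h₃
    have h₁' := (acyclic Γ).prop_of_iso (Triangle.π₁.mapIso e) h₁
    have h₃' := (acyclic Γ).prop_of_iso (Triangle.π₃.mapIso e) h₃
    exact (acyclic Γ).prop_of_iso (Triangle.π₂.mapIso e).symm (acyclic_of_cone f h₁' h₃'))

/-- The derived category of `G`-graded right dg modules. -/
abbrev Derived (Γ : DGRing G) := VerdierQuotient (acyclic Γ)

/-- A dg module, viewed as an object of the derived category. -/
def toD (M : DGMod Γ) : Derived Γ := (verdierQ (acyclic Γ)).obj ((toHo Γ).obj M)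

/-! ### Constructions with dg modules -/

/-- The grading shift `M(g)`, where `M(g)_h = M_{g+h}`. -/
def twist (M : DGMod Γ) (g : G) : DGMod Γ where
  X i h := M.X i (g + h)
  d hi h := M.d hi (g + h)
  act {i j k h h' l} hi hg := M.act hi (by rw [add_assoc, hg])
  d_d hi hj h x := M.d_d hi hj _ x
  act_one {i h} x := by
    have := M.act_one x
    simpa using this
  act_assoc h₁₂ h₂₃ h h' e₁₂ e₂₃ e e' x a b := M.act_assoc _ _ _ _ _ _ _ _ x a b
  d_act hi hj hk h₁ h₂ h₃ e x a := M.d_act _ _ _ _ _ _ _ x a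

/-- The dg ring `Γ` as a right dg module over itself. -/
def regular (Γ : DGRing G) : DGMod Γ where
  X := Γ.X
  d := Γ.d
  act := Γ.mul
  d_d := Γ.d_d
  act_one := Γ.mul_one
  act_assoc := Γ.mul_assoc
  d_act := Γ.d_mul

/-- The subgroup of `Γ^i_g` which is zero if `g = 0`, and everything otherwise. -/
def nonzeroPart (Γ : DGRing G) (i : ℤ) (g : G) : AddSubgroup (Γ.X i g) where
  carrier := {x | g = 0 → x = 0}
  add_mem' ha hb h := by rw [ha h, hb h, add_zero]
  zero_mem' _ := rfl
  neg_mem' ha h := by rw [ha h, neg_zero]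

lemma mul_mem_nonzeroPart [PartialOrder G] [IsOrderedAddMonoid G] (hΓ : Γ.IsNonneg) {i j k : ℤ}
    {g h l : G} (hi : i + j = k) (hg : g + h = l) {x : Γ.X i g} (hx : x ∈ nonzeroPart Γ i g)
    (a : Γ.X j h) : Γ.mul hi hg x a ∈ nonzeroPart Γ k l := by
  intro hl
  by_cases g0 : g = 0
  · rw [hx g0, map_zero, AddMonoidHom.zero_apply]
  · by_cases hg' : 0 ≤ g
    · have : ¬ 0 ≤ h := fun hh ↦ g0 (le_antisymm (by
        rw [← hg.trans hl]; exact le_add_of_nonneg_right hh) hg')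
      rw [hΓ j h this a, map_zero]
    · rw [hΓ i g hg' x, map_zero, AddMonoidHom.zero_apply]

/-- The right dg module `Γ_0`, the quotient of `Γ` by its elements of nonzero degree in `G`. -/
def degreeZero [PartialOrder G] [IsOrderedAddMonoid G] (Γ : DGRing G) (hΓ : Γ.IsNonneg) :
    DGMod Γ where
  X i g := Γ.X i g ⧸ nonzeroPart Γ i g
  d {i j} hi g := QuotientAddGroup.map _ _ (Γ.d hi g) (fun x hx h ↦ by rw [hx h, map_zero])
  act {i j k g h l} hi hg := QuotientAddGroup.lift _
    (AddMonoidHom.mk' (fun x ↦ (QuotientAddGroup.mk' _).comp (Γ.mul hi hg x)) (by intros; ext; simp))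
    (fun x hx ↦ by
      ext a
      exact (QuotientAddGroup.eq_zero_iff _).2 (mul_mem_nonzeroPart hΓ hi hg hx a))
  d_d hi hj g x := by
    induction x using QuotientAddGroup.induction_on with
    | _ x => exact congrArg _ (Γ.d_d hi hj g x)
  act_one x := by
    induction x using QuotientAddGroup.induction_on with
    | _ x => exact congrArg _ (Γ.mul_one x)
  act_assoc h₁₂ h₂₃ h h' e₁₂ e₂₃ e e' x a b := by
    induction x using QuotientAddGroup.induction_on with
    | _ x => exact congrArg _ (Γ.mul_assoc h₁₂ h₂₃ h h' e₁₂ e₂₃ e e' x a b)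
  d_act hi hj hk h₁ h₂ h₃ e x a := by
    induction x using QuotientAddGroup.induction_on with
    | _ x => exact congrArg _ (Γ.d_mul hi hj hk h₁ h₂ h₃ e x a)

/-- A dg module is K-projective if every morphism from it to an acyclic dg module is
null-homotopic. -/
def KProjective (P : DGMod Γ) : Prop :=
  ∀ N : DGMod Γ, N.Acyclic → ∀ f : P ⟶ N, f ∈ nullHomotopic P N

/-- The homogeneous right `Γ`-linear maps `P → Γ` of degree `(i, g)`. Such a map is given by its
components `P^j_h → Γ^k_l`, for `j + i = k` and `h + g = l`. -/
def dualHoms (P : DGMod Γ) (i : ℤ) (g : G) : AddSubgroup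
    (∀ (t : {t : ℤ × ℤ // t.1 + i = t.2}) (r : {r : G × G // r.1 + g = r.2}),
      P.X t.1.1 r.1.1 →+ Γ.X t.1.2 r.1.2) where
  carrier := {φ | ∀ {j k j' j₁ k₁ : ℤ} {h l h' h₁ l₁ : G} (e : j + i = k) (e₁ : j₁ + i = k₁)
    (f : h + g = l) (f₁ : h₁ + g = l₁) (hj : j + j' = j₁) (hk : k + j' = k₁) (hh : h + h' = h₁)
    (hl : l + h' = l₁) (x : P.X j h) (b : Γ.X j' h'),
    φ ⟨(j₁, k₁), e₁⟩ ⟨(h₁, l₁), f₁⟩ (P.act hj hh x b) =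
      Γ.mul hk hl (φ ⟨(j, k), e⟩ ⟨(h, l), f⟩ x) b}
  add_mem' {φ ψ} hφ hψ j k j' j₁ k₁ h l h' h₁ l₁ e e₁ f f₁ hj hk hh hl x b := by
    simp [hφ e e₁ f f₁ hj hk hh hl, hψ e e₁ f f₁ hj hk hh hl]
  zero_mem' := by simp
  neg_mem' {φ} hφ j k j' j₁ k₁ h l h' h₁ l₁ e e₁ f f₁ hj hk hh hl x b := by
    simp [hφ e e₁ f f₁ hj hk hh hl]

/-- The component `P^j_h → Γ^k_l` of a homogeneous map. -/
def ev {P : DGMod Γ} {i : ℤ} {g : G} (φ : P.dualHoms i g) {j k : ℤ} {h l : G} (e : j + i = k)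
    (f : h + g = l) : P.X j h →+ Γ.X k l := φ.1 ⟨(j, k), e⟩ ⟨(h, l), f⟩

section

variable {i : ℤ} {g : G}

@[ext] lemma dualHoms_ext {φ ψ : P.dualHoms i g}
    (H : ∀ (j : ℤ) (h : G) (x : P.X j h), ev φ rfl rfl x = ev ψ rfl rfl x) : φ = ψ := by
  refine Subtype.ext (funext ?_)
  rintro ⟨⟨j, k⟩, e⟩
  refine funext ?_
  rintro ⟨⟨h, l⟩, f⟩
  ext x
  obtain rfl : j + i = k := e
  obtain rfl : h + g = l := f
  exact H j h x

@[simp] lemma ev_add (φ ψ : P.dualHoms i g) {j k : ℤ} {h l : G} (e : j + i = k)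
    (f : h + g = l) (x : P.X j h) : ev (φ + ψ) e f x = ev φ e f x + ev ψ e f x := rfl

@[simp] lemma ev_zero {j k : ℤ} {h l : G} (e : j + i = k)
    (f : h + g = l) (x : P.X j h) : ev (0 : P.dualHoms i g) e f x = 0 := rfl

@[simp] lemma ev_zsmul (n : ℤ) (φ : P.dualHoms i g) {j k : ℤ} {h l : G} (e : j + i = k)
    (f : h + g = l) (x : P.X j h) : ev (n • φ) e f x = n • ev φ e f x := rfl

lemma ev_act (φ : P.dualHoms i g) {j k j' j₁ k₁ : ℤ} {h l h' h₁ l₁ : G} (e : j + i = k)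
    (e₁ : j₁ + i = k₁) (f : h + g = l) (f₁ : h₁ + g = l₁) (hj : j + j' = j₁) (hk : k + j' = k₁)
    (hh : h + h' = h₁) (hl : l + h' = l₁) (x : P.X j h) (b : Γ.X j' h') :
    ev φ e₁ f₁ (P.act hj hh x b) = Γ.mul hk hl (ev φ e f x) b :=
  φ.2 e e₁ f f₁ hj hk hh hl x b

/-- Constructor for homogeneous linear maps. -/
def mkDual (φ : ∀ {j k : ℤ} {h l : G} (_ : j + i = k) (_ : h + g = l), P.X j h →+ Γ.X k l)
    (hφ : ∀ {j k j' j₁ k₁ : ℤ} {h l h' h₁ l₁ : G} (e : j + i = k) (e₁ : j₁ + i = k₁)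
      (f : h + g = l) (f₁ : h₁ + g = l₁) (hj : j + j' = j₁) (hk : k + j' = k₁) (hh : h + h' = h₁)
      (hl : l + h' = l₁) (x : P.X j h) (b : Γ.X j' h'),
      φ e₁ f₁ (P.act hj hh x b) = Γ.mul hk hl (φ e f x) b) : P.dualHoms i g :=
  ⟨fun t r ↦ φ t.2 r.2, hφ⟩

@[simp] lemma ev_mkDual
    (φ : ∀ {j k : ℤ} {h l : G} (_ : j + i = k) (_ : h + g = l), P.X j h →+ Γ.X k l) (hφ)
    {j k : ℤ} {h l : G} (e : j + i = k) (f : h + g = l) :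
    ev (mkDual (i := i) (g := g) φ hφ) e f = φ e f := rfl

/-- The differential of the dual: `φ ↦ d ∘ φ - (-1)^{|φ|} φ ∘ d`. -/
def dualD {i' : ℤ} (hi : i + 1 = i') (φ : P.dualHoms i g) : P.dualHoms i' g :=
  mkDual (fun {j k h l} e f ↦ (Γ.d (show j + i + 1 = k by omega) l).comp (ev φ rfl f) -
      dgSign i • (ev φ (show j + 1 + i = k by omega) f).comp (P.d rfl h)) (by
    intro j k j' j₁ k₁ h l h' h₁ l₁ e e₁ f f₁ hj hk hh hl x b
    subst hi
    have h1 := ev_act φ (rfl : j + i = _) (rfl : j₁ + i = _) f f₁ hj (by omega) hh hl x b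
    have h2 := ev_act φ (show j + 1 + i = k by omega) (show j₁ + 1 + i = k₁ by omega) f f₁
      (by omega) hk hh hl (P.d rfl h x) b
    have h3 := ev_act φ (rfl : j + i = _) (show j₁ + 1 + i = k₁ by omega) f f₁
      (show j + (j' + 1) = j₁ + 1 by omega) (by omega) hh hl x (Γ.d rfl h' b)
    have h4 := P.d_act (rfl : j + 1 = _) rfl (rfl : j₁ + 1 = _) hj (by omega) (by omega) hh x b
    have h5 := Γ.d_mul (show j + i + 1 = k by omega) rfl (show j₁ + i + 1 = k₁ by omega)
      (by omega) hk (by omega) hl (ev φ rfl f x) b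
    simp only [AddMonoidHom.sub_apply, AddMonoidHom.coe_comp, Function.comp_apply,
      AddMonoidHom.smul_apply, h1, h4, h5, map_add, map_zsmul, h2, h3, map_sub, smul_add, smul_smul,
      ← dgSign.add, add_comm i j]
    abel)

lemma ev_dualD {i' : ℤ} (hi : i + 1 = i') (φ : P.dualHoms i g) {j k : ℤ} {h l : G} (e : j + i' = k)
    (f : h + g = l) (x : P.X j h) : ev (dualD hi φ) e f x =
      Γ.d (show j + i + 1 = k by omega) l (ev φ rfl f x) -
      dgSign i • ev φ (show j + 1 + i = k by omega) f (P.d rfl h x) := rfl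

/-- The action on the dual: `φ · a = (-1)^{|φ||a|} a φ`. -/
def dualAct {i' k' : ℤ} {g' l' : G} (hi : i + i' = k') (hg : g + g' = l') (φ : P.dualHoms i g)
    (a : Γ.X i' g') : P.dualHoms k' l' :=
  mkDual (fun {j k h l} e f ↦ dgSign (i * i') • (Γ.mul (show i' + (j + i) = k by omega)
    (show g' + (h + g) = l by rw [← f, ← hg]; abel) a).comp (ev φ rfl rfl)) (by
    intro j k j' j₁ k₁ h l h' h₁ l₁ e e₁ f f₁ hj hk hh hl x b
    subst hj hh
    have h1 := ev_act φ (rfl : j + i = _) (rfl : j + j' + i = _) (rfl : h + g = _)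
      (rfl : h + h' + g = _) rfl (by omega) rfl (by abel) x b
    simp only [AddMonoidHom.coe_comp, Function.comp_apply,
      AddMonoidHom.smul_apply, h1, map_zsmul]
    rw [Γ.mul_assoc])

lemma ev_dualAct {i' k' : ℤ} {g' l' : G} (hi : i + i' = k') (hg : g + g' = l') (φ : P.dualHoms i g)
    (a : Γ.X i' g') {j k k₁ : ℤ} {h l l₁ : G} (e : j + k' = k) (f : h + l' = l) (e₁ : j + i = k₁)
    (f₁ : h + g = l₁) (x : P.X j h) :
    ev (dualAct hi hg φ a) e f x = dgSign (i * i') • Γ.mul (show i' + k₁ = k by omega)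
      (show g' + l₁ = l by rw [← f, ← hg, ← f₁]; abel) a (ev φ e₁ f₁ x) := by
  subst e₁ f₁; rfl

lemma dualD_add {i' : ℤ} (hi : i + 1 = i') (φ ψ : P.dualHoms i g) :
    dualD hi (φ + ψ) = dualD hi φ + dualD hi ψ := by
  ext j h x
  simp only [ev_dualD, ev_add, map_add, smul_add]
  abel

lemma dualAct_add {i' k' : ℤ} {g' l' : G} (hi : i + i' = k') (hg : g + g' = l')
    (φ : P.dualHoms i g) (a b : Γ.X i' g') :
    dualAct hi hg φ (a + b) = dualAct hi hg φ a + dualAct hi hg φ b := by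
  ext j h x
  rw [ev_add]
  iterate 3 rw [ev_dualAct hi hg _ _ _ _ rfl rfl]
  rw [map_add, AddMonoidHom.add_apply, smul_add]

lemma add_dualAct {i' k' : ℤ} {g' l' : G} (hi : i + i' = k') (hg : g + g' = l')
    (φ ψ : P.dualHoms i g) (a : Γ.X i' g') :
    dualAct hi hg (φ + ψ) a = dualAct hi hg φ a + dualAct hi hg ψ a := by
  ext j h x
  rw [ev_add]
  iterate 3 rw [ev_dualAct hi hg _ _ _ _ rfl rfl]
  rw [ev_add, map_add, smul_add]

lemma d_ev (φ : P.dualHoms i g) {j k k' k'' : ℤ} {h l : G} (e : j + i = k) (e' : j + i = k')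
    (f : h + g = l) (hk : k + 1 = k'') (hk' : k' + 1 = k'') (x : P.X j h) :
    Γ.d hk l (ev φ e f x) = Γ.d hk' l (ev φ e' f x) := by
  subst e e'; rfl

lemma dualD_dualD {i' i'' : ℤ} (hi : i + 1 = i') (hj : i' + 1 = i'') (φ : P.dualHoms i g) :
    dualD hj (dualD hi φ) = 0 := by
  ext j h x
  subst hi
  simp only [ev_dualD, map_sub, map_zsmul, Γ.d_d, P.d_d, map_zero,
    smul_zero, dgSign.add, dgSign.one, ev_zero]
  simp only [zero_sub, mul_neg, mul_one, neg_smul, sub_zero, sub_neg_eq_add]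
  exact (congrArg (fun y ↦ -(dgSign i • y) + _) (d_ev φ _ _ _ _ _ _)).trans (neg_add_cancel _)

lemma dualAct_one (φ : P.dualHoms i g) : dualAct (add_zero i) (add_zero g) φ Γ.one = φ := by
  ext j h x
  rw [ev_dualAct (add_zero i) (add_zero g) _ _ _ _ rfl rfl, mul_zero, dgSign.zero, one_smul]
  exact Γ.one_mul _

lemma dualAct_dualAct {i₂ i₃ i₁₂ i₂₃ k : ℤ} {g₂ g₃ g₁₂ g₂₃ l : G}
    (h₁₂ : i + i₂ = i₁₂) (h₂₃ : i₂ + i₃ = i₂₃) (hk : i₁₂ + i₃ = k) (hk' : i + i₂₃ = k)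
    (e₁₂ : g + g₂ = g₁₂) (e₂₃ : g₂ + g₃ = g₂₃) (e : g₁₂ + g₃ = l) (e' : g + g₂₃ = l)
    (φ : P.dualHoms i g) (a : Γ.X i₂ g₂) (b : Γ.X i₃ g₃) :
    dualAct hk e (dualAct h₁₂ e₁₂ φ a) b = dualAct hk' e' φ
      (dgSign (i₂ * i₃) • Γ.mul ((add_comm _ _).trans h₂₃) ((add_comm _ _).trans e₂₃) b a) := by
  ext j h x
  rw [ev_dualAct hk e _ _ _ _ rfl rfl, ev_dualAct h₁₂ e₁₂ _ _ _ _ rfl rfl,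
    ev_dualAct hk' e' _ _ _ _ rfl rfl]
  simp only [map_zsmul, AddMonoidHom.smul_apply, smul_smul, ← dgSign.add]
  rw [Γ.mul_assoc (i₂₃ := j + i₁₂) (g₂₃ := h + g₁₂) _ (by omega) _ (by omega) _
    (by rw [← e₁₂]; abel) _ (by rw [← e, ← e₁₂]; abel)]
  congr 2
  subst h₁₂ h₂₃
  ring

lemma dualD_dualAct {i' j j' k k' : ℤ} {h l : G} (hi : i + 1 = i') (hj : j + 1 = j')
    (hk : k + 1 = k') (h₁ : i + j = k) (h₂ : i' + j = k') (h₃ : i + j' = k') (e : g + h = l)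
    (φ : P.dualHoms i g) (a : Γ.X j h) :
    dualD hk (dualAct h₁ e φ a) = dualAct h₂ e (dualD hi φ) a +
      dgSign i • dualAct h₃ e φ (Γ.d hj h a) := by
  subst hi hj h₁ hk e
  ext m r x
  rw [ev_add, ev_zsmul, ev_dualD, ev_dualAct rfl rfl φ a rfl rfl rfl rfl,
    ev_dualAct rfl rfl φ a _ _ (show m + 1 + i = m + (i + 1) by omega) rfl,
    ev_dualAct h₂ rfl _ a _ _ rfl rfl, ev_dualAct h₃ rfl φ _ _ _ rfl rfl, ev_dualD, map_zsmul,
    Γ.d_mul (rfl : j + 1 = _) (show m + i + 1 = m + (i + 1) by omega)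
      (show m + (i + j) + 1 = m + (i + j + 1) by omega) (by omega) (by omega) (by omega)]
  simp only [map_sub, map_zsmul, smul_add, smul_sub, smul_smul, ← dgSign.add]
  rw [show (i + 1) * j + i = i + j + i * j by ring, show (i + 1) * j = i * j + j by ring,
    show dgSign (i + i * (j + 1)) = dgSign (i * j) by
      rw [show i + i * (j + 1) = i * j + (i + i) by ring, dgSign.add _ (i + i), dgSign.add i i,
        dgSign.mul_self, mul_one]]
  abel

end

/-- The dual `Hom_Γ(P, Γ)` of a right dg module `P`, as a right dg module over the opposite of `Γ`. The
differential is `φ ↦ d ∘ φ - (-1)^{|φ|} φ ∘ d`, and the right action of an element `a` of the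
opposite of `Γ` is `φ · a = (-1)^{|φ||a|} a φ`. -/
def dual (P : DGMod Γ) : DGMod Γ.op where
  X i g := P.dualHoms i g
  d hi _ := AddMonoidHom.mk' (dualD hi) (dualD_add hi)
  act hi hg := AddMonoidHom.mk' (fun φ ↦ AddMonoidHom.mk' (dualAct hi hg φ) (dualAct_add hi hg φ))
    (fun φ ψ ↦ AddMonoidHom.ext (add_dualAct hi hg φ ψ))
  d_d hi hj _ φ := dualD_dualD hi hj φ
  act_one φ := dualAct_one φ
  act_assoc h₁₂ h₂₃ h h' e₁₂ e₂₃ e e' φ a b := dualAct_dualAct h₁₂ h₂₃ h h' e₁₂ e₂₃ e e' φ a b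
  d_act hi hj hk h₁ h₂ h₃ e φ a := dualD_dualAct hi hj hk h₁ h₂ h₃ e φ a

/-! ### Subcategories of the derived category and the cluster category -/

/-- `thickOn M I` is the thick subcategory of the derived category generated by the objects
`M(-g)`, for `g` in `I`. -/
def thickOn (M : DGMod Γ) (I : Set G) : ObjectProperty (Derived Γ) :=
  thick (fun Y ↦ ∃ g ∈ I, Y = toD (M.twist (-g)))

lemma thickOn_mono (M : DGMod Γ) {I J : Set G} (h : I ⊆ J) : thickOn M I ≤ thickOn M J :=
  thick_mono (fun _ ⟨g, hg, e⟩ ↦ ⟨g, h hg, e⟩)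

instance (M : DGMod Γ) (I : Set G) : (thickOn M I).IsTriangulated :=
  inferInstanceAs (thick _).IsTriangulated

instance (M : DGMod Γ) (I : Set G) : (thickOn M I).IsStableUnderRetracts :=
  inferInstanceAs (thick _).IsStableUnderRetracts

end DGMod

namespace DGRing

open DGMod

/-- `Γ.per I` is the thick subcategory of the derived category generated by the objects `Γ(-g)`, for
`g` in `I`. -/
abbrev per (Γ : DGRing G) (I : Set G) : ObjectProperty (Derived Γ) := thickOn (regular Γ) I

/-- The category of perfect `G`-graded dg modules. -/
abbrev Per (Γ : DGRing G) := (Γ.per Set.univ).FullSubcategory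

/-- `Γ` has Gorenstein parameter `p` if the derived functor of `Hom_Γ(-, Γ)` takes dg modules whose
cohomology is concentrated in degree `0` of the grading group to dg modules over the opposite dg ring whose
cohomology is concentrated in degree `-p`. The derived functor is computed on K-projective dg
modules. -/
def HasGorensteinParameter (Γ : DGRing G) (p : G) : Prop :=
  ∀ P : DGMod Γ, P.KProjective → P.SupportedOn {0} → P.dual.SupportedOn {-p}

variable [PartialOrder G] [IsOrderedAddMonoid G]

/-- The dg modules `Γ_0` over `Γ` and over its opposite are perfect. -/
def DegreeZeroPerfect (Γ : DGRing G) (hΓ : Γ.IsNonneg) : Prop :=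
  Γ.per Set.univ (toD (degreeZero Γ hΓ)) ∧ Γ.op.per Set.univ (toD (degreeZero Γ.op hΓ.op))

/-- `thick^G Γ_0`, as a full subcategory of the category of perfect `G`-graded dg modules. -/
abbrev thickDegreeZero (Γ : DGRing G) (hΓ : Γ.IsNonneg) : ObjectProperty Γ.Per :=
  (thickOn (degreeZero Γ hΓ) Set.univ).inverseImage (Γ.per Set.univ).ι

/-- The graded cluster category: the Verdier quotient of the category of perfect `G`-graded dg modules by the
thick subcategory generated by the objects `Γ_0(-g)`. -/
abbrev Cluster (Γ : DGRing G) (hΓ : Γ.IsNonneg) := VerdierQuotient (Γ.thickDegreeZero hΓ)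

/-- The inclusion of the subcategory generated by the objects `Γ(-g)`, for `g` in `J`, into the category of
perfect `G`-graded dg modules. -/
abbrev perInclusion (Γ : DGRing G) (J : Set G) : (Γ.per J).FullSubcategory ⥤ Γ.Per :=
  (Γ.per Set.univ).lift (Γ.per J).ι (fun X ↦ thickOn_mono _ (Set.subset_univ J) _ X.2)

/-- The composite of the inclusion into the category of perfect `G`-graded dg modules and of the quotient
functor to the graded cluster category. -/
abbrev perToCluster (Γ : DGRing G) (hΓ : Γ.IsNonneg) (J : Set G) :
    (Γ.per J).FullSubcategory ⥤ Γ.Cluster hΓ :=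
  Γ.perInclusion J ⋙ verdierQ (Γ.thickDegreeZero hΓ)

end DGRing

/-- `J(I) = I ∩ (Iᶜ + p)`. -/
def upperGap (I : Set G) (p : G) : Set G := I ∩ (fun g ↦ g + p) '' Iᶜ

end

/-! Everything rests on two computations of morphisms. The module `Γ(-g)` is K-projective and
generated by a cocycle of degree `g`, so the morphisms from it to the shifts of `M` are the
cohomology of `M` in degree `g` (`free_hom_eq_zero_iff`). As `Γ` is non-negative, `Γ(-l)` lives in
degrees `≥ l`. For an upper set `U` there are therefore no morphisms from `per^(L \ U) Γ` to `per^(L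
∩ U) Γ`, and an object of `per^L Γ` without cohomology in the degrees of `L \ U` lies in `per^(L ∩
U) Γ` (`per_inter_of_hom_eq_zero`). Secondly, the Gorenstein condition says that `Γ_0(-g)` has
nonzero morphisms to shifts of `Γ(-l)` only if `l = g + p` (`hom_degreeZero_per_eq_zero`).

Generation comes from two triangles. By (D1) the fibre of `Γ(-g) → Γ_0(-g)` is perfect; its
cohomology lives in degrees `> g`, so it lies in `per^(>g) Γ`. Replacing generators outside `I` by
larger ones stops after finitely many steps and gives `per^G Γ = per^I Γ ⊥ thick^(Iᶜ) Γ_0`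
(`per_univ_le`). Dualizing the same triangle over the opposite ring gives `S → Γ(-g) → Y` with `Y`
in `per^(<g) Γ` and `S` perfect with cohomology in degree `g - p` only, hence in `thick^{g-p} Γ_0`
(`exists_distTriang_free`). Descending in the same way gives `per^G Γ = thick^I Γ_0 ⊥ per^(Iᶜ+p) Γ`
(`per_univ_le_thickOn_degreeZero`). When an object of `per^I Γ`, which contains `thick^I Γ_0`, is
cut by the second decomposition, the last term lies in both `per^I Γ` and `per^(Iᶜ+p) Γ`, hence in
`per^J(I) Γ`. This is the first assertion.

To pass from generators to thick subcategories, an extension product has to be closed under direct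
summands. This holds when idempotents of its first factor split (`thick_le_extensionProduct`). They
do so for perfect dg modules, by an Eilenberg swindle with countable powers in the homotopy
category.

For the equivalence, `thick^G Γ_0` decomposes into `thick^I Γ_0`, which has no morphisms to
`per^J(I) Γ`, and `thick^(Iᶜ) Γ_0`, which receives none from it. A calculus of fractions then shows
that `per^J(I) Γ` embeds fully faithfully in the quotient, and the decomposition shows that it
exhausts it. Taking row vectors of homogeneous components sends `Γ(w a)` to the row `a` of the
matrix ring, and identifies `per^J Γ` with the perfect modules over that ring
(`triangleEquivalent_matrix`). The weight `w g = -g` gives `per^J(I) Γ`. The weight `w g = g` gives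
`per^(-J(I)) Γ`, and `-J(I)` is the set `J` of another upper set, the reflection of `I`; the cluster
category does not depend on the upper set.

All finiteness comes from the rank: `p > 0` is not torsion, so `G / ℤp` is finite, and the multiples
of `p` are cofinal. -/

noncomputable section

/-! ### Thick subcategories and extension products -/

section

variable {C : Type*} [Category C] [HasZeroObject C] [HasShift C ℤ] [Preadditive C]
  [∀ n : ℤ, (shiftFunctor C n).Additive] [Pretriangulated C]

section Triangle

variable {X Y Z W X' Y' Z' : C} {f : X ⟶ Y} {g : Y ⟶ Z} {k : Z ⟶ X⟦(1 : ℤ)⟧}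

lemma distTriang_comp₁₂ (hT : Triangle.mk f g k ∈ distTriang C) : f ≫ g = 0 :=
  comp_distTriang_mor_zero₁₂ _ hT

lemma distTriang_comp₂₃ (hT : Triangle.mk f g k ∈ distTriang C) : g ≫ k = 0 :=
  comp_distTriang_mor_zero₂₃ _ hT

lemma exists_lift₂ (hT : Triangle.mk f g k ∈ distTriang C) {a : W ⟶ Y} (h : a ≫ g = 0) :
    ∃ b : W ⟶ X, a = b ≫ f := Triangle.coyoneda_exact₂ _ hT a h

lemma exists_lift₃ (hT : Triangle.mk f g k ∈ distTriang C) {a : W ⟶ Z} (h : a ≫ k = 0) :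
    ∃ b : W ⟶ Y, a = b ≫ g := Triangle.coyoneda_exact₃ _ hT a h

lemma exists_desc₂ (hT : Triangle.mk f g k ∈ distTriang C) {a : Y ⟶ W} (h : f ≫ a = 0) :
    ∃ b : Z ⟶ W, a = g ≫ b := Triangle.yoneda_exact₂ _ hT a h

lemma exists_desc₃ (hT : Triangle.mk f g k ∈ distTriang C) {a : Z ⟶ W} (h : g ≫ a = 0) :
    ∃ b : X⟦(1 : ℤ)⟧ ⟶ W, a = k ≫ b := Triangle.yoneda_exact₃ _ hT a h

lemma exists_fiber (hT : Triangle.mk f g k ∈ distTriang C) :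
    ∃ (δ : Z⟦(-1 : ℤ)⟧ ⟶ X) (k' : Y ⟶ Z⟦(-1 : ℤ)⟧⟦(1 : ℤ)⟧), Triangle.mk δ f k' ∈ distTriang C :=
  ⟨_, _, inv_rot_of_distTriang _ hT⟩

lemma exists_map₃ {f' : X' ⟶ Y'} {g' : Y' ⟶ Z'} {k' : Z' ⟶ X'⟦(1 : ℤ)⟧}
    (hT : Triangle.mk f g k ∈ distTriang C) (hT' : Triangle.mk f' g' k' ∈ distTriang C)
    {a : X ⟶ X'} {b : Y ⟶ Y'} (h : f ≫ b = a ≫ f') :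
    ∃ c : Z ⟶ Z', g ≫ c = b ≫ g' ∧ k ≫ a⟦(1 : ℤ)⟧' = c ≫ k' :=
  complete_distinguished_triangle_morphism _ _ hT hT' a b h

lemma distTriang_map {D : Type*} [Category D] [HasZeroObject D] [HasShift D ℤ] [Preadditive D]
    [∀ n : ℤ, (shiftFunctor D n).Additive] [Pretriangulated D] (F : C ⥤ D) [F.CommShift ℤ]
    [F.IsTriangulated] (hT : Triangle.mk f g k ∈ distTriang C) :
    Triangle.mk (F.map f) (F.map g) (F.map k ≫ (F.commShiftIso (1 : ℤ)).hom.app X) ∈ distTriang D :=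
  F.map_distinguished _ hT

lemma isTriangulatedClosed₂_of {P : ObjectProperty C} [P.IsClosedUnderIsomorphisms]
    (h : ∀ ⦃X Y Z : C⦄ (f : X ⟶ Y) (g : Y ⟶ Z) (k : Z ⟶ X⟦(1 : ℤ)⟧),
      Triangle.mk f g k ∈ distTriang C → P X → P Z → P Y) : P.IsTriangulatedClosed₂ :=
  .mk' fun ⟨_, _, _, _, _, _⟩ hT h₁ h₃ ↦ h _ _ _ hT h₁ h₃

end Triangle

lemma le_thick (S : ObjectProperty C) : S ≤ thick S := fun _ hX _ _ _ hS ↦ hS _ hX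

lemma thick_le {S Q : ObjectProperty C} [hQ : Q.IsTriangulated] [hQ' : Q.IsStableUnderRetracts]
    (h : S ≤ Q) : thick S ≤ Q := fun _ hX ↦ hX Q hQ hQ' h

instance (P : ObjectProperty C) : P.leftOrthogonal.IsStableUnderRetracts where
  of_retract r hY Z f hZ := by
    rw [← Category.id_comp f, ← r.retract, Category.assoc, hY (r.r ≫ f) hZ, comp_zero]

instance (P : ObjectProperty C) : P.rightOrthogonal.IsStableUnderRetracts where
  of_retract r hY Z f hZ := by
    rw [← Category.comp_id f, ← r.retract, ← Category.assoc, hY (f ≫ r.i) hZ, zero_comp]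

/-- Orthogonals of shift-stable classes are thick, so the vanishing extends from generators first in
the source, then in the target. -/
lemma thick_hom_eq_zero {S S' : ObjectProperty C}
    (h : ∀ ⦃X Y⦄, S X → S' Y → ∀ (n : ℤ) (f : X ⟶ Y⟦n⟧), f = 0) {X Y : C}
    (hX : thick S X) (hY : thick S' Y) (f : X ⟶ Y) : f = 0 := by
  have h₁ : thick S ≤ (S'.shiftClosure ℤ).leftOrthogonal := thick_le fun X hX Z f hZ ↦ by
    obtain ⟨Y, n, e, hY⟩ := hZ
    have := h hX hY n (f ≫ e.hom)
    rwa [← cancel_mono e.hom, zero_comp]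
  have h₂ : thick S' ≤ (thick S).rightOrthogonal := thick_le fun Y hY Z f hZ ↦
    h₁ _ hZ f (S'.le_shiftClosure _ hY)
  exact h₂ _ hY f hX

namespace CategoryTheory.ObjectProperty

/-- Idempotent endomorphisms of the objects in `P` split in the ambient category. -/
def SplitsIdempotents {C : Type*} [Category C] (P : ObjectProperty C) : Prop :=
  ∀ ⦃X : C⦄, P X → ∀ e : X ⟶ X, e ≫ e = e →
    ∃ (Y : C) (i : Y ⟶ X) (r : X ⟶ Y), i ≫ r = 𝟙 Y ∧ r ≫ i = e

variable {A B : ObjectProperty C}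

/-- The connecting morphism goes from `A` to a shift of an object of `B`, so it vanishes. The middle
term is then a direct sum, whose summands can be exchanged. -/
lemma extensionProduct_swap_le [A.IsStableUnderShift ℤ] [B.IsStableUnderShift ℤ]
    (h : ∀ ⦃X Y⦄, A X → B Y → ∀ f : X ⟶ Y, f = 0) :
    B.extensionProduct A ≤ A.extensionProduct B := by
  rintro E ⟨Y, X, f, g, k, hT, hY, hX⟩
  have hk : k = 0 := h hX (B.le_shift 1 _ hY) k
  subst hk
  have e : E ≅ Y ⊞ X := Triangle.π₂.mapIso (isoTriangleOfIso₁₃ _ _ hT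
    (binaryBiproductTriangle_distinguished Y X) (Iso.refl _) (Iso.refl _)
      (zero_comp.trans comp_zero.symm))
  refine prop_of_iso _ (biprod.braiding X Y ≪≫ e.symm) ?_
  exact ⟨_, _, _, _, _, binaryBiproductTriangle_distinguished X Y, hX, hY⟩

/-- `(A * B) * (A * B) = A * (B * A) * B`, and swapping the two middle factors lands in `(A * A) *
(B * B) = A * B`. -/
lemma isTriangulated_extensionProduct [IsTriangulated C] [A.IsTriangulated] [B.IsTriangulated]
    (h : ∀ ⦃X Y⦄, A X → B Y → ∀ f : X ⟶ Y, f = 0)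
    [A.IsClosedUnderIsomorphisms] [B.IsClosedUnderIsomorphisms] :
    (A.extensionProduct B).IsTriangulated where
  exists_zero := ⟨_, isZero_zero C, le_extensionProduct_left _ _ (A.prop_of_isZero (isZero_zero C))⟩
  toIsTriangulatedClosed₂ := .mk' fun T hT h₁ h₃ ↦ by
    have : (A.extensionProduct B).extensionProduct (A.extensionProduct B) T.obj₂ :=
      ⟨_, _, _, _, _, hT, h₁, h₃⟩
    rw [extensionProduct_assoc] at this
    have h' : B.extensionProduct (A.extensionProduct B) ≤ A.extensionProduct B := by
      rw [← extensionProduct_assoc]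
      refine (monotone_extensionProduct_left _ (extensionProduct_swap_le h)).trans ?_
      rw [extensionProduct_assoc]
      exact monotone_extensionProduct_right _
        (extensionProduct_le_of_isTriangulatedClosed₂ le_rfl le_rfl)
    replace this := monotone_extensionProduct_right _ h' _ this
    rw [← extensionProduct_assoc] at this
    exact monotone_extensionProduct_left _
      (extensionProduct_le_of_isTriangulatedClosed₂ le_rfl le_rfl) _ this

/-- The idempotent of `W` belonging to the summand `X` restricts to an idempotent of the first term
`Y`. Splitting it, by `hA`, yields a summand `Y'` of `Y` with a map to `X`, whose cone is a retract
of `Z`. -/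
lemma isStableUnderRetracts_extensionProduct [A.IsTriangulated] [B.IsTriangulated]
    [A.IsStableUnderRetracts] [B.IsStableUnderRetracts]
    (h : ∀ ⦃X Y⦄, A X → B Y → ∀ f : X ⟶ Y, f = 0) (hA : A.SplitsIdempotents) :
    (A.extensionProduct B).IsStableUnderRetracts where
  of_retract {X W} ρ := by
    rintro ⟨Y, Z, f, g, k, hT, hY, hZ⟩
    obtain ⟨δ, k', hδ⟩ := exists_fiber hT
    -- Two maps from `V` to `Y` that agree in `W` differ by a map through `Z⟦-1⟧`, which is zero by
    -- orthogonality.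
    have inj {V : C} (hV : A V) {a b : V ⟶ Y} (hab : a ≫ f = b ≫ f) : a = b := by
      rw [← sub_eq_zero]
      obtain ⟨c, hc⟩ := exists_lift₂ hδ (a := a - b) (by
        rw [Preadditive.sub_comp, sub_eq_zero, hab])
      rw [hc, h hV (B.le_shift (-1) _ hZ) c, zero_comp]
    obtain ⟨e, he⟩ := exists_lift₂ hT (a := f ≫ ρ.r ≫ ρ.i) (h hY hZ _)
    obtain ⟨Y', i, r, hir, hri⟩ := hA hY e (inj hY (by
      rw [Category.assoc, ← he, ← reassoc_of% he]; simp))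
    have hY' : A Y' := IsStableUnderRetracts.of_retract (P := A) ⟨i, r, hir⟩ hY
    obtain ⟨Z', g', k', hT'⟩ := distinguished_cocone_triangle (i ≫ f ≫ ρ.r)
    have h₁ : (i ≫ f ≫ ρ.r) ≫ ρ.i = i ≫ f := by
      rw [Category.assoc, Category.assoc, he, ← hri]; simp [reassoc_of% hir]
    have h₂ : f ≫ ρ.r = r ≫ (i ≫ f ≫ ρ.r) := by
      rw [reassoc_of% hri, ← reassoc_of% he]; simp
    obtain ⟨a, ha, ha'⟩ := exists_map₃ hT' hT h₁
    obtain ⟨b, hb, hb'⟩ := exists_map₃ hT hT' h₂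
    -- The fill-ins `a` and `b` are not canonical, but `a ≫ b` completes two identities to an
    -- endomorphism of a triangle. It is therefore invertible, and correcting `b` by its inverse
    -- makes `Z'` a retract of `Z`.
    let φ : Triangle.mk (i ≫ f ≫ ρ.r) g' k' ⟶ Triangle.mk (i ≫ f ≫ ρ.r) g' k' :=
      { hom₁ := 𝟙 _
        hom₂ := 𝟙 _
        hom₃ := a ≫ b
        comm₁ := (Category.comp_id _).trans (Category.id_comp _).symm
        comm₂ := by
          refine Eq.trans ?_ (Category.id_comp _).symm
          change g' ≫ a ≫ b = g'
          rw [reassoc_of% ha, hb, ← Category.assoc, ρ.retract, Category.id_comp]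
        comm₃ := by
          change k' ≫ (𝟙 Y')⟦(1 : ℤ)⟧' = (a ≫ b) ≫ k'
          rw [Category.assoc, ← hb', ← reassoc_of% ha', ← Functor.map_comp, hir] }
    have : IsIso (a ≫ b) := isIso₃_of_isIso₁₂ φ hT' hT' (inferInstanceAs (IsIso (𝟙 _)))
      (inferInstanceAs (IsIso (𝟙 _)))
    exact ⟨_, _, _, _, _, hT', hY', IsStableUnderRetracts.of_retract (P := B) ⟨a, b ≫ inv (a ≫ b), by
      rw [← Category.assoc, IsIso.hom_inv_id]⟩ hZ⟩

/-- The first map of the triangle vanishes, so the second one is a split monomorphism into an object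
of `B`. -/
lemma prop_right_of_extensionProduct [B.IsStableUnderRetracts] {X : C}
    (hX : A.extensionProduct B X) (h : ∀ ⦃Y⦄, A Y → ∀ f : Y ⟶ X, f = 0) : B X := by
  obtain ⟨Y, Z, f, g, k, hT, hY, hZ⟩ := hX
  obtain ⟨r, hr⟩ := exists_desc₂ hT (a := 𝟙 X) (by rw [h hY f, zero_comp])
  exact IsStableUnderRetracts.of_retract (P := B) ⟨g, r, hr.symm⟩ hZ

end CategoryTheory.ObjectProperty

open ObjectProperty

/-- Reduces a decomposition of a thick subcategory to its generators; all the decompositions below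
are obtained in this way. -/
lemma thick_le_extensionProduct [IsTriangulated C] {S A B : ObjectProperty C} [A.IsTriangulated]
    [B.IsTriangulated] [A.IsStableUnderRetracts] [B.IsStableUnderRetracts]
    (h : ∀ ⦃X Y⦄, A X → B Y → ∀ f : X ⟶ Y, f = 0) (hA : A.SplitsIdempotents)
    (hS : S ≤ A.extensionProduct B) : thick S ≤ A.extensionProduct B := by
  have := isTriangulated_extensionProduct h
  have := isStableUnderRetracts_extensionProduct h hA
  exact thick_le hS

/-! ### Fully faithful functors to Verdier quotients -/

section

variable [IsTriangulated C] (N : ObjectProperty C) [N.IsTriangulated] {N₁ N₂ : ObjectProperty C}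
  {J : Type*} [Category J] (F : J ⥤ C)

lemma isZero_verdierQ_obj {X : C} (hX : N X) : IsZero ((verdierQ N).obj X) := by
  obtain ⟨Z, hZ⟩ := HasZeroObject.zero (C := C)
  have h : N.trW (0 : X ⟶ Z) := by
    rw [trW_iff']
    refine ⟨X, 𝟙 X, 0, isomorphic_distinguished _ (contractible_distinguished X) _ ?_, hX⟩
    exact Triangle.isoMk _ _ (Iso.refl _) (Iso.refl _) (hZ.iso (isZero_zero C)) rfl
      ((isZero_zero C).eq_of_tgt _ _) (hZ.eq_of_src _ _)
  have := Localization.inverts (verdierQ N) N.trW _ h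
  exact ((verdierQ N).map_isZero hZ).of_iso (asIso ((verdierQ N).map (0 : X ⟶ Z)))

/-- Two maps identified in the quotient differ by a map through an object `M` of `N`. Maps from the
image of `F` to `M` factor through the part of `M` in `N₁`, and nothing nonzero goes from there to
the image of `F`. -/
lemma verdierQ_comp_faithful [F.Faithful] (hN : N ≤ N₁.extensionProduct N₂)
    (h₁ : ∀ ⦃X⦄, N₁ X → ∀ (Y : J) (f : X ⟶ F.obj Y), f = 0)
    (h₂ : ∀ ⦃X⦄, N₂ X → ∀ (Y : J) (f : F.obj Y ⟶ X), f = 0) : (F ⋙ verdierQ N).Faithful where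
  map_injective {X Y} f f' hf := F.map_injective (by
    have hf' : (verdierQ N).map (F.map f) = (verdierQ N).map (F.map f') := hf
    obtain ⟨Z, s, hs, h⟩ := (MorphismProperty.map_eq_iff_postcomp (verdierQ N) N.trW _ _).1 hf'
    rw [trW_iff'] at hs
    obtain ⟨M, m, k, hT, hM⟩ := hs
    obtain ⟨q, hq⟩ := exists_lift₂ hT (a := F.map f - F.map f')
      (by rw [Preadditive.sub_comp, sub_eq_zero, h])
    obtain ⟨A, B, a, b, c, hT', hA, hB⟩ := hN _ hM
    obtain ⟨q', hq'⟩ := exists_lift₂ hT' (a := q) (h₂ hB _ _)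
    rw [← sub_eq_zero, hq, hq', Category.assoc, h₁ hA _ (a ≫ m), comp_zero])

/-- Given a roof with numerator `φ.f` and denominator `φ.s` of cone `M`, the map from `F.obj X` to
`M` factors through the part `A` of `M` in `N₁`. Since `A` has no maps to the shift of `F.obj Y`,
the map from `A` to `M` lifts along `v`. Subtracting this lift, which is zero in the quotient, makes
the numerator factor through `φ.s`. -/
lemma verdierQ_comp_full [F.Full] (hN : N ≤ N₁.extensionProduct N₂) (hN₁ : N₁ ≤ N)
    (h₁ : ∀ ⦃X⦄, N₁ X → ∀ (Y : J) (n : ℤ) (f : X ⟶ (F.obj Y)⟦n⟧), f = 0)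
    (h₂ : ∀ ⦃X⦄, N₂ X → ∀ (Y : J) (f : F.obj Y ⟶ X), f = 0) : (F ⋙ verdierQ N).Full where
  map_surjective {X Y} g := by
    obtain ⟨φ, hφ⟩ := Localization.exists_leftFraction (verdierQ N) N.trW
      (X := F.obj X) (Y := F.obj Y) g
    obtain ⟨M, v, w, hT, hM⟩ := φ.hs
    obtain ⟨A, B, a, b, c, hT', hA, hB⟩ := hN _ hM
    obtain ⟨q, hq⟩ := exists_lift₂ hT' (a := φ.f ≫ v) (h₂ hB _ _)
    obtain ⟨a', ha'⟩ := exists_lift₃ hT (a := a) (h₁ hA _ _ _)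
    obtain ⟨f, hf⟩ := exists_lift₂ hT (a := φ.f - q ≫ a') (by
      rw [Preadditive.sub_comp, hq, Category.assoc, ← ha', sub_self])
    obtain ⟨f, rfl⟩ := F.map_surjective f
    refine ⟨f, ?_⟩
    have := Localization.inverts (verdierQ N) N.trW _ φ.hs
    rw [hφ, ← cancel_mono ((verdierQ N).map φ.s), MorphismProperty.LeftFraction.map_comp_map_s]
    refine ((verdierQ N).map_comp _ _).symm.trans ?_
    rw [← hf, Functor.map_sub, Functor.map_comp,
      (isZero_verdierQ_obj N (hN₁ _ hA)).eq_zero_of_tgt ((verdierQ N).map q), zero_comp, sub_zero]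

lemma verdierQ_comp_essSurj (h : ∀ E : C, ∃ (X : C) (Y : J) (f : X ⟶ E) (g : X ⟶ F.obj Y),
    N.trW f ∧ N.trW g) : (F ⋙ verdierQ N).EssSurj where
  mem_essImage E := by
    have : (verdierQ N).EssSurj := Localization.essSurj (verdierQ N) N.trW
    obtain ⟨X, Y, f, g, hf, hg⟩ := h ((verdierQ N).objPreimage E)
    have := Localization.inverts (verdierQ N) N.trW _ hf
    have := Localization.inverts (verdierQ N) N.trW _ hg
    exact ⟨Y, ⟨(asIso ((verdierQ N).map g)).symm ≪≫ asIso ((verdierQ N).map f) ≪≫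
      (verdierQ N).objObjPreimageIso E⟩⟩

end

/-! ### Triangulated functors which are fully faithful on generators -/

section

variable {D : Type*} [Category D] [HasZeroObject D] [HasShift D ℤ] [Preadditive D]
  [∀ n : ℤ, (shiftFunctor D n).Additive] [Pretriangulated D] (F : C ⥤ D)

/-- The objects `X` such that `F` is bijective on the morphisms with source `X`. -/
def bijectiveFrom {C D : Type*} [Category C] [Category D] (F : C ⥤ D) : ObjectProperty C :=
  fun X ↦ ∀ Z : C, Function.Bijective (F.map : (X ⟶ Z) → _)

instance : (bijectiveFrom F).IsStableUnderRetracts where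
  of_retract {X Y} r hY Z := by
    refine ⟨fun f f' h ↦ ?_, fun g ↦ ?_⟩
    · have : r.r ≫ f = r.r ≫ f' := (hY Z).1 (by rw [F.map_comp, F.map_comp, h])
      rw [← Category.id_comp f, ← r.retract, Category.assoc, this, r.retract_assoc]
    · obtain ⟨f, hf⟩ := (hY Z).2 (F.map r.r ≫ g)
      exact ⟨r.i ≫ f, by rw [F.map_comp, hf, ← Category.assoc, ← F.map_comp, r.retract,
        F.map_id, Category.id_comp]⟩

lemma bijectiveFrom_shift [F.CommShift ℤ] {X : C} (hX : bijectiveFrom F X) (n : ℤ) :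
    bijectiveFrom F (X⟦n⟧) := fun Z ↦ by
  have h : bijectiveFrom F (X⟦n⟧⟦-n⟧) :=
    prop_of_iso _ ((shiftFunctorCompIsoId C n (-n) (by simp)).symm.app X) hX
  have nat {f : X⟦n⟧ ⟶ Z} : F.map (f⟦-n⟧') = (F.commShiftIso (-n)).hom.app _ ≫ (F.map f)⟦-n⟧' ≫
      (F.commShiftIso (-n)).inv.app _ := by
    rw [← F.commShiftIso_hom_naturality_assoc, Iso.hom_inv_id_app]
    exact (Category.comp_id _).symm
  refine ⟨fun f f' hf ↦ (shiftFunctor C (-n)).map_injective ((h _).1 ?_), fun g ↦ ?_⟩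
  · rw [nat, nat, hf]
  · obtain ⟨k, hk⟩ := (h _).2 ((F.commShiftIso (-n)).hom.app _ ≫ g⟦-n⟧' ≫
      (F.commShiftIso (-n)).inv.app _)
    obtain ⟨f, rfl⟩ := (shiftFunctor C (-n)).map_surjective k
    rw [nat, cancel_epi, cancel_mono] at hk
    exact ⟨f, (shiftFunctor D (-n)).map_injective hk⟩

/-- A five lemma in the source variable alone, the target being arbitrary. Bijectivity on generators
thus extends to the thick subcategory they generate, with no condition on the targets. -/
instance [F.CommShift ℤ] [F.IsTriangulated] : (bijectiveFrom F).IsTriangulated where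
  exists_zero := ⟨_, isZero_zero C, fun Z ↦ by
    have := (F.map_isZero (isZero_zero C))
    exact ⟨fun f f' _ ↦ (isZero_zero C).eq_of_src _ _, fun g ↦ ⟨0, this.eq_of_src _ _⟩⟩⟩
  isStableUnderShiftBy n := ⟨fun X hX ↦ bijectiveFrom_shift F hX n⟩
  toIsTriangulatedClosed₂ := isTriangulatedClosed₂_of fun X₁ X₂ X₃ m₁ m₂ m₃ hT h₁ h₃ Z ↦ by
    have hT' := distTriang_map F hT
    refine ⟨(injective_iff_map_eq_zero F.mapAddHom).2 fun (f : X₂ ⟶ Z) hf ↦ ?_, fun g ↦ ?_⟩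
    · replace hf : F.map f = 0 := hf
      obtain ⟨t, ht⟩ := exists_desc₂ hT (a := f) ((h₁ Z).1 (by
        rw [F.map_comp, hf, comp_zero, F.map_zero]))
      obtain ⟨v, hv⟩ := exists_desc₃ hT' (a := F.map t) (by rw [← F.map_comp, ← ht, hf])
      obtain ⟨v', hv'⟩ := (bijectiveFrom_shift F h₁ 1 Z).2 ((F.commShiftIso (1 : ℤ)).hom.app _ ≫ v)
      have : t = m₃ ≫ v' := (h₃ Z).1 (by rw [F.map_comp, hv', hv, Category.assoc])
      rw [ht, this, ← Category.assoc, distTriang_comp₂₃ hT, zero_comp]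
    · obtain ⟨a, ha⟩ := (h₁ Z).2 (F.map m₁ ≫ g)
      -- The preimage `a` over `X₁` extends to `X₂`: its restriction along `δ` is killed by `F`,
      -- which is faithful on the maps from `X₃⟦-1⟧`. What remains of `g` vanishes on `X₁` and comes
      -- from `X₃`.
      obtain ⟨δ, k', hδ⟩ := exists_fiber hT
      obtain ⟨f, hf⟩ := exists_desc₂ hδ (a := a) ((bijectiveFrom_shift F h₃ (-1) Z).1 (by
          rw [F.map_comp, ha, ← Category.assoc, ← F.map_comp, distTriang_comp₁₂ hδ, F.map_zero,
            F.map_zero, zero_comp]))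
      obtain ⟨w, hw⟩ := exists_desc₂ hT' (a := g - F.map f) (by
        rw [Preadditive.comp_sub, ← ha, hf, F.map_comp, sub_self])
      obtain ⟨w', rfl⟩ := (h₃ Z).2 w
      exact ⟨m₂ ≫ w' + f, by rw [F.map_add, F.map_comp, ← hw, sub_add_cancel]⟩

/-- The idempotent of the summand lifts through `F`, splits in the source, and the image of the
splitting is the summand. -/
lemma isStableUnderRetracts_essImage {C D : Type*} [Category C] [Category D] (F : C ⥤ D) [F.Full]
    [F.Faithful] (h : (⊤ : ObjectProperty C).SplitsIdempotents) :
    F.essImage.IsStableUnderRetracts where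
  of_retract {X Y} r hY := by
    obtain ⟨Z, ⟨e⟩⟩ := hY
    obtain ⟨k, hk⟩ := F.map_surjective (e.hom ≫ r.r ≫ r.i ≫ e.inv)
    obtain ⟨W, i, p, hip, hpi⟩ := h (X := Z) trivial k (F.map_injective (by simp [hk]))
    have h₁ := congrArg F.map hip
    have h₂ := congrArg F.map hpi
    rw [F.map_comp] at h₁ h₂
    refine ⟨W, ⟨⟨F.map i ≫ e.hom ≫ r.r, r.i ≫ e.inv ≫ F.map p, ?_, ?_⟩⟩⟩
    · have : e.hom ≫ r.r ≫ r.i ≫ e.inv = F.map p ≫ F.map i := by rw [h₂, hk]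
      rw [Category.assoc, Category.assoc, reassoc_of% this, reassoc_of% h₁, h₁, F.map_id, Category.id_comp]
    · rw [Category.assoc, Category.assoc, reassoc_of% h₂, hk]
      simp

end

end

/-! ### Splitting of idempotents -/

section

variable {C : Type*} [Category C] [HasZeroObject C] [HasShift C ℤ] [Preadditive C]
  [∀ n : ℤ, (shiftFunctor C n).Additive] [Pretriangulated C]

/-- In a triangulated category, a split monomorphism `φ` has a complement. -/
lemma exists_complement {V W : C} (φ : V ⟶ W) (ψ : W ⟶ V) (h : φ ≫ ψ = 𝟙 V) :
    ∃ (Z : C) (s : Z ⟶ W) (c : W ⟶ Z), s ≫ c = 𝟙 Z ∧ c ≫ s = 𝟙 W - ψ ≫ φ := by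
  obtain ⟨Z, c, k, hT⟩ := distinguished_cocone_triangle φ
  -- The shift of `φ` is a split monomorphism, and `k` composed with it is zero.
  have hk : k = 0 := by
    have : k ≫ φ⟦(1 : ℤ)⟧' = 0 := comp_distTriang_mor_zero₃₁ _ hT
    rw [← Category.comp_id k, ← CategoryTheory.Functor.map_id, ← h, CategoryTheory.Functor.map_comp, ← Category.assoc, this,
      zero_comp]
  obtain ⟨s, hs⟩ := exists_desc₂ hT (a := 𝟙 W - ψ ≫ φ) (by
    rw [Preadditive.comp_sub, ← Category.assoc, h, Category.comp_id, Category.id_comp, sub_self])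
  refine ⟨Z, s, c, ?_, hs.symm⟩
  obtain ⟨b, hb⟩ := exists_desc₃ hT (a := s ≫ c - 𝟙 Z) (by
    rw [Preadditive.comp_sub, ← Category.assoc, ← hs, Preadditive.sub_comp, Category.assoc,
      distTriang_comp₁₂ hT]
    simp)
  rwa [hk, zero_comp, sub_eq_zero] at hb

/-- An idempotent `e` of `W` splits if `W` is a summand of an object `V` (such as a countable
power of `W`) to which `e` extends and on which there is a shift operator. -/
lemma exists_split_of_shift {V W : C} (e : W ⟶ W) (he : e ≫ e = e) (ι : W ⟶ V) (π : V ⟶ W)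
    (R L E : V ⟶ V) (hιπ : ι ≫ π = 𝟙 W) (hRL : R ≫ L = 𝟙 V) (hLR : L ≫ R = 𝟙 V - π ≫ ι)
    (hE : E ≫ E = E) (hER : E ≫ R = R ≫ E) (hEL : E ≫ L = L ≫ E) (hEπ : E ≫ π = π ≫ e) :
    ∃ (Z : C) (i : Z ⟶ W) (r : W ⟶ Z), i ≫ r = 𝟙 Z ∧ r ≫ i = e := by
  have hRE : R ≫ E ≫ L = E := by rw [hEL, ← Category.assoc, hRL, Category.id_comp]
  have hELE : E ≫ L ≫ E = E ≫ L := by rw [← hEL, ← Category.assoc, hE]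
  have hERE : E ≫ R ≫ E = E ≫ R := by rw [← hER, ← Category.assoc, hE]
  -- Eilenberg swindle: shift to the right on the image of `E` and do nothing on its complement.
  -- Shifting back is a retraction, and what is missed is the first copy of the image of `e`: the
  -- complementary idempotent is `E ≫ (𝟙 V - L ≫ R) = π ≫ e ≫ ι`.
  obtain ⟨Z, s, c, hsc, hcs⟩ := exists_complement (𝟙 V - E + E ≫ R) (𝟙 V - E + E ≫ L) (by
    simp only [Preadditive.add_comp, Preadditive.comp_add, Preadditive.sub_comp,
      Preadditive.comp_sub, Category.id_comp, Category.comp_id, Category.assoc, hE, hRE, hERE]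
    rw [← Category.assoc E E, hE]
    abel)
  have h : c ≫ s = π ≫ e ≫ ι := by
    rw [hcs]
    simp only [Preadditive.add_comp, Preadditive.comp_add, Preadditive.sub_comp,
      Preadditive.comp_sub, Category.id_comp, Category.comp_id, Category.assoc, hE, hELE]
    rw [← Category.assoc L E R, ← hEL, Category.assoc, hLR, ← Category.assoc E E, hE]
    simp only [Preadditive.comp_sub, Category.comp_id]
    rw [← Category.assoc E E, hE, ← Category.assoc E π, hEπ, Category.assoc]
    abel
  refine ⟨Z, s ≫ π, ι ≫ c, ?_, ?_⟩
  · have h₁ : c ≫ (s ≫ π ≫ ι ≫ c) ≫ s = c ≫ s := by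
      simp only [Category.assoc]
      rw [h, ← Category.assoc c s, h]
      simp only [Category.assoc]
      rw [← Category.assoc ι π, hιπ, Category.id_comp, ← Category.assoc ι π, hιπ, Category.id_comp,
        ← Category.assoc e e, he]
    calc (s ≫ π) ≫ ι ≫ c = (s ≫ c) ≫ (s ≫ π ≫ ι ≫ c) ≫ (s ≫ c) := by
          rw [hsc]; simp
      _ = s ≫ (c ≫ (s ≫ π ≫ ι ≫ c) ≫ s) ≫ c := by simp only [Category.assoc]
      _ = 𝟙 Z := by rw [h₁, Category.assoc, hsc, Category.comp_id, hsc]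
  · rw [Category.assoc, ← Category.assoc c s, h]
    simp only [Category.assoc]
    rw [hιπ, Category.comp_id, ← Category.assoc, hιπ, Category.id_comp]

end

variable {G : Type u} [AddCommGroup G]

namespace DGMod

variable {Γ : DGRing G} {M N P : DGMod Γ}

/-- The countable power of a dg module. -/
def pow (M : DGMod Γ) : DGMod Γ where
  X i g := ℕ → M.X i g
  d h g := (M.d h g).compLeft ℕ
  act hi hg := AddMonoidHom.mk' (fun x ↦ AddMonoidHom.mk' (fun a n ↦ M.act hi hg (x n) a)
    (by intros; ext; simp)) (by intros; ext; simp)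
  d_d hi hj g x := by funext n; exact M.d_d hi hj g (x n)
  act_one x := by funext n; exact M.act_one (x n)
  act_assoc h₁₂ h₂₃ h h' e₁₂ e₂₃ e e' x a b := by
    funext n; exact M.act_assoc h₁₂ h₂₃ h h' e₁₂ e₂₃ e e' (x n) a b
  d_act hi hj hk h₁ h₂ h₃ e x a := by
    funext n; exact M.d_act hi hj hk h₁ h₂ h₃ e (x n) a

/-- The morphism between countable powers induced by a morphism. -/
def powMap (f : M ⟶ N) : pow M ⟶ pow N :=
  mkHom (M := pow M) (N := pow N) (fun i g ↦ (app f i g).compLeft ℕ)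
    (fun h g x ↦ by funext n; exact app_d f h g (x n))
    (fun hi hg x a ↦ by funext n; exact app_act f hi hg (x n) a)

lemma powMap_comp (f : M ⟶ N) (g : N ⟶ P) : powMap (f ≫ g) = powMap f ≫ powMap g := rfl

lemma powMap_sub (f g : M ⟶ N) : powMap (f - g) = powMap f - powMap g := rfl

lemma powMap_mem_nullHomotopic {f : M ⟶ N} (hf : f ∈ nullHomotopic M N) :
    powMap f ∈ nullHomotopic (pow M) (pow N) := by
  obtain ⟨s, hs, hs'⟩ := hf
  refine ⟨fun h g ↦ (s h g).compLeft ℕ, ?_, ?_⟩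
  · intro i i' j k k' g h l hi hk e e' hg x a
    funext n
    exact hs hi hk e e' hg (x n) a
  · intro i j k hj hk g x
    funext n
    exact hs' hj hk g (x n)

/-- The first factor of the countable power. -/
def powIn (M : DGMod Γ) : M ⟶ pow M :=
  mkHom (N := pow M) (fun i g ↦ AddMonoidHom.mk'
      (fun (x : M.X i g) n ↦ match n with | 0 => x | _ + 1 => 0)
      (fun _ _ ↦ by funext n; cases n; exacts [rfl, (add_zero _).symm]))
    (fun h g _ ↦ by funext n; cases n; exacts [rfl, (map_zero (M.d h g)).symm])
    (fun hi hg _ a ↦ by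
      funext n; cases n; exacts [rfl, (DFunLike.congr_fun (map_zero (M.act hi hg)) a).symm])

/-- The projection to the first factor of the countable power. -/
def powOut (M : DGMod Γ) : pow M ⟶ M :=
  mkHom (M := pow M) (fun i g ↦ Pi.evalAddMonoidHom (fun _ : ℕ ↦ M.X i g) 0)
    (fun _ _ _ ↦ rfl) (fun _ _ _ _ ↦ rfl)

/-- The shift to the left. -/
def powLeft (M : DGMod Γ) : pow M ⟶ pow M :=
  mkHom (M := pow M) (N := pow M) (fun _ _ ↦ AddMonoidHom.mk' (fun x n ↦ x (n + 1)) (fun _ _ ↦ rfl))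
    (fun _ _ _ ↦ rfl) (fun _ _ _ _ ↦ rfl)

/-- The shift to the right. -/
def powRight (M : DGMod Γ) : pow M ⟶ pow M :=
  mkHom (M := pow M) (N := pow M) (fun i g ↦ AddMonoidHom.mk'
      (fun x n ↦ match n with | 0 => (0 : M.X i g) | n + 1 => x n)
      (fun _ _ ↦ by funext n; cases n; exacts [(add_zero _).symm, rfl]))
    (fun h g _ ↦ by funext n; cases n; exacts [(map_zero (M.d h g)).symm, rfl])
    (fun hi hg _ a ↦ by
      funext n; cases n; exacts [(DFunLike.congr_fun (map_zero (M.act hi hg)) a).symm, rfl])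

/-- A representative `e` is idempotent only up to homotopy, so its image as a map of dg modules is
useless. Homotopies act factorwise on countable powers, which lets the swindle run in the homotopy
category. -/
lemma splitsIdempotents_hoCat : (⊤ : ObjectProperty (HoCat Γ)).SplitsIdempotents := by
  rintro ⟨W⟩ - e he
  obtain ⟨e, rfl⟩ := (toHo Γ).map_surjective (X := W) (Y := W) e
  have map {A B C D : DGMod Γ} {a : A ⟶ B} {b : B ⟶ D} {a' : A ⟶ C} {b' : C ⟶ D}
      (h : a ≫ b = a' ≫ b') : (toHo Γ).map a ≫ (toHo Γ).map b =
        (toHo Γ).map a' ≫ (toHo Γ).map b' := map_comp_eq h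
  refine exists_split_of_shift (V := (toHo Γ).obj (pow W)) ((toHo Γ).map e) he
    ((toHo Γ).map (powIn W)) ((toHo Γ).map (powOut W)) ((toHo Γ).map (powRight W))
    ((toHo Γ).map (powLeft W)) ((toHo Γ).map (powMap e)) ?_ ?_ ?_ ?_ ?_ ?_ ?_
  · rw [← CategoryTheory.Functor.map_comp, ← CategoryTheory.Functor.map_id]; rfl
  · rw [← CategoryTheory.Functor.map_comp, ← CategoryTheory.Functor.map_id]; rfl
  · rw [← CategoryTheory.Functor.map_comp, ← CategoryTheory.Functor.map_id, ← CategoryTheory.Functor.map_comp, ← CategoryTheory.Functor.map_sub]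
    congr 1
    ext i g x
    funext n
    cases n
    · exact (sub_self _).symm
    · exact (sub_zero _).symm
  · rw [← CategoryTheory.Functor.map_comp, ← sub_eq_zero, ← CategoryTheory.Functor.map_sub, toHo_map_eq_zero_iff, ← powMap_comp,
      ← powMap_sub]
    refine powMap_mem_nullHomotopic ?_
    rw [← toHo_map_eq_zero_iff, CategoryTheory.Functor.map_sub, CategoryTheory.Functor.map_comp]
    exact sub_eq_zero.2 he
  · refine map ?_
    ext i g x
    funext n
    cases n
    · exact (map_zero (app e i g)).symm
    · rfl
  · exact map rfl
  · exact map rfl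

/-! ### K-projective dg modules -/

lemma kProjective_iff (P : DGMod Γ) :
    P.KProjective ↔ (acyclic Γ).leftOrthogonal ((toHo Γ).obj P) := by
  constructor
  · rintro h ⟨N⟩ f hN
    obtain ⟨f, rfl⟩ := (toHo Γ).map_surjective (X := P) (Y := N) f
    exact (toHo_map_eq_zero_iff f).2 (h N hN f)
  · intro h N hN f
    exact (toHo_map_eq_zero_iff f).1 (h (Y := (toHo Γ).obj N) ((toHo Γ).map f) hN)

/-- The functor from dg modules to the derived category. -/
abbrev toDer (Γ : DGRing G) : DGMod Γ ⥤ Derived Γ := toHo Γ ⋙ verdierQ (acyclic Γ)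

/-- K-projective modules are left orthogonal to the acyclic ones, so morphisms from them in the
derived category are homotopy classes of morphisms of dg modules. -/
lemma KProjective.exists_map (hP : P.KProjective) (f : toD P ⟶ toD N) :
    ∃ f' : P ⟶ N, (toDer Γ).map f' = f := by
  obtain ⟨f', hf'⟩ := (ObjectProperty.leftOrthogonal.map_bijective_of_isTriangulated
    ((kProjective_iff P).1 hP) (verdierQ (acyclic Γ)) ((toHo Γ).obj N)).2 f
  obtain ⟨f'', rfl⟩ := (toHo Γ).map_surjective (X := P) (Y := N) f'
  exact ⟨f'', hf'⟩

lemma KProjective.map_eq_zero_iff (hP : P.KProjective) (f : P ⟶ N) :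
    (toDer Γ).map f = 0 ↔ f ∈ nullHomotopic P N := by
  rw [← toHo_map_eq_zero_iff]
  refine ⟨fun h ↦ (ObjectProperty.leftOrthogonal.map_bijective_of_isTriangulated
    ((kProjective_iff P).1 hP) (verdierQ (acyclic Γ)) ((toHo Γ).obj N)).1 ?_, fun h ↦ ?_⟩
  · exact h.trans ((verdierQ (acyclic Γ)).map_zero _ _).symm
  · exact (congrArg (verdierQ (acyclic Γ)).map h).trans ((verdierQ (acyclic Γ)).map_zero _ _)

instance : ((acyclic Γ).leftOrthogonal.ι ⋙ verdierQ (acyclic Γ)).Full where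
  map_surjective {X Y} f := by
    obtain ⟨g, hg⟩ := (ObjectProperty.leftOrthogonal.map_bijective_of_isTriangulated
      X.2 (verdierQ (acyclic Γ)) Y.obj).2 f
    exact ⟨ObjectProperty.homMk g, hg⟩

instance : ((acyclic Γ).leftOrthogonal.ι ⋙ verdierQ (acyclic Γ)).Faithful where
  map_injective {X Y} f g h := by
    ext
    exact (ObjectProperty.leftOrthogonal.map_bijective_of_isTriangulated
      X.2 (verdierQ (acyclic Γ)) Y.obj).1 h

/-- The objects of the derived category which have a K-projective resolution. -/
def resolved (Γ : DGRing G) : ObjectProperty (Derived Γ) :=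
  ((acyclic Γ).leftOrthogonal.ι ⋙ verdierQ (acyclic Γ)).essImage

lemma resolved_iff (X : Derived Γ) :
    resolved Γ X ↔ ∃ P : DGMod Γ, P.KProjective ∧ Nonempty (toD P ≅ X) := by
  constructor
  · rintro ⟨⟨⟨P⟩, hP⟩, e⟩
    exact ⟨P, (kProjective_iff P).2 hP, e⟩
  · rintro ⟨P, hP, e⟩
    exact ⟨⟨(toHo Γ).obj P, (kProjective_iff P).1 hP⟩, e⟩

lemma KProjective.resolved (hP : P.KProjective) : resolved Γ (toD P) :=
  (resolved_iff _).2 ⟨P, hP, ⟨Iso.refl _⟩⟩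

instance : (resolved Γ).IsTriangulated :=
  inferInstanceAs ((acyclic Γ).leftOrthogonal.ι ⋙ verdierQ (acyclic Γ)).essImage.IsTriangulated

lemma _root_.CategoryTheory.ObjectProperty.SplitsIdempotents.fullSubcategory {C : Type*}
    [Category C] {P : ObjectProperty C} (h : P.SplitsIdempotents) [P.IsStableUnderRetracts] :
    (⊤ : ObjectProperty P.FullSubcategory).SplitsIdempotents := by
  intro X _ e he
  obtain ⟨Y, i, r, hir, hri⟩ := h X.2 e.hom (congrArg InducedCategory.Hom.hom he)
  exact ⟨⟨Y, ObjectProperty.IsStableUnderRetracts.of_retract (P := P) ⟨i, r, hir⟩ X.2⟩,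
    ObjectProperty.homMk i, ObjectProperty.homMk r, by ext; exact hir, by ext; exact hri⟩

lemma _root_.CategoryTheory.ObjectProperty.SplitsIdempotents.mono {C : Type*}
    [Category C] {P Q : ObjectProperty C} (h : P ≤ Q) (hQ : Q.SplitsIdempotents) :
    P.SplitsIdempotents := fun _ hX ↦ hQ (h _ hX)

/-- The countable power used by the swindle may fail to be K-projective, but the image it produces
is a retract of the given K-projective object. -/
lemma splitsIdempotents_leftOrthogonal :
    (⊤ : ObjectProperty (acyclic Γ).leftOrthogonal.FullSubcategory).SplitsIdempotents :=
  (splitsIdempotents_hoCat.mono le_top).fullSubcategory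

instance : (resolved Γ).IsStableUnderRetracts :=
  isStableUnderRetracts_essImage _ splitsIdempotents_leftOrthogonal

lemma splitsIdempotents_resolved : (resolved Γ).SplitsIdempotents := by
  intro X hX e he
  obtain ⟨P, ⟨a⟩⟩ := hX
  let F := (acyclic Γ).leftOrthogonal.ι ⋙ verdierQ (acyclic Γ)
  obtain ⟨k, hk⟩ := F.map_surjective (a.hom ≫ e ≫ a.inv)
  obtain ⟨Z, i, r, hir, hri⟩ := splitsIdempotents_leftOrthogonal (X := P) trivial k
    (F.map_injective (by rw [F.map_comp, hk]; simp [reassoc_of% he]))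
  have h₁ := congrArg F.map hir
  have h₂ := congrArg F.map hri
  rw [F.map_comp] at h₁ h₂
  refine ⟨F.obj Z, F.map i ≫ a.hom, a.inv ≫ F.map r, ?_, ?_⟩
  · rw [Category.assoc, Iso.hom_inv_id_assoc, h₁, F.map_id]
  · rw [Category.assoc, reassoc_of% h₂, hk]; simp

/-! ### Free dg modules -/

lemma _root_.DGRing.d_one (Γ : DGRing G) {j : ℤ} (h : 0 + 1 = j) : Γ.d h 0 Γ.one = 0 := by
  subst h
  have := Γ.d_mul (i := 0) (j := 0) (k := 0) rfl rfl rfl (add_zero 0) (add_zero (0 + 1))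
    (zero_add (0 + 1)) (add_zero (0 : G)) Γ.one Γ.one
  rw [Γ.mul_one, Γ.mul_one, Γ.one_mul, dgSign.zero, one_smul] at this
  simpa using this

lemma _root_.DGRing.d_oneOf (Γ : DGRing G) {j : ℤ} (h : 0 + 1 = j) {g : G} (e : 0 = g) :
    Γ.d h g (Γ.oneOf e) = 0 := by
  subst e; exact Γ.d_one h

/-- The free dg module `Γ(g)`. -/
abbrev free (Γ : DGRing G) (g : G) : DGMod Γ := (regular Γ).twist g

/-- The generator of a free dg module. -/
def gen (Γ : DGRing G) (g : G) : (free Γ g).X 0 (-g) := Γ.oneOf (g := g + -g) (by simp)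

lemma d_gen {j : ℤ} (h : 0 + 1 = j) (g : G) : (free Γ g).d h (-g) (gen Γ g) = 0 :=
  Γ.d_oneOf h _

lemma gen_act {i : ℤ} {g l : G} (a : Γ.X i (g + l)) :
    (free Γ g).act (zero_add i) (show -g + (g + l) = l by abel) (gen Γ g) a = a :=
  Γ.oneOf_mul _ _ a

lemma app_free {g : G} (f : free Γ g ⟶ M) {i : ℤ} {l : G} (a : Γ.X i (g + l)) :
    app f i l a = M.act (zero_add i) (show -g + (g + l) = l by abel) (app f 0 (-g) (gen Γ g)) a := by
  rw [← app_act, gen_act]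

lemma d_act_of_d_eq_zero {i i' j j' k k' : ℤ} {g h l : G} (hi : i + 1 = i') (hj : j + 1 = j')
    (hk : k + 1 = k') (h₁ : i + j = k) (h₃ : i + j' = k') (e : g + h = l) {x : M.X i g}
    (hx : M.d hi g x = 0) (a : Γ.X j h) :
    M.d hk l (M.act h₁ e x a) = dgSign i • M.act h₃ e x (Γ.d hj h a) := by
  rw [M.d_act hi hj hk h₁ (by omega) h₃, hx, map_zero, AddMonoidHom.zero_apply, zero_add]

/-- The morphism from a free dg module which maps the generator to a given cocycle. -/
def freeHom (g : G) (x : M.X 0 (-g)) (hx : M.d rfl (-g) x = 0) : free Γ g ⟶ M :=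
  mkHom (M := free Γ g) (fun i l ↦ M.act (zero_add i) (show -g + (g + l) = l by abel) x)
    (fun {i j} h _ a ↦ ((d_act_of_d_eq_zero rfl h h (zero_add i) (zero_add j) _ hx a).trans
      (by rw [dgSign.zero, one_smul]; rfl)).symm)
    (fun {i j k h h' l} hi hg a b ↦ (M.act_assoc (zero_add i) hi hi (zero_add k) _
      (by rw [add_assoc, hg]) hg _ x a b).symm)

lemma freeHom_gen (g : G) (x : M.X 0 (-g)) (hx : M.d rfl (-g) x = 0) :
    app (freeHom g x hx) 0 (-g) (gen Γ g) = x := by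
  have key : ∀ {l : G} (e : 0 = l) (e' : -g + l = -g),
      M.act (zero_add 0) e' x (Γ.oneOf e) = x := by
    rintro l rfl e'
    exact M.act_one x
  exact key _ _

/-- A linear homotopy is determined by its value on the generator, and any `y` is allowed. Since `y`
has degree `-1`, the Leibniz rule reads `(dy)a = d(ya) + y(da)`, which is the homotopy relation. -/
lemma free_nullHomotopic_iff {g : G} (f : free Γ g ⟶ M) : f ∈ nullHomotopic _ _ ↔
    ∃ y : M.X (-1) (-g), M.d (by omega) (-g) y = app f 0 (-g) (gen Γ g) := by
  constructor
  · rintro ⟨s, hs, hs'⟩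
    refine ⟨s (by omega) _ (gen Γ g), ?_⟩
    rw [hs' (show -1 + 1 = 0 by omega) rfl, d_gen, map_zero, add_zero]
  · rintro ⟨y, hy⟩
    refine ⟨fun {i j} h l ↦ M.act (by omega) (show -g + (g + l) = l by abel) y, ?_, ?_⟩
    · intro i i' j k k' g h l hi hk e e' hg x a
      exact (M.act_assoc _ _ _ _ _ _ _ _ y x a).symm
    · intro i j k hj hk l x
      refine (app_free f x).trans ?_
      rw [← hy]
      have := M.d_act (i := -1) (i' := 0) (by omega) hk hj (by omega) (zero_add i) (by omega)
        (show -g + (g + l) = l by abel) y x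
      simp only [dgSign, Int.negOnePow_neg, Int.negOnePow_one, Units.val_neg, Units.val_one,
        neg_smul, one_smul, ← sub_eq_add_neg] at this
      exact eq_add_of_sub_eq this.symm

lemma kProjective_free (g : G) : (free Γ g).KProjective := fun N hN f ↦ by
  rw [free_nullHomotopic_iff]
  exact hN _ _ rfl _ (by rw [← app_d, d_gen, map_zero])

/-- The functor to the derived category is compatible with the shift. -/
def toDShift (M : DGMod Γ) (n : ℤ) : toD (M.shiftObj n) ≅ (toD M)⟦n⟧ :=
  ((toDer Γ).commShiftIso n).app M

lemma exactAt_shiftObj {g : G} (h : M.ExactAt g) (n : ℤ) : (M.shiftObj n).ExactAt g := by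
  intro i j k hi hj x hx
  obtain ⟨y, hy⟩ := h (show i + n + 1 = j + n by omega) (show j + n + 1 = k + n by omega) x (by
    have : dgSign n • (M.shiftObj n).d hj g x = 0 := by rw [hx, smul_zero]
    rw [shiftObj_d, smul_smul, dgSign.mul_self, one_smul] at this
    exact this)
  refine ⟨dgSign n • y, ?_⟩
  rw [shiftObj_d, map_zsmul, smul_smul, dgSign.mul_self, one_smul, hy]

/-- By the value on the generator, the morphisms from `Γ(-g)` to `M[n]` are the cocycles of `M` of
degree `(n, g)` modulo boundaries. Conditions on cohomology thereby become conditions on morphisms,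
invariant in the derived category. -/
lemma free_hom_eq_zero_iff (g : G) (M : DGMod Γ) :
    (∀ (n : ℤ) (f : toD (free Γ (-g)) ⟶ (toD M)⟦n⟧), f = 0) ↔ M.ExactAt g := by
  obtain ⟨h, rfl⟩ : ∃ h, g = -h := ⟨-g, by simp⟩
  rw [neg_neg]
  constructor
  · intro H i j k hi hj x hx
    have h₀ : j = 0 + j := (zero_add j).symm
    -- The generator has cohomological degree `0`, and the degree `0` part of the shift is the part
    -- of `M` of degree `0 + j`; hence the transport.
    let f := freeHom (M := M.shiftObj j) h (M.castHom h₀ _ x) (by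
      rw [shiftObj_d, ← castHom_d M hj (by omega) h₀ (by omega), hx, map_zero, smul_zero])
    have hf := (kProjective_free h).map_eq_zero_iff f |>.1 (by
      exact (cancel_mono (toDShift M j).hom).1 ((H j _).trans zero_comp.symm))
    rw [free_nullHomotopic_iff, freeHom_gen] at hf
    obtain ⟨y, hy⟩ := hf
    refine ⟨M.castHom (by omega) _ (dgSign j • y), ?_⟩
    rw [shiftObj_d, ← map_zsmul] at hy
    have h₁ := congrArg (M.castHom h₀.symm _) hy
    rw [castHom_castHom, castHom_rfl, castHom_d M _ hi (by omega) (by omega)] at h₁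
    exact h₁
  · intro H n f
    obtain ⟨f', hf'⟩ := (kProjective_free h).exists_map (f ≫ (toDShift M n).inv)
    refine (cancel_mono (toDShift M n).inv).1 (hf'.symm.trans (Eq.trans ?_ zero_comp.symm))
    refine ((kProjective_free h).map_eq_zero_iff f').2 ((free_nullHomotopic_iff f').2 ?_)
    exact exactAt_shiftObj H n _ rfl _ (by rw [← app_d, d_gen, map_zero])

lemma exactAt_of_iso {g : G} (e : toD M ≅ toD N) (h : M.ExactAt g) : N.ExactAt g := by
  rw [← free_hom_eq_zero_iff] at h ⊢
  intro n f
  rw [← cancel_mono (e.inv⟦n⟧'), zero_comp]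
  exact h n _

/-- Provides perfect objects with K-projective resolutions, and hence with split idempotents. -/
lemma per_le_resolved (I : Set G) : Γ.per I ≤ resolved Γ :=
  thick_le (by rintro _ ⟨g, -, rfl⟩; exact (kProjective_free (-g)).resolved)

end DGMod

/-! ### Exact functors between categories of dg modules -/

namespace DGMod

variable {G G' : Type u} [AddCommGroup G] [AddCommGroup G'] {Γ : DGRing G} {Γ' : DGRing G'}

/-- A functor between categories of dg modules is exact if it preserves null-homotopic morphisms,
mapping cones and acyclic dg modules. -/
class IsExact (Φ : DGMod Γ ⥤ DGMod Γ') [Φ.CommShift ℤ] : Prop where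
  nullHomotopic : ∀ {M N : DGMod Γ} {f : M ⟶ N}, f ∈ nullHomotopic M N →
    Φ.map f ∈ nullHomotopic (Φ.obj M) (Φ.obj N)
  cone : ∀ {M N : DGMod Γ} (f : M ⟶ N), ∃ e : Φ.obj (cone f) ≅ cone (Φ.map f),
    Φ.map (coneIn f) ≫ e.hom = coneIn _ ∧
      e.hom ≫ coneOut (Φ.map f) = Φ.map (coneOut f) ≫ (Φ.commShiftIso (1 : ℤ)).hom.app M
  acyclic : ∀ {M : DGMod Γ}, M.Acyclic → (Φ.obj M).Acyclic

variable (Φ : DGMod Γ ⥤ DGMod Γ') [Φ.CommShift ℤ] [Φ.Additive] [IsExact Φ]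

lemma map_homotopic {M N : DGMod Γ} (f f' : M ⟶ N) (h : homotopic Γ f f') :
    (Φ ⋙ toHo Γ').map f = (Φ ⋙ toHo Γ').map f' := by
  rw [← sub_eq_zero, ← CategoryTheory.Functor.map_sub]
  exact (toHo_map_eq_zero_iff _).2 (IsExact.nullHomotopic h)

/-- The functor between homotopy categories induced by an exact functor. -/
def mapHo : HoCat Γ ⥤ HoCat Γ' :=
  CategoryTheory.Quotient.lift (homotopic Γ) (Φ ⋙ toHo Γ') (fun _ _ ↦ map_homotopic Φ)

instance : (mapHo Φ).CommShift ℤ :=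
  inferInstanceAs ((CategoryTheory.Quotient.lift (homotopic Γ) (Φ ⋙ toHo Γ') _).CommShift ℤ)

/-- The functor `mapHo Φ` is induced by `Φ`. -/
def mapHoFac : toHo Γ ⋙ mapHo Φ ≅ Φ ⋙ toHo Γ' := CategoryTheory.Quotient.lift.isLift _ _ _

instance : NatTrans.CommShift (mapHoFac Φ).hom ℤ :=
  inferInstanceAs (NatTrans.CommShift (CategoryTheory.Quotient.lift.isLift _ _ _).hom ℤ)

instance : (mapHo Φ).Additive where
  map_add {X Y f f'} := by
    obtain ⟨X⟩ := X
    obtain ⟨Y⟩ := Y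
    obtain ⟨f, rfl⟩ := (toHo Γ).map_surjective (X := X) (Y := Y) f
    obtain ⟨f', rfl⟩ := (toHo Γ).map_surjective (X := X) (Y := Y) f'
    rw [← CategoryTheory.Functor.map_add]
    exact (Φ ⋙ toHo Γ').map_add

instance : (mapHo Φ).IsTriangulated where
  map_distinguished := by
    rintro T ⟨M, N, f, ⟨e⟩⟩
    obtain ⟨c, h₁, h₂⟩ := IsExact.cone (Φ := Φ) f
    exact ⟨_, _, Φ.map f, ⟨(mapHo Φ).mapTriangle.mapIso e ≪≫
      (Functor.mapTriangleCompIso _ _).symm.app _ ≪≫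
      (Functor.mapTriangleIso (mapHoFac Φ)).app _ ≪≫
      (Functor.mapTriangleCompIso _ _).app _ ≪≫
      (toHo Γ').mapTriangle.mapIso (Triangle.isoMk (Φ.mapTriangle.obj (coneTriangle f))
        (coneTriangle (Φ.map f)) (Iso.refl _) (Iso.refl _) c
        ((Category.comp_id _).trans (Category.id_comp _).symm)
        (h₁.trans (Category.id_comp _).symm) (by
          refine Eq.trans ?_ h₂.symm
          refine Eq.trans ?_ (Category.comp_id _)
          exact congrArg _ (CategoryTheory.Functor.map_id _ _)))⟩⟩

lemma mapHo_inverts : (acyclic Γ).trW.IsInvertedBy (mapHo Φ ⋙ verdierQ (acyclic Γ')) := by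
  rintro X Y f ⟨Z, g, h, hT, hZ⟩
  have := distTriang_map (mapHo Φ ⋙ verdierQ (acyclic Γ')) hT
  exact (Triangle.isZero₃_iff_isIso₁ _ this).1
    (isZero_verdierQ_obj (acyclic Γ') (X := (mapHo Φ).obj Z)
      (IsExact.acyclic (Φ := Φ) (M := Z.as) hZ))

/-- The functor between derived categories induced by an exact functor. -/
def mapDerived : Derived Γ ⥤ Derived Γ' :=
  Localization.lift (mapHo Φ ⋙ verdierQ (acyclic Γ')) (mapHo_inverts Φ) (verdierQ (acyclic Γ))

instance : Localization.Lifting (verdierQ (acyclic Γ)) (acyclic Γ).trW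
    (mapHo Φ ⋙ verdierQ (acyclic Γ')) (mapDerived Φ) :=
  inferInstanceAs (Localization.Lifting _ _ _ (Localization.lift _ (mapHo_inverts Φ) _))

instance : (mapDerived Φ).CommShift ℤ :=
  Functor.commShiftOfLocalization (verdierQ (acyclic Γ)) (acyclic Γ).trW ℤ
    (mapHo Φ ⋙ verdierQ (acyclic Γ')) (mapDerived Φ)

/-- The functor `mapDerived Φ` is induced by `mapHo Φ`. -/
def mapDerivedFac : verdierQ (acyclic Γ) ⋙ mapDerived Φ ≅ mapHo Φ ⋙ verdierQ (acyclic Γ') :=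
  Localization.Lifting.iso _ (acyclic Γ).trW _ _

instance : NatTrans.CommShift (mapDerivedFac Φ).hom ℤ :=
  NatTrans.commShift_iso_hom_of_localization (verdierQ (acyclic Γ)) (acyclic Γ).trW ℤ
    (mapHo Φ ⋙ verdierQ (acyclic Γ')) (mapDerived Φ)

instance : (mapDerived Φ).IsTriangulated :=
  have := Localization.essSurj_mapArrow (verdierQ (acyclic Γ)) (acyclic Γ).trW
  Functor.isTriangulated_of_precomp_iso (mapDerivedFac Φ)

/-- The functor `mapDerived Φ` on the dg modules. -/
def mapDerivedIso : toDer Γ ⋙ mapDerived Φ ≅ Φ ⋙ toDer Γ' :=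
  Functor.isoWhiskerLeft (toHo Γ) (mapDerivedFac Φ) ≪≫
    Functor.isoWhiskerRight (mapHoFac Φ) (verdierQ (acyclic Γ'))

/-- The functor `mapDerived Φ` on a dg module. -/
def mapDerivedObj (M : DGMod Γ) : (mapDerived Φ).obj (toD M) ≅ toD (Φ.obj M) :=
  (mapDerivedIso Φ).app M

end DGMod

namespace DGMod

variable {G : Type u} [AddCommGroup G] {Γ : DGRing G} {M N : DGMod Γ}

/-! ### The grading shift functors -/

/-- The grading shift, as a functor. -/
@[simps obj]
def twistFunctor (Γ : DGRing G) (g : G) : DGMod Γ ⥤ DGMod Γ where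
  obj M := M.twist g
  map {M N} f := mkHom (M := M.twist g) (N := N.twist g) (fun i h ↦ app f i (g + h))
    (fun hi h x ↦ app_d f hi (g + h) x) (fun hi hg x a ↦ app_act f hi _ x a)

lemma castHom_twist (M : DGMod Γ) (g : G) {i j : ℤ} (hi : i = j) (h : G) (x : M.X i (g + h)) :
    (M.twist g).castHom hi h x = M.castHom hi (g + h) x := by
  subst hi; rfl

/-- The grading shift commutes with the shift. -/
def twistShift (Γ : DGRing G) (g : G) (n : ℤ) : shiftFunctor (DGMod Γ) n ⋙ twistFunctor Γ g ≅
    twistFunctor Γ g ⋙ shiftFunctor (DGMod Γ) n :=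
  NatIso.ofComponents (fun M ↦ mkIso
    (mkHom (M := (M.shiftObj n).twist g) (N := (M.twist g).shiftObj n)
      (fun i h ↦ AddMonoidHom.id (M.X (i + n) (g + h))) (fun _ _ _ ↦ rfl) (fun _ _ _ _ ↦ rfl))
    (mkHom (N := (M.shiftObj n).twist g) (M := (M.twist g).shiftObj n)
      (fun i h ↦ AddMonoidHom.id (M.X (i + n) (g + h))) (fun _ _ _ ↦ rfl) (fun _ _ _ _ ↦ rfl))
    (fun _ _ _ ↦ rfl) (fun _ _ _ ↦ rfl)) (fun _ ↦ rfl)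

instance (g : G) : (twistFunctor Γ g).CommShift ℤ where
  commShiftIso n := twistShift Γ g n
  commShiftIso_zero := by
    ext M i h x
    rw [Functor.CommShift.isoZero_hom_app]
    exact ((castHom_twist M g _ h _).trans (castHom_castHom M _ _ _ x)).symm
  commShiftIso_add a b := by
    ext M i h x
    rw [Functor.CommShift.isoAdd_hom_app]
    exact ((castHom_twist M g _ h _).trans (castHom_castHom M _ _ _ x)).symm

instance (g : G) : (twistFunctor Γ g).Additive where

instance (g : G) : IsExact (twistFunctor Γ g) where
  nullHomotopic := by
    rintro M N f ⟨s, hs, hs'⟩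
    exact ⟨fun hi h ↦ s hi (g + h), fun hi hk e e' hg x a ↦ hs hi hk e e' _ x a,
      fun hj hk h x ↦ hs' hj hk (g + h) x⟩
  cone {M N} f := by
    refine ⟨mkIso
      (mkHom (M := (cone f).twist g) (N := cone ((twistFunctor Γ g).map f))
        (fun i h ↦ AddMonoidHom.id (N.X i (g + h) × M.X (i + 1) (g + h))) (fun {i j} hi h x ↦ ?_)
        (fun _ _ _ _ ↦ rfl))
      (mkHom (N := (cone f).twist g) (M := cone ((twistFunctor Γ g).map f))
        (fun i h ↦ AddMonoidHom.id (N.X i (g + h) × M.X (i + 1) (g + h))) (fun {i j} hi h x ↦ ?_)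
        (fun _ _ _ _ ↦ rfl))
      (fun _ _ _ ↦ rfl) (fun _ _ _ ↦ rfl), rfl, rfl⟩ <;> (subst hi; rfl)
  acyclic hM h _ _ _ hi hj x hx := hM (g + h) hi hj x hx

end DGMod

/-- The relation exhibits `X` as a summand of the finite product of the `Y a`. -/
lemma CategoryTheory.ObjectProperty.prop_of_sum_eq_id {C : Type*} [Category C] [HasZeroObject C]
    [HasShift C ℤ] [Preadditive C] [∀ n : ℤ, (shiftFunctor C n).Additive] [Pretriangulated C]
    (Q : ObjectProperty C) [Q.IsTriangulated] [Q.IsStableUnderRetracts] {ι : Type*} [Fintype ι]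
    {X : C} {Y : ι → C} (π : ∀ a, X ⟶ Y a) (i : ∀ a, Y a ⟶ X) (h : ∑ a, π a ≫ i a = 𝟙 X)
    (hY : ∀ a, Q (Y a)) : Q X := by
  let e := (Fintype.equivFin ι).symm
  exact ObjectProperty.IsStableUnderRetracts.of_retract (P := Q)
    (X := X) (Y := ∏ᶜ (Y ∘ e)) ⟨Pi.lift (fun b ↦ π (e b)), ∑ b, Pi.π (Y ∘ e) b ≫ i (e b), by
      rw [Preadditive.comp_sum, ← h, ← e.sum_comp]
      exact Finset.sum_congr rfl fun a _ ↦ by rw [← Category.assoc, Pi.lift_π]⟩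
    (Q.prop_pi _ fun b ↦ hY (e b))

namespace DGMod

variable {G : Type u} [AddCommGroup G] {Γ : DGRing G} {M N : DGMod Γ} {s : Finset G} {w : G → G}

lemma act_oneOf (M : DGMod Γ) {i : ℤ} {g h : G} (e : 0 = g) (e' : h + g = h) (x : M.X i h) :
    M.act (add_zero i) e' x (Γ.oneOf e) = x := by
  subst e; exact M.act_one x

/-! ### Modules over a matrix dg ring -/

/-- The product of a row vector and a matrix. -/
def rowsAct (M : DGMod Γ) (s : Finset G) (w : G → G) {i j k : ℤ} (hi : i + j = k) :
    (∀ a : s, M.X i (-w a)) →+ (∀ a b : s, Γ.X j (w a - w b)) →+ (∀ b : s, M.X k (-w b)) :=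
  AddMonoidHom.mk' (fun x ↦ AddMonoidHom.mk'
    (fun m b ↦ ∑ a : s, M.act hi (show -w a + (w a - w b) = -w b by abel) (x a) (m a b))
    (by intros; ext; simp [Finset.sum_add_distrib]))
    (by intros; ext; simp [Finset.sum_add_distrib])

lemma rowsAct_apply {i j k : ℤ} (hi : i + j = k) (x : ∀ a : s, M.X i (-w a))
    (m : ∀ a b : s, Γ.X j (w a - w b)) (b : s) : rowsAct M s w hi x m b =
      ∑ a : s, M.act hi (show -w a + (w a - w b) = -w b by abel) (x a) (m a b) := rfl

/-- The module of row vectors over a matrix dg ring whose entries are elements of a dg module. -/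
def rows (M : DGMod Γ) (s : Finset G) (w : G → G) : DGMod (Γ.matrix s w) where
  X i _ := ∀ a : s, M.X i (-w a)
  d h _ := AddMonoidHom.mk' (fun x a ↦ M.d h _ (x a)) (by intros; ext; simp)
  act hi _ := rowsAct M s w hi
  d_d hi hj _ x := by ext; simp [M.d_d]
  act_one {i _} x := by
    funext c
    refine (rowsAct_apply _ x _ c).trans
      ((Finset.sum_eq_single c (fun b _ hb ↦ ?_) (by simp)).trans ?_)
    · simp [DGRing.matrix, dif_neg hb]
    · simp only [DGRing.matrix, dite_true]
      exact act_oneOf M _ _ _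
  act_assoc {i₁ i₂ i₃ i₁₂ i₂₃ i _ _ _ _ _ _} h₁₂ h₂₃ h h' _ _ _ _ x y z := by
    funext c
    change ∑ b : s, M.act h _ (∑ a : s, M.act h₁₂ _ (x a) (y a b)) (z b c) =
      ∑ a : s, M.act h' _ (x a) (∑ b : s, Γ.mul h₂₃ _ (y a b) (z b c))
    simp only [map_sum, AddMonoidHom.finsetSum_apply]
    rw [Finset.sum_comm]
    refine Finset.sum_congr rfl fun b _ ↦ Finset.sum_congr rfl fun b' _ ↦ ?_
    exact M.act_assoc _ _ _ _ _ _ _ _ _ _ _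
  d_act {i i' j j' k k' _ _ _} hi hj hk h₁ h₂ h₃ _ x y := by
    funext c
    change M.d hk _ (∑ a : s, M.act h₁ _ (x a) (y a c)) =
      (∑ a : s, M.act h₂ _ (M.d hi _ (x a)) (y a c)) +
        dgSign i • ∑ a : s, M.act h₃ _ (x a) (Γ.d hj _ (y a c))
    rw [map_sum, Finset.smul_sum, ← Finset.sum_add_distrib]
    exact Finset.sum_congr rfl fun b _ ↦ M.d_act _ _ _ _ _ _ _ _ _

/-- The functor `rows`. -/
@[simps obj]
def rowsFunctor (Γ : DGRing G) (s : Finset G) (w : G → G) : DGMod Γ ⥤ DGMod (Γ.matrix s w) where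
  obj M := M.rows s w
  map {M N} f := mkHom (M := M.rows s w) (N := N.rows s w)
    (fun i _ ↦ AddMonoidHom.mk' (fun x a ↦ app f i (-w a) (x a)) (by
      intro x y; funext a; exact map_add (app f i (-w a)) (x a) (y a)))
    (fun hi _ x ↦ funext fun a : s ↦ app_d f hi _ (x a))
    (fun hi _ x m ↦ funext fun b : s ↦ (map_sum (app f _ (-w b)) _ _).trans
      (Finset.sum_congr rfl fun (a : s) _ ↦ app_act f hi _ (x a) (m a b)))

lemma castHom_rows (M : DGMod Γ) {i j : ℤ} (h : i = j) (h' : j = i) (t : PUnit)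
    (x : ∀ a : s, M.X i (-w a)) :
    (M.rows s w).castHom h' t (fun a : s ↦ M.castHom h (-w a) (x a)) = x := by
  subst h; rfl

/-- The functor `rows` commutes with the shift. -/
def rowsShift (Γ : DGRing G) (s : Finset G) (w : G → G) (n : ℤ) :
    shiftFunctor (DGMod Γ) n ⋙ rowsFunctor Γ s w ≅
      rowsFunctor Γ s w ⋙ shiftFunctor (DGMod (Γ.matrix s w)) n :=
  NatIso.ofComponents (fun M ↦ mkIso
    (mkHom (M := (M.shiftObj n).rows s w) (N := (M.rows s w).shiftObj n)
      (fun i _ ↦ AddMonoidHom.id (∀ a : s, M.X (i + n) (-w a))) (fun _ _ _ ↦ rfl)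
      (fun _ _ _ _ ↦ rfl))
    (mkHom (N := (M.shiftObj n).rows s w) (M := (M.rows s w).shiftObj n)
      (fun i _ ↦ AddMonoidHom.id (∀ a : s, M.X (i + n) (-w a))) (fun _ _ _ ↦ rfl)
      (fun _ _ _ _ ↦ rfl))
    (fun _ _ _ ↦ rfl) (fun _ _ _ ↦ rfl)) (fun _ ↦ rfl)

instance : (rowsFunctor Γ s w).CommShift ℤ where
  commShiftIso n := rowsShift Γ s w n
  commShiftIso_zero := by
    ext M i h x
    rw [Functor.CommShift.isoZero_hom_app]
    exact (castHom_rows M (add_zero i) (add_zero i).symm h x).symm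
  commShiftIso_add a b := by
    ext M i h x
    rw [Functor.CommShift.isoAdd_hom_app]
    exact (castHom_rows M (show i + (a + b) = i + b + a by omega) (by omega) h x).symm

instance : (rowsFunctor Γ s w).Additive where

/-- The addition of pairs of row vectors. -/
def rowsProd (A B : s → Type u) [∀ a, AddCommGroup (A a)] [∀ a, AddCommGroup (B a)] :
    (∀ a, A a × B a) ≃+ (∀ a, A a) × (∀ a, B a) where
  toFun x := (fun a ↦ (x a).1, fun a ↦ (x a).2)
  invFun x a := (x.1 a, x.2 a)
  map_add' _ _ := rfl

instance : IsExact (rowsFunctor Γ s w) where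
  nullHomotopic := by
    rintro M N f ⟨σ, hs, hs'⟩
    refine ⟨fun {i j} hi _ ↦ AddMonoidHom.mk' (fun x (a : s) ↦ σ hi (-w a) (x a)) (by
      intro x y; funext a; exact map_add (σ hi (-w a)) (x a) (y a)), ?_, ?_⟩
    · intro i i' j k k' g h l hi hk e e' hg x m
      funext b
      exact (map_sum (σ hk (-w b)) _ _).trans
        (Finset.sum_congr rfl fun (a : s) _ ↦ hs hi hk e e' _ (x a) (m a b))
    · intro i j k hj hk _ x
      funext a
      exact hs' hj hk (-w a) (x a)
  cone {M N} f := by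
    refine ⟨isoOfInverse (mkHom (M := (cone f).rows s w) (N := cone ((rowsFunctor Γ s w).map f))
        (fun i h ↦
          (rowsProd (fun a : s ↦ N.X i (-w a)) (fun a : s ↦ M.X (i + 1) (-w a))).toAddMonoidHom)
        (fun {i j} hi h x ↦ ?_) (fun {i j k g h l} hi hg x a ↦ ?_))
      (fun i h ↦ (rowsProd (fun a : s ↦ N.X i (-w a)) (fun a : s ↦ M.X (i + 1) (-w a))).symm)
      ?_ ?_, ?_, ?_⟩
    · subst hi; rfl
    · refine Prod.ext (funext fun b ↦ ?_) (funext fun b ↦ ?_)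
      · exact Prod.fst_sum
      · exact Prod.snd_sum
    · intro i h x; rfl
    · intro i h x; rfl
    · exact hom_ext fun i h x ↦ Prod.ext rfl (funext fun a ↦ rfl)
    · exact hom_ext fun i h x ↦ rfl
  acyclic {M} hM h i j k hi hj x hx := by
    choose y hy using fun a : s ↦ hM (-w a) hi hj (x a) (congrFun hx a)
    exact ⟨y, funext hy⟩

end DGMod

namespace DGRing

variable {G : Type u} [AddCommGroup G] (Γ : DGRing G)

/-- Transport along an equality of degrees in the grading group. -/
def castDeg {i : ℤ} {g h : G} (e : g = h) : Γ.X i g →+ Γ.X i h := e ▸ AddMonoidHom.id _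

variable {Γ}

@[simp] lemma castDeg_castDeg {i : ℤ} {g h l : G} (e : g = h) (e' : h = l) (x : Γ.X i g) :
    Γ.castDeg e' (Γ.castDeg e x) = Γ.castDeg (e.trans e') x := by
  subst e e'; rfl

lemma castDeg_d {i j : ℤ} {g h : G} (e : g = h) (hi : i + 1 = j) (x : Γ.X i g) :
    Γ.castDeg e (Γ.d hi g x) = Γ.d hi h (Γ.castDeg e x) := by
  subst e; rfl

lemma castDeg_mul {i j k : ℤ} {g g' h l l' : G} (e : l = l') (e' : g = g') (hi : i + j = k)
    (hg : g + h = l) (hg' : g' + h = l') (x : Γ.X i g) (y : Γ.X j h) :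
    Γ.castDeg e (Γ.mul hi hg x y) = Γ.mul hi hg' (Γ.castDeg e' x) y := by
  subst e e'; rfl

lemma castDeg_oneOf {g h : G} (e : g = h) (e₀ : 0 = g) :
    Γ.castDeg e (Γ.oneOf e₀) = Γ.oneOf (e₀.trans e) := by
  subst e; rfl

end DGRing

/-! ### Full faithfulness of `rows` on the free modules `Γ(w a)` -/

namespace DGMod

/-- An exact functor which is full on the morphisms from a K-projective dg module whose image
is K-projective, and which reflects null-homotopic morphisms from it, is bijective
on the morphisms from it in the derived category. -/
lemma bijectiveFrom_mapDerived {G G' : Type u} [AddCommGroup G] [AddCommGroup G'] {Γ : DGRing G}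
    {Γ' : DGRing G'} (Φ : DGMod Γ ⥤ DGMod Γ') [Φ.CommShift ℤ] [Φ.Additive] [IsExact Φ]
    {P : DGMod Γ} (hP : P.KProjective) (hP' : (Φ.obj P).KProjective)
    (h : ∀ (N : DGMod Γ) (φ : Φ.obj P ⟶ Φ.obj N), ∃ f : P ⟶ N, Φ.map f = φ)
    (h' : ∀ (N : DGMod Γ) (f : P ⟶ N), Φ.map f ∈ nullHomotopic (Φ.obj P) (Φ.obj N) →
      f ∈ nullHomotopic P N) : bijectiveFrom (mapDerived Φ) (toD P) := by
  intro Y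
  obtain ⟨⟨N⟩, rfl⟩ := (Localization.Construction.objEquiv (acyclic Γ).trW).surjective Y
  change Function.Bijective ((mapDerived Φ).map : (toD P ⟶ toD N) → _)
  have nat (f : P ⟶ N) : (mapDerived Φ).map ((toDer Γ).map f) ≫ (mapDerivedObj Φ N).hom =
      (mapDerivedObj Φ P).hom ≫ (toDer Γ').map (Φ.map f) := (mapDerivedIso Φ).hom.naturality f
  constructor
  · intro f f' hf
    rw [← sub_eq_zero, ← CategoryTheory.Functor.map_sub] at hf
    rw [← sub_eq_zero]
    obtain ⟨a, ha⟩ := hP.exists_map (f - f')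
    rw [← ha] at hf
    have := ((congrArg (· ≫ (mapDerivedObj Φ N).hom) hf).trans zero_comp).symm.trans (nat a)
    refine ha.symm.trans ((hP.map_eq_zero_iff a).2 (h' N a ((hP'.map_eq_zero_iff _).1 ?_)))
    exact (cancel_epi (mapDerivedObj Φ P).hom).1 (this.symm.trans comp_zero.symm)
  · intro g
    obtain ⟨φ, hφ⟩ := hP'.exists_map ((mapDerivedObj Φ P).inv ≫ g ≫ (mapDerivedObj Φ N).hom)
    obtain ⟨f, rfl⟩ := h N φ
    refine ⟨(toDer Γ).map f, (cancel_mono (mapDerivedObj Φ N).hom).1 ((nat f).trans ?_)⟩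
    refine (congrArg ((mapDerivedObj Φ P).hom ≫ ·) hφ).trans ?_
    exact Iso.hom_inv_id_assoc _ _

lemma kProjective_of_retract {G : Type u} [AddCommGroup G] {Γ : DGRing G} {P Q : DGMod Γ}
    (i : P ⟶ Q) (r : Q ⟶ P) (h : i ≫ r = 𝟙 P) (hQ : Q.KProjective) : P.KProjective :=
  fun N hN f ↦ by
    rw [← Category.id_comp f, ← h, Category.assoc]
    exact comp_mem_nullHomotopic' i (hQ N hN (r ≫ f))

variable {G : Type u} [AddCommGroup G] {Γ : DGRing G} {M N : DGMod Γ} {s : Finset G} {w : G → G}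

lemma app_sum {ι : Type*} (t : Finset ι) (f : ι → (M ⟶ N)) (i : ℤ) (g : G) (x : M.X i g) :
    app (∑ a ∈ t, f a) i g x = ∑ a ∈ t, app (f a) i g x :=
  map_sum (AddMonoidHom.mk' (fun f : M ⟶ N ↦ app f i g x) (fun _ _ ↦ rfl)) _ _

/-- The projection of a matrix to one of its rows. -/
def rowsOut (Γ : DGRing G) (s : Finset G) (w : G → G) (a : s) :
    regular (Γ.matrix s w) ⟶ (free Γ (w a)).rows s w :=
  mkHom (M := regular (Γ.matrix s w)) (N := (free Γ (w a)).rows s w)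
    (fun i _ ↦ AddMonoidHom.mk' (fun (m : ∀ a b : s, Γ.X i (w a - w b)) (b : s) ↦
      Γ.castDeg (sub_eq_add_neg (w a) (w b)) (m a b))
      (fun x y ↦ funext fun b ↦ map_add _ (x a b) (y a b)))
    (fun {i j} hi _ m ↦ funext fun b : s ↦ Γ.castDeg_d _ hi _)
    (fun {i j k _ _ _} hi _ m n ↦ funext fun b : s ↦ (map_sum (Γ.castDeg _) _ _).trans
      (Finset.sum_congr rfl fun c _ ↦ Γ.castDeg_mul _ _ hi _ _ _ _))

open scoped Classical in
/-- The inclusion of an entry of a row into the matrices. -/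
def entryIn (Γ : DGRing G) (w : G → G) (a c b : s) (i : ℤ) :
    Γ.X i (w a + -w b) →+ Γ.X i (w c - w b) :=
  if h : a = c then Γ.castDeg (by rw [h, sub_eq_add_neg]) else 0

lemma entryIn_self (a b : s) (i : ℤ) :
    entryIn Γ w a a b i = Γ.castDeg (sub_eq_add_neg _ _).symm := dif_pos rfl

lemma entryIn_of_ne {a c : s} (h : a ≠ c) (b : s) (i : ℤ) : entryIn Γ w a c b i = 0 := dif_neg h

lemma entryIn_d (a c b : s) {i j : ℤ} (hi : i + 1 = j) (x : Γ.X i (w a + -w b)) :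
    entryIn Γ w a c b j (Γ.d hi _ x) = Γ.d hi _ (entryIn Γ w a c b i x) := by
  by_cases h : a = c
  · subst h
    simp only [entryIn_self, DGRing.castDeg_d]
  · simp [entryIn_of_ne h]

lemma entryIn_mul (a c b b' : s) {i j k : ℤ} (hi : i + j = k) (x : Γ.X i (w a + -w b))
    (y : Γ.X j (w b - w b')) (h : w a + -w b + (w b - w b') = w a + -w b') :
    entryIn Γ w a c b' k (Γ.mul hi h x y) =
      Γ.mul hi (sub_add_sub_cancel _ _ _) (entryIn Γ w a c b i x) y := by
  by_cases h : a = c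
  · subst h
    simp only [entryIn_self]
    exact DGRing.castDeg_mul _ _ _ _ _ _ _
  · simp [entryIn_of_ne h]

/-- The inclusion of a row into the matrices. -/
def rowsIn (Γ : DGRing G) (s : Finset G) (w : G → G) (a : s) :
    (free Γ (w a)).rows s w ⟶ regular (Γ.matrix s w) :=
  mkHom (N := regular (Γ.matrix s w)) (M := (free Γ (w a)).rows s w)
    (fun i _ ↦ AddMonoidHom.mk' (fun (x : ∀ b : s, Γ.X i (w a + -w b)) (c b : s) ↦
      entryIn Γ w a c b i (x b))
      (fun x y ↦ funext fun c ↦ funext fun b ↦ map_add (entryIn Γ w a c b i) (x b) (y b)))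
    (fun {_ _} hi _ x ↦ funext fun c : s ↦ funext fun b : s ↦ entryIn_d a c b hi (x b))
    (fun {_ _ k _ _ _} hi _ x m ↦ funext fun c : s ↦ funext fun b : s ↦
      (map_sum (entryIn Γ w a c b k) _ _).trans
        (Finset.sum_congr rfl fun b' _ ↦ entryIn_mul a c b' b hi (x b') (m b' b) _))

lemma rowsIn_rowsOut (a : s) : rowsIn Γ s w a ≫ rowsOut Γ s w a = 𝟙 _ :=
  hom_ext fun i _ x ↦ funext fun b : s ↦ by
    change Γ.castDeg (sub_eq_add_neg (w a) (w b)) (entryIn Γ w a a b i (x b)) = x b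
    rw [entryIn_self]
    exact DGRing.castDeg_castDeg _ _ _

lemma sum_rowsOut_rowsIn : ∑ a : s, rowsOut Γ s w a ≫ rowsIn Γ s w a = 𝟙 _ :=
  hom_ext fun i _ x ↦ funext fun c : s ↦ funext fun b : s ↦ by
    rw [app_sum]
    have h : (∑ a : s, app (rowsOut Γ s w a ≫ rowsIn Γ s w a) i PUnit.unit x :
        ∀ c b : s, Γ.X i (w c - w b)) c b =
        ∑ a : s, entryIn Γ w a c b i (Γ.castDeg (sub_eq_add_neg (w a) (w b)) (x a b)) :=
      (congrFun (Finset.sum_apply c _ _) b).trans (Finset.sum_apply b _ _)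
    refine h.trans ((Finset.sum_eq_single c (fun a _ ha ↦ ?_) (by simp)).trans ?_)
    · rw [entryIn_of_ne ha]; rfl
    · rw [entryIn_self, DGRing.castDeg_castDeg]; rfl

lemma kProjective_rows (a : s) : ((free Γ (w a)).rows s w).KProjective :=
  kProjective_of_retract _ _ (rowsIn_rowsOut a) (kProjective_free (Γ := Γ.matrix s w) 0)

/-- The generator of a row. -/
def rowGen (Γ : DGRing G) (w : G → G) (a : s) : ((free Γ (w a)).rows s w).X 0 0 :=
  app (rowsOut Γ s w a) 0 0 (Γ.matrix s w).one

lemma rowGen_self (a : s) : (rowGen Γ w a : ∀ b : s, Γ.X 0 (w a + -w b)) a = gen Γ (w a) := by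
  exact (congrArg (Γ.castDeg (sub_eq_add_neg (w a) (w a))) (dif_pos rfl)).trans
    (DGRing.castDeg_oneOf _ _)

lemma rowGen_of_ne {a b : s} (h : a ≠ b) :
    (rowGen Γ w a : ∀ b : s, Γ.X 0 (w a + -w b)) b = 0 := by
  exact (congrArg (Γ.castDeg (sub_eq_add_neg (w a) (w b))) (dif_neg h)).trans (map_zero _)

lemma d_rowGen {j : ℤ} (h : 0 + 1 = j) (a : s) :
    ((free Γ (w a)).rows s w).d h 0 (rowGen Γ w a) = 0 := by
  exact (app_d (rowsOut Γ s w a) h 0 (Γ.matrix s w).one).symm.trans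
    ((congrArg _ ((Γ.matrix s w).d_one h)).trans (map_zero _))

/-- A row is a summand of the regular module, which is free on the unit matrix; the generator of the
row is the projection of the unit. -/
lemma rows_hom_ext {K : DGMod (Γ.matrix s w)} {a : s} {φ ψ : (free Γ (w a)).rows s w ⟶ K}
    (h : app φ 0 0 (rowGen Γ w a) = app ψ 0 0 (rowGen Γ w a)) : φ = ψ := by
  have h' : rowsOut Γ s w a ≫ φ = rowsOut Γ s w a ≫ ψ := hom_ext fun i t m ↦
    (app_free (Γ := Γ.matrix s w) (g := 0) (rowsOut Γ s w a ≫ φ) m).trans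
      ((congrArg (fun x ↦ K.act (zero_add i) (show (0 : PUnit) + 0 = t from rfl) x m) h).trans
      (app_free (Γ := Γ.matrix s w) (g := 0) (rowsOut Γ s w a ≫ ψ) m).symm)
  rw [← Category.id_comp φ, ← rowsIn_rowsOut a, Category.assoc, h', ← Category.assoc,
    rowsIn_rowsOut a, Category.id_comp]

/-- The idempotent matrix which corresponds to the generator of a row. -/
def rowIdem (Γ : DGRing G) (w : G → G) (a : s) : (Γ.matrix s w).X 0 0 :=
  app (rowsIn Γ s w a) 0 0 (rowGen Γ w a)

lemma rowGen_act_rowIdem (a : s) : ((free Γ (w a)).rows s w).act (zero_add 0) (zero_add 0)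
    (rowGen Γ w a) (rowIdem Γ w a) = rowGen Γ w a := by
  refine (app_act (rowsOut Γ s w a) (zero_add 0) (zero_add 0) (Γ.matrix s w).one
    (rowIdem Γ w a)).symm.trans ?_
  refine (congrArg (app (rowsOut Γ s w a) 0 0) ((Γ.matrix s w).one_mul _)).trans ?_
  exact congrArg (fun f ↦ app f 0 0 (rowGen Γ w a)) (rowsIn_rowsOut a)

/-- The columns of this idempotent other than column `a` are zero, so acting by it kills the entries
other than entry `a`. -/
lemma rows_act_rowIdem_of_ne {a b : s} (h : a ≠ b) (y : ∀ c : s, N.X 0 (-w c)) :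
    rowsAct N s w (zero_add 0) y (rowIdem Γ w a) b = 0 := by
  refine (rowsAct_apply _ y _ b).trans (Finset.sum_eq_zero fun c _ ↦ ?_)
  have : (rowIdem Γ w a : ∀ c b : s, Γ.X 0 (w c - w b)) c b = 0 :=
    (congrArg (entryIn Γ w a c b 0) (rowGen_of_ne h)).trans (map_zero _)
  exact (congrArg _ this).trans (map_zero _)

/-- The image `y` of the generator is fixed by the idempotent of row `a`, so only its entry `a`
survives. That entry is a cocycle of `N` in degree `-w a`, which is the same as a morphism from `Γ(w
a)`. -/
lemma rows_map_surjective (a : s) (φ : (free Γ (w a)).rows s w ⟶ N.rows s w) :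
    ∃ f : free Γ (w a) ⟶ N, (rowsFunctor Γ s w).map f = φ := by
  let y : ∀ c : s, N.X 0 (-w c) := app φ 0 0 (rowGen Γ w a)
  have hy {b : s} (h : a ≠ b) : y b = 0 := by
    have : rowsAct N s w (zero_add 0) y (rowIdem Γ w a) = y :=
      (app_act φ (zero_add 0) (zero_add 0) (rowGen Γ w a) (rowIdem Γ w a)).symm.trans
        (congrArg (app φ 0 0) (rowGen_act_rowIdem a))
    rw [← this, rows_act_rowIdem_of_ne h]
  have hd : N.d rfl _ (y a) = 0 := congrFun ((app_d φ rfl 0 (rowGen Γ w a)).symm.trans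
    ((congrArg (app φ _ 0) (d_rowGen rfl a)).trans (map_zero _))) a
  refine ⟨freeHom (w a) (y a) hd, rows_hom_ext (funext fun b : s ↦ ?_)⟩
  change app (freeHom (w a) (y a) hd) 0 (-w b)
    ((rowGen Γ w a : ∀ b : s, Γ.X 0 (w a + -w b)) b) = y b
  by_cases h : a = b
  · subst h
    rw [rowGen_self, freeHom_gen]
  · rw [rowGen_of_ne h, hy h]
    exact map_zero _

/-- Pulled back to the regular module, the homotopy amounts to a row vector bounding the image of
the generator of the row; its entry `a` bounds the image of the generator of `Γ(w a)`. -/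
lemma mem_nullHomotopic_of_rows {a : s} (f : free Γ (w a) ⟶ N)
    (hf : (rowsFunctor Γ s w).map f ∈ nullHomotopic _ _) : f ∈ nullHomotopic _ _ := by
  rw [free_nullHomotopic_iff]
  obtain ⟨y, hy⟩ := (free_nullHomotopic_iff (Γ := Γ.matrix s w) (g := 0) _).1
    (comp_mem_nullHomotopic' (rowsOut Γ s w a) hf)
  refine ⟨(y : ∀ c : s, N.X (-1) (-w c)) a, (congrFun hy a).trans ?_⟩
  change app f 0 (-w a) ((rowGen Γ w a : ∀ b : s, Γ.X 0 (w a + -w b)) a) = _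
  rw [rowGen_self]

lemma bijectiveFrom_rows (a : s) :
    bijectiveFrom (mapDerived (rowsFunctor Γ s w)) (toD (free Γ (w a))) :=
  bijectiveFrom_mapDerived _ (kProjective_free _) (kProjective_rows a)
    (fun _ ↦ rows_map_surjective a) (fun _ ↦ mem_nullHomotopic_of_rows)

end DGMod

/-! ### Perfect dg modules over `Γ` and over a matrix ring -/

instance {C D : Type*} [Category C] [Category D] (F : C ⥤ D) (P : ObjectProperty D)
    [P.IsStableUnderRetracts] : (P.inverseImage F).IsStableUnderRetracts where
  of_retract r hY := ObjectProperty.IsStableUnderRetracts.of_retract (P := P) (r.map F) hY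

namespace DGMod

variable {G : Type u} [AddCommGroup G] {Γ : DGRing G} {M N : DGMod Γ} {s : Finset G} {w : G → G}

/-- A matrix ring is the direct sum of its rows. -/
lemma prop_regular_matrix (Q : ObjectProperty (Derived (Γ.matrix s w))) [Q.IsTriangulated]
    [Q.IsStableUnderRetracts] (hQ : ∀ a : s, Q (toD ((free Γ (w a)).rows s w))) :
    Q (toD (regular (Γ.matrix s w))) := by
  refine Q.prop_of_sum_eq_id (Y := fun a : s ↦ toD ((free Γ (w a)).rows s w)) (fun a : s ↦ (toDer _).map (rowsOut Γ s w a))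
    (fun a ↦ (toDer _).map (rowsIn Γ s w a)) ?_ hQ
  have := congrArg (toDer _).map (sum_rowsOut_rowsIn (Γ := Γ) (s := s) (w := w))
  rw [Functor.map_sum, CategoryTheory.Functor.map_id] at this
  exact (Finset.sum_congr rfl fun a _ ↦ ((toDer _).map_comp _ _).symm).trans this

lemma per_rows (a : s) : (Γ.matrix s w).per Set.univ (toD ((free Γ (w a)).rows s w)) :=
  ObjectProperty.IsStableUnderRetracts.of_retract (P := (Γ.matrix s w).per Set.univ)
    (Retract.map ⟨rowsIn Γ s w a, rowsOut Γ s w a, rowsIn_rowsOut a⟩ (toDer _))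
    (le_thick _ _ ⟨0, trivial, rfl⟩)

lemma per_le_bijectiveFrom : Γ.per ((fun a ↦ -w a) '' s) ≤
    bijectiveFrom (mapDerived (rowsFunctor Γ s w)) :=
  thick_le (by
    rintro _ ⟨_, ⟨a, ha, rfl⟩, rfl⟩
    rw [neg_neg]
    exact bijectiveFrom_rows ⟨a, ha⟩)

lemma per_le_inverseImage : Γ.per ((fun a ↦ -w a) '' s) ≤
    ((Γ.matrix s w).per Set.univ).inverseImage (mapDerived (rowsFunctor Γ s w)) :=
  thick_le (by
    rintro _ ⟨_, ⟨a, ha, rfl⟩, rfl⟩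
    rw [neg_neg]
    exact ((Γ.matrix s w).per Set.univ).prop_of_iso
      (mapDerivedObj (rowsFunctor Γ s w) (free Γ (w a))).symm (per_rows ⟨a, ha⟩))

lemma per_mapDerived_rows (X : (Γ.per ((fun a ↦ -w a) '' s)).FullSubcategory) :
    (Γ.matrix s w).per Set.univ
      (((Γ.per ((fun a ↦ -w a) '' s)).ι ⋙ mapDerived (rowsFunctor Γ s w)).obj X) :=
  per_le_inverseImage _ X.2

/-- The functor `rows` on perfect dg modules. -/
def perRows (Γ : DGRing G) (s : Finset G) (w : G → G) :
    (Γ.per ((fun a ↦ -w a) '' s)).FullSubcategory ⥤ (Γ.matrix s w).Per :=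
  ((Γ.matrix s w).per Set.univ).lift
    ((Γ.per ((fun a ↦ -w a) '' s)).ι ⋙ mapDerived (rowsFunctor Γ s w))
    per_mapDerived_rows

instance : (perRows Γ s w).CommShift ℤ :=
  inferInstanceAs ((((Γ.matrix s w).per Set.univ).lift _ _).CommShift ℤ)

instance : (perRows Γ s w).IsTriangulated :=
  inferInstanceAs (((Γ.matrix s w).per Set.univ).lift _ _).IsTriangulated

instance : ((Γ.per ((fun a ↦ -w a) '' s)).ι ⋙ mapDerived (rowsFunctor Γ s w)).Full where
  map_surjective {X Y} f := by
    obtain ⟨g, hg⟩ := (per_le_bijectiveFrom _ X.2 Y.obj).2 f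
    exact ⟨ObjectProperty.homMk g, hg⟩

instance : ((Γ.per ((fun a ↦ -w a) '' s)).ι ⋙ mapDerived (rowsFunctor Γ s w)).Faithful where
  map_injective {X Y} f g h := by
    ext
    exact (per_le_bijectiveFrom _ X.2 Y.obj).1 h

lemma splitsIdempotents_per (I : Set G) : (Γ.per I).SplitsIdempotents :=
  splitsIdempotents_resolved.mono (per_le_resolved I)

/-- As idempotents of perfect objects split, the essential image is closed under summands. It
contains every row, hence the regular module. -/
lemma per_le_essImage : (Γ.matrix s w).per Set.univ ≤
    ((Γ.per ((fun a ↦ -w a) '' s)).ι ⋙ mapDerived (rowsFunctor Γ s w)).essImage := by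
  have := isStableUnderRetracts_essImage
    ((Γ.per ((fun a ↦ -w a) '' s)).ι ⋙ mapDerived (rowsFunctor Γ s w))
    (splitsIdempotents_per _).fullSubcategory
  refine thick_le ?_
  rintro _ ⟨_, -, rfl⟩
  -- The grading group of the matrix ring is trivial, so the twist of the regular module is the
  -- regular module itself.
  refine prop_regular_matrix _ fun a ↦ ⟨⟨toD (free Γ (w a)), le_thick _ _
    ⟨-w a, ⟨a, a.2, rfl⟩, by rw [neg_neg]⟩⟩, ⟨mapDerivedObj _ _⟩⟩

instance : (perRows Γ s w).Full := inferInstanceAs (((Γ.matrix s w).per Set.univ).lift _ _).Full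

instance : (perRows Γ s w).Faithful :=
  inferInstanceAs (((Γ.matrix s w).per Set.univ).lift _ _).Faithful

instance : (perRows Γ s w).EssSurj where
  mem_essImage X := by
    obtain ⟨Y, ⟨e⟩⟩ := per_le_essImage _ X.2
    exact ⟨Y, ⟨ObjectProperty.isoMk _ e⟩⟩

/-- `rows` takes the generators `Γ(w a)` to the rows, with the same morphisms, and the rows generate
the perfect modules. The sign in `hJ` arises because `Γ(w a)` is the generator `Γ(-g)` for `g = -w
a`. -/
theorem triangleEquivalent_matrix (Γ : DGRing G) (s : Finset G) (w : G → G) {J : Set G}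
    (hJ : (fun a ↦ -w a) '' s = J) :
    TriangleEquivalent (Γ.per J).FullSubcategory (Γ.matrix s w).Per := by
  subst hJ
  exact ⟨perRows Γ s w, inferInstance, inferInstance, {}⟩

end DGMod

namespace DGMod

variable {G : Type u} [AddCommGroup G] {Γ : DGRing G} {M N : DGMod Γ}

/-! ### Grading shifts of thick subcategories -/

/-- Transport along an equality of degrees in the grading group. -/
def castDeg (M : DGMod Γ) {i : ℤ} {g h : G} (e : g = h) : M.X i g →+ M.X i h :=
  e ▸ AddMonoidHom.id _

@[simp] lemma castDeg_castDeg {i : ℤ} {g h l : G} (e : g = h) (e' : h = l) (x : M.X i g) :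
    M.castDeg e' (M.castDeg e x) = M.castDeg (e.trans e') x := by
  subst e e'; rfl

lemma castDeg_d {i j : ℤ} {g h : G} (e : g = h) (hi : i + 1 = j) (x : M.X i g) :
    M.castDeg e (M.d hi g x) = M.d hi h (M.castDeg e x) := by
  subst e; rfl

lemma castDeg_act {i j k : ℤ} {g g' h l l' : G} (e : l = l') (e' : g = g') (hi : i + j = k)
    (hg : g + h = l) (hg' : g' + h = l') (x : M.X i g) (a : Γ.X j h) :
    M.castDeg e (M.act hi hg x a) = M.act hi hg' (M.castDeg e' x) a := by
  subst e e'; rfl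

/-- The composition of grading shifts. -/
def twistTwist (M : DGMod Γ) {a b c : G} (h : a + b = c) : (M.twist a).twist b ≅ M.twist c :=
  have e (l : G) : a + (b + l) = c + l := by rw [← h, add_assoc]
  isoOfInverse (mkHom (M := (M.twist a).twist b) (N := M.twist c) (fun _ l ↦ M.castDeg (e l))
      (fun hi l x ↦ M.castDeg_d (e l) hi x) (fun hi _ x a ↦ M.castDeg_act _ (e _) hi _ _ x a))
    (fun _ l ↦ M.castDeg (e l).symm) (fun _ _ x ↦ M.castDeg_castDeg _ _ x)
    (fun _ _ x ↦ M.castDeg_castDeg _ _ x)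

lemma thickOn_twist {I : Set G} {X : Derived Γ} (hX : thickOn M I X) (g : G) :
    thickOn M ((fun h ↦ h + g) '' I) ((mapDerived (twistFunctor Γ (-g))).obj X) := by
  suffices h : thickOn M I ≤
      (thickOn M ((fun h ↦ h + g) '' I)).inverseImage (mapDerived (twistFunctor Γ (-g))) from h _ hX
  refine thick_le ?_
  rintro _ ⟨h, hh, rfl⟩
  exact ObjectProperty.prop_of_iso (thickOn M ((fun h ↦ h + g) '' I))
    ((mapDerivedObj (twistFunctor Γ (-g)) (M.twist (-h))) ≪≫
      (toDer Γ).mapIso (M.twistTwist (neg_add h g).symm)).symm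
    (le_thick _ _ ⟨h + g, ⟨h, hh, rfl⟩, rfl⟩)

/-! ### Vanishing of morphisms -/

lemma thickOn_hom_eq_zero {N : DGMod Γ} {I J : Set G}
    (h : ∀ g ∈ I, ∀ l ∈ J, (N.twist (-l)).ExactAt g) {X Y : Derived Γ} (hX : Γ.per I X)
    (hY : thickOn N J Y) (f : X ⟶ Y) : f = 0 :=
  thick_hom_eq_zero (by
    rintro _ _ ⟨g, hg, rfl⟩ ⟨l, hl, rfl⟩
    exact (free_hom_eq_zero_iff g _).2 (h g hg l hl)) hX hY f

lemma per_hom_eq_zero {I : Set G} {X Y : Derived Γ}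
    (h : ∀ g ∈ I, ∀ (n : ℤ) (f : toD (free Γ (-g)) ⟶ Y⟦n⟧), f = 0) (hX : Γ.per I X)
    (f : X ⟶ Y) : f = 0 :=
  thick_hom_eq_zero (S' := (· = Y)) (by
    rintro _ _ ⟨g, hg, rfl⟩ rfl
    exact h g hg) hX (le_thick _ _ rfl) f

lemma shift_hom_eq_zero {I J : Set G}
    (h : ∀ ⦃X Y⦄, Γ.per I X → Γ.per J Y → ∀ f : X ⟶ Y, f = 0) {Y : Derived Γ} (hY : Γ.per J Y) :
    ∀ g ∈ I, ∀ (n : ℤ) (f : toD (free Γ (-g)) ⟶ Y⟦n⟧), f = 0 :=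
  fun g hg n f ↦ h (le_thick _ _ ⟨g, hg, rfl⟩) ((Γ.per J).le_shift n _ hY) f

variable [PartialOrder G] [IsOrderedAddMonoid G]

lemma exactAt_free (hΓ : Γ.IsNonneg) {g l : G} (h : ¬ l ≤ g) : (free Γ (-l)).ExactAt g :=
  fun _ _ x _ ↦ ⟨0, (map_zero _).trans (hΓ _ (-l + g) (by rwa [le_neg_add_iff_le]) x).symm⟩

lemma hom_per_eq_zero (hΓ : Γ.IsNonneg) {I J : Set G} (h : ∀ g ∈ I, ∀ l ∈ J, ¬ l ≤ g)
    ⦃X Y : Derived Γ⦄ (hX : Γ.per I X) (hY : Γ.per J Y) (f : X ⟶ Y) : f = 0 :=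
  thickOn_hom_eq_zero (fun g hg l hl ↦ exactAt_free hΓ (h g hg l hl)) hX hY f

/-- Each generator lies on one side of `I`. A morphism from `Γ(-g)` with `g ∉ I` to a shift of
`Γ(-l)` with `l ∈ I` would need `l ≤ g`, which is excluded because `I` is an upper set. -/
lemma per_le_extensionProduct (hΓ : Γ.IsNonneg) {I : Set G} (hI : IsUpperSet I) (L : Set G) :
    Γ.per L ≤ (Γ.per (L \ I)).extensionProduct (Γ.per (L ∩ I)) :=
  thick_le_extensionProduct
    (hom_per_eq_zero hΓ fun _ hg _ hl h ↦ hg.2 (hI h hl.2)) (splitsIdempotents_per _) (by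
      rintro _ ⟨g, hg, rfl⟩
      by_cases h : g ∈ I
      · exact ObjectProperty.le_extensionProduct_right _ _ (le_thick _ _ ⟨g, ⟨hg, h⟩, rfl⟩)
      · exact ObjectProperty.le_extensionProduct_left _ _ (le_thick _ _ ⟨g, ⟨hg, h⟩, rfl⟩))

/-- An object of `per^L Γ` whose cohomology vanishes outside an upper set `I` belongs
to `per^(L ∩ I) Γ`. -/
lemma per_inter_of_hom_eq_zero (hΓ : Γ.IsNonneg) {I : Set G} (hI : IsUpperSet I) {L : Set G}
    {X : Derived Γ} (hX : Γ.per L X)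
    (h : ∀ g ∈ L \ I, ∀ (n : ℤ) (f : toD (free Γ (-g)) ⟶ X⟦n⟧), f = 0) : Γ.per (L ∩ I) X :=
  -- The part of `X` generated outside `I` has no morphisms to `X`, so `X` is a summand of its part
  -- generated inside `I`.
  ObjectProperty.prop_right_of_extensionProduct (per_le_extensionProduct hΓ hI L _ hX)
    (fun _ hY ↦ per_hom_eq_zero h hY)

/-! ### The dg module `Γ_0` -/

/-- The projection of `Γ` to `Γ_0`. -/
def toDegreeZero (Γ : DGRing G) (hΓ : Γ.IsNonneg) : regular Γ ⟶ degreeZero Γ hΓ :=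
  mkHom (M := regular Γ) (N := degreeZero Γ hΓ) (fun i g ↦ QuotientAddGroup.mk' (nonzeroPart Γ i g))
    (fun _ _ _ ↦ rfl) (fun _ _ _ _ ↦ rfl)

lemma degreeZero_eq_zero (hΓ : Γ.IsNonneg) {i : ℤ} {g : G} (h : g ≠ 0)
    (x : (degreeZero Γ hΓ).X i g) : x = 0 := by
  induction x using QuotientAddGroup.induction_on with
  | _ x => exact (QuotientAddGroup.eq_zero_iff _).2 fun h' ↦ absurd h' h

lemma exactAt_degreeZero (hΓ : Γ.IsNonneg) {g l : G} (h : g ≠ l) :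
    ((degreeZero Γ hΓ).twist (-l)).ExactAt g :=
  fun _ _ x _ ↦ ⟨0, (map_zero _).trans (degreeZero_eq_zero hΓ (fun e ↦ h (by
    rwa [neg_add_eq_zero, eq_comm] at e)) x).symm⟩

/-- In degree `0` this is the cone of an isomorphism; in any other degree that is not positive, both
modules vanish. -/
lemma exactAt_cone_toDegreeZero (hΓ : Γ.IsNonneg) {g : G} (h : ¬ 0 < g) :
    (cone (toDegreeZero Γ hΓ)).ExactAt g := by
  rintro i j k hi hj ⟨y, (z : Γ.X (j + 1) g)⟩ hx
  subst hi hj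
  by_cases hg : g = 0
  · subst hg
    obtain ⟨y', rfl⟩ := QuotientAddGroup.mk'_surjective _ y
    refine ⟨((0 : (degreeZero Γ hΓ).X i 0), (y' : Γ.X (i + 1) 0)), ?_⟩
    have h₁ : QuotientAddGroup.mk' (nonzeroPart Γ (i + 1 + 1) 0) (Γ.d rfl 0 y' + z) = 0 :=
      congrArg Prod.fst hx
    have h₂ : Γ.d rfl 0 y' + z = 0 := (QuotientAddGroup.eq_zero_iff _).1 h₁ rfl
    refine Prod.ext ?_ (neg_eq_of_add_eq_zero_right h₂)
    exact (congrArg (· + QuotientAddGroup.mk' (nonzeroPart Γ (i + 1) 0) y')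
      (map_zero ((degreeZero Γ hΓ).d rfl 0))).trans (zero_add _)
  · refine ⟨0, (map_zero _).trans (Prod.ext (degreeZero_eq_zero hΓ hg y).symm ?_)⟩
    exact (hΓ _ g (fun h' ↦ h (lt_of_le_of_ne h' (Ne.symm hg))) z).symm

end DGMod

/-! ### Replacing objects of distinguished triangles by isomorphic ones -/

lemma exists_distTriang_of_iso {C : Type*} [Category C] [HasZeroObject C] [HasShift C ℤ]
    [Preadditive C] [∀ n : ℤ, (shiftFunctor C n).Additive] [Pretriangulated C] {X Y Z X' Y' : C}
    {f : X ⟶ Y} {g : Y ⟶ Z} {k : Z ⟶ X⟦(1 : ℤ)⟧} (hT : Triangle.mk f g k ∈ distTriang C)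
    (e : X ≅ X') (e' : Y ≅ Y') : ∃ (f' : X' ⟶ Y') (g' : Y' ⟶ Z) (k' : Z ⟶ X'⟦(1 : ℤ)⟧),
      Triangle.mk f' g' k' ∈ distTriang C :=
  ⟨e.inv ≫ f ≫ e'.hom, e'.inv ≫ g, k ≫ e.hom⟦(1 : ℤ)⟧', isomorphic_distinguished _ hT _
    (Triangle.isoMk _ _ e.symm e'.symm (Iso.refl _)
      (by
        change (e.inv ≫ f ≫ e'.hom) ≫ e'.inv = e.inv ≫ f
        rw [Category.assoc, Category.assoc, e'.hom_inv_id, Category.comp_id])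
      (Category.comp_id _)
      (by
        change (k ≫ e.hom⟦(1 : ℤ)⟧') ≫ e.inv⟦(1 : ℤ)⟧' = 𝟙 Z ≫ k
        rw [Category.assoc, ← CategoryTheory.Functor.map_comp, e.hom_inv_id,
          CategoryTheory.Functor.map_id, Category.comp_id, Category.id_comp]))⟩

lemma exists_distTriang_of_iso₃ {C : Type*} [Category C] [HasZeroObject C] [HasShift C ℤ]
    [Preadditive C] [∀ n : ℤ, (shiftFunctor C n).Additive] [Pretriangulated C] {X Y Z Z' : C}
    {f : X ⟶ Y} {g : Y ⟶ Z} {k : Z ⟶ X⟦(1 : ℤ)⟧} (hT : Triangle.mk f g k ∈ distTriang C)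
    (e : Z ≅ Z') : ∃ (g' : Y ⟶ Z') (k' : Z' ⟶ X⟦(1 : ℤ)⟧), Triangle.mk f g' k' ∈ distTriang C :=
  ⟨g ≫ e.hom, e.inv ≫ k, isomorphic_distinguished _ hT _
    (Triangle.isoMk _ _ (Iso.refl _) (Iso.refl _) e.symm
      ((Category.comp_id _).trans (Category.id_comp _).symm)
      (by
        change (g ≫ e.hom) ≫ e.inv = 𝟙 Y ≫ g
        rw [Category.assoc, e.hom_inv_id, Category.comp_id, Category.id_comp])
      (by
        change (e.inv ≫ k) ≫ (𝟙 X)⟦(1 : ℤ)⟧' = e.inv ≫ k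
        rw [CategoryTheory.Functor.map_id, Category.comp_id]))⟩

namespace CategoryTheory.ObjectProperty

variable {C : Type*} [Category C] [HasZeroObject C] [HasShift C ℤ]
    [Preadditive C] [∀ n : ℤ, (shiftFunctor C n).Additive] [Pretriangulated C] {X Y Z : C}
    {f : X ⟶ Y} {g : Y ⟶ Z} {k : Z ⟶ X⟦(1 : ℤ)⟧} {P : ObjectProperty C} [P.IsTriangulated]
    [P.IsStableUnderRetracts]

lemma prop₂_of_distTriang (hT : Triangle.mk f g k ∈ distTriang C) (hX : P X) (hZ : P Z) : P Y :=
  P.ext_of_isTriangulatedClosed₂ _ hT hX hZ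

lemma prop₃_of_distTriang (hT : Triangle.mk f g k ∈ distTriang C) (hX : P X) (hY : P Y) : P Z :=
  P.ext_of_isTriangulatedClosed₃ _ hT hX hY

end CategoryTheory.ObjectProperty

open CategoryTheory.ObjectProperty

/-! ### The triangle of `Γ_0` and the decomposition of `per^G Γ` into `per^I Γ` and `thick^(Iᶜ) Γ_0`
-/

namespace DGMod

variable {G : Type u} [AddCommGroup G] {Γ : DGRing G} {M N : DGMod Γ}

/-- The trivial grading shift. -/
def twistNegZero (M : DGMod Γ) : M.twist (-0) ≅ M :=
  have e (l : G) : -0 + l = l := by rw [neg_zero, zero_add]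
  isoOfInverse (mkHom (M := M.twist (-0)) (fun _ l ↦ M.castDeg (e l))
      (fun hi l x ↦ M.castDeg_d (e l) hi x) (fun hi _ x a ↦ M.castDeg_act _ (e _) hi _ _ x a))
    (fun _ l ↦ M.castDeg (e l).symm) (fun _ _ x ↦ M.castDeg_castDeg _ _ x)
    (fun _ _ x ↦ M.castDeg_castDeg _ _ x)

lemma thickOn_toD (M : DGMod Γ) {I : Set G} (h : 0 ∈ I) : thickOn M I (toD M) :=
  (thickOn M I).prop_of_iso ((toDer Γ).mapIso M.twistNegZero) (le_thick _ _ ⟨0, h, rfl⟩)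

lemma thickOn_toD_twist (M : DGMod Γ) {I : Set G} {g : G} (h : g ∈ I) :
    thickOn M I (toD (M.twist (-g))) := le_thick _ _ ⟨g, h, rfl⟩

/-- The triangle of a morphism in the derived category, after a grading shift. -/
lemma exists_distTriang_twist (f : M ⟶ N) (g : G) :
    ∃ (f' : toD (M.twist (-g)) ⟶ toD (N.twist (-g)))
      (k : toD (N.twist (-g)) ⟶ (mapDerived (twistFunctor Γ (-g))).obj (toD (cone f)))
      (l : (mapDerived (twistFunctor Γ (-g))).obj (toD (cone f)) ⟶ (toD (M.twist (-g)))⟦(1 : ℤ)⟧),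
      Triangle.mk f' k l ∈ distTriang (Derived Γ) :=
  exists_distTriang_of_iso (distTriang_map (mapDerived (twistFunctor Γ (-g)))
    (distTriang_map (verdierQ (acyclic Γ)) (coneTriangle_mem f)))
    (mapDerivedObj (twistFunctor Γ (-g)) M) (mapDerivedObj (twistFunctor Γ (-g)) N)

variable [PartialOrder G] [IsOrderedAddMonoid G] {hΓ : Γ.IsNonneg}

/-- The cone is perfect because `Γ_0` is, and has cohomology only in the upper set of positive
degrees, so the generators of those degrees suffice. -/
lemma per_Ioi_cone_toDegreeZero (hD : Γ.per Set.univ (toD (degreeZero Γ hΓ))) :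
    Γ.per (Set.Ioi 0) (toD (cone (toDegreeZero Γ hΓ))) := by
  have h : Γ.per Set.univ (toD (cone (toDegreeZero Γ hΓ))) :=
    prop₃_of_distTriang (distTriang_map (verdierQ (acyclic Γ))
      (coneTriangle_mem (toDegreeZero Γ hΓ))) (thickOn_toD _ trivial) hD
  have := per_inter_of_hom_eq_zero hΓ (isUpperSet_Ioi 0) h
    (fun g hg ↦ (free_hom_eq_zero_iff g _).2 (exactAt_cone_toDegreeZero hΓ hg.2))
  rwa [Set.univ_inter] at this

/-- Trades `Γ(-g)` for `Γ_0(-g)` and generators of degree strictly larger than `g`. It is the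
projection of `Γ` to `Γ_0`, shifted in the grading and completed to a triangle. -/
lemma exists_distTriang_degreeZero (hD : Γ.per Set.univ (toD (degreeZero Γ hΓ))) (g : G) :
    ∃ (C : Derived Γ) (f : C ⟶ toD (free Γ (-g)))
      (k : toD (free Γ (-g)) ⟶ toD ((degreeZero Γ hΓ).twist (-g))) (l : _ ⟶ C⟦(1 : ℤ)⟧),
      Triangle.mk f k l ∈ distTriang (Derived Γ) ∧ Γ.per (Set.Ioi g) C := by
  obtain ⟨f, k, l, hT⟩ := exists_distTriang_twist (toDegreeZero Γ hΓ) g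
  obtain ⟨δ, k', hT'⟩ := exists_fiber hT
  refine ⟨_, δ, f, k', hT', (Γ.per (Set.Ioi g)).le_shift (-1) _ (thickOn_mono _ ?_ _
    (thickOn_twist (per_Ioi_cone_toDegreeZero hD) g))⟩
  rintro _ ⟨h, hh, rfl⟩
  exact lt_add_of_pos_left g hh

lemma per_Ici_degreeZero (hD : Γ.per Set.univ (toD (degreeZero Γ hΓ))) (g : G) :
    Γ.per (Set.Ici g) (toD ((degreeZero Γ hΓ).twist (-g))) := by
  obtain ⟨C, f, k, l, hT, hC⟩ := exists_distTriang_degreeZero hD g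
  exact prop₃_of_distTriang hT (thickOn_mono _ Set.Ioi_subset_Ici_self _ hC)
    (thickOn_toD_twist _ Set.self_mem_Ici)

/-- `Γ_0(-g)` is built from the generators of degree `≥ g`, which all lie in `I`. -/
lemma thickOn_degreeZero_le_per (hD : Γ.per Set.univ (toD (degreeZero Γ hΓ))) {I : Set G}
    (hI : IsUpperSet I) : thickOn (degreeZero Γ hΓ) I ≤ Γ.per I :=
  thick_le (by
    rintro _ ⟨g, hg, rfl⟩
    exact thickOn_mono _ (hI.Ici_subset hg) _ (per_Ici_degreeZero hD g))

lemma hom_degreeZero_eq_zero {I J : Set G} (h : Disjoint I J) ⦃X Y : Derived Γ⦄ (hX : Γ.per I X)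
    (hY : thickOn (degreeZero Γ hΓ) J Y) (f : X ⟶ Y) : f = 0 :=
  thickOn_hom_eq_zero (fun _ hg _ hl ↦ exactAt_degreeZero hΓ (h.ne_of_mem hg hl)) hX hY f

/-- The inclusion of `thick^I Γ_0` in `per^I Γ` supplies both the orthogonality, `Γ_0(-l)` being
concentrated in degree `l ∉ I`, and the splitting of idempotents. -/
lemma thickOn_degreeZero_univ_le (hD : Γ.per Set.univ (toD (degreeZero Γ hΓ))) {I : Set G}
    (hI : IsUpperSet I) : thickOn (degreeZero Γ hΓ) Set.univ ≤
      (thickOn (degreeZero Γ hΓ) I).extensionProduct (thickOn (degreeZero Γ hΓ) Iᶜ) :=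
  thick_le_extensionProduct (fun _ _ hX hY ↦ hom_degreeZero_eq_zero disjoint_compl_right
      (thickOn_degreeZero_le_per hD hI _ hX) hY)
    ((splitsIdempotents_per I).mono (thickOn_degreeZero_le_per hD hI)) (by
      rintro _ ⟨g, -, rfl⟩
      by_cases h : g ∈ I
      · exact le_extensionProduct_left _ _ (thickOn_toD_twist _ h)
      · exact le_extensionProduct_right _ _ (thickOn_toD_twist _ h))

/-- The semi-orthogonal decomposition of `per^G Γ` into `per^I Γ` and `thick^(Iᶜ) Γ_0`. -/
lemma per_univ_le (hD : Γ.per Set.univ (toD (degreeZero Γ hΓ))) {I : Set G}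
    (hfin : ∀ g, {h | g ≤ h ∧ h ∉ I}.Finite) : Γ.per Set.univ ≤
      (Γ.per I).extensionProduct (thickOn (degreeZero Γ hΓ) Iᶜ) := by
  have h₀ : ∀ ⦃X Y⦄, Γ.per I X → thickOn (degreeZero Γ hΓ) Iᶜ Y → ∀ f : X ⟶ Y, f = 0 :=
    hom_degreeZero_eq_zero disjoint_compl_right
  have := isTriangulated_extensionProduct h₀
  have := isStableUnderRetracts_extensionProduct h₀ (splitsIdempotents_per I)
  -- Induction on the number of elements above `g` outside `I`. If `g ∉ I`, the triangle of
  -- `Γ_0(-g)` leads to elements `h > g`, and the count drops because `g` itself is lost.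
  suffices key : ∀ (n : ℕ) (g : G), {h | g ≤ h ∧ h ∉ I}.ncard = n →
      (Γ.per I).extensionProduct (thickOn (degreeZero Γ hΓ) Iᶜ) (toD (free Γ (-g))) from
    thick_le (by rintro _ ⟨g, -, rfl⟩; exact key _ g rfl)
  intro n
  induction n using Nat.strong_induction_on with
  | _ n ih =>
    rintro g rfl
    by_cases hg : g ∈ I
    · exact le_extensionProduct_left _ _ (thickOn_toD_twist _ hg)
    · obtain ⟨C, f, k, l, hT, hC⟩ := exists_distTriang_degreeZero hD g
      refine prop₂_of_distTriang hT ?_ (le_extensionProduct_right _ _ (thickOn_toD_twist _ hg))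
      refine thick_le ?_ _ hC
      rintro _ ⟨h, hh, rfl⟩
      refine ih _ (Set.ncard_lt_ncard ?_ (hfin g)) h rfl
      exact ⟨fun x hx ↦ ⟨hh.le.trans hx.1, hx.2⟩, fun H ↦ hh.not_ge (H ⟨le_rfl, hg⟩).1⟩

/-- An object of `per^G Γ` whose cohomology is concentrated in degree `g` belongs to
`thick^{g} Γ_0`. -/
lemma thickOn_degreeZero_singleton (hD : Γ.per Set.univ (toD (degreeZero Γ hΓ))) {g : G}
    {X : Derived Γ} (hX : Γ.per Set.univ X)
    (h : ∀ l ≠ g, ∀ (n : ℤ) (f : toD (free Γ (-l)) ⟶ X⟦n⟧), f = 0) :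
    thickOn (degreeZero Γ hΓ) {g} X := by
  have h₁ : Γ.per (Set.Ici g) X := by
    have := per_inter_of_hom_eq_zero hΓ (isUpperSet_Ici g) hX
      (fun l hl ↦ h l (fun e ↦ hl.2 e.ge))
    rwa [Set.univ_inter] at this
  -- The only generator not already in `per^(>g) Γ` is `Γ(-g)`, and its triangle has third term
  -- `Γ_0(-g)`. As `X` has no cohomology in degrees `> g`, it is a summand of its part in `thick^{g}
  -- Γ_0`.
  have h₂ : Γ.per (Set.Ici g) ≤
      (Γ.per (Set.Ioi g)).extensionProduct (thickOn (degreeZero Γ hΓ) {g}) :=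
    thick_le_extensionProduct (hom_degreeZero_eq_zero (by simp)) (splitsIdempotents_per _) (by
      rintro _ ⟨l, hl, rfl⟩
      by_cases e : g = l
      · subst e
        obtain ⟨C, f, k, l, hT, hC⟩ := exists_distTriang_degreeZero hD g
        exact ⟨_, _, _, _, _, hT, hC, thickOn_toD_twist _ rfl⟩
      · exact le_extensionProduct_left _ _ (thickOn_toD_twist _ (lt_of_le_of_ne hl e)))
  exact prop_right_of_extensionProduct (h₂ _ h₁)
    (fun _ hY ↦ per_hom_eq_zero (fun l hl ↦ h l (fun e ↦ hl.ne e.symm)) hY)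

end DGMod

/-! ### Signs and the double opposite -/

lemma dgSign.congr {a b : ℤ} (c : ℤ) (h : a = b + 2 * c) : dgSign a = dgSign b := by
  rw [h, two_mul, dgSign.add, dgSign.add, dgSign.mul_self, mul_one]

lemma dgSign.eq_or (a : ℤ) : dgSign a = 1 ∨ dgSign a = -1 := by
  obtain h | h := Int.even_or_odd a
  · exact .inl (by simp [dgSign, Int.negOnePow_even a h])
  · exact .inr (by simp [dgSign, Int.negOnePow_odd a h])

lemma dgSign.add_one (a : ℤ) : dgSign (a + 1) = -dgSign a := by
  rw [dgSign.add, dgSign.one, mul_neg_one]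

namespace DGRing

variable {G : Type u} [AddCommGroup G]

/-- The two signs `(-1)^(ij)` and `(-1)^(ji)` cancel. Duals of modules over the opposite ring live
over the double opposite, and this equality brings them back to `Γ`. -/
lemma op_op (Γ : DGRing G) : Γ.op.op = Γ := by
  have h {i j k : ℤ} {g h l : G} (hi : i + j = k) (hg : g + h = l) :
      Γ.op.op.mul hi hg = Γ.mul hi hg := by
    refine AddMonoidHom.ext fun x ↦ AddMonoidHom.ext fun y ↦ ?_
    change dgSign (i * j) • dgSign (j * i) • Γ.mul hi hg x y = _
    rw [smul_smul, mul_comm j i, dgSign.mul_self, one_smul]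
    rfl
  have h' : @DGRing.mul G _ Γ.op.op = @DGRing.mul G _ Γ := by
    funext i j k g h' l hi hg
    exact h hi hg
  obtain ⟨X, d, one, mul, h₁, h₂, h₃, h₄, h₅⟩ := Γ
  change DGRing.mk _ _ _ _ _ _ _ _ _ = DGRing.mk _ _ _ _ _ _ _ _ _
  congr 1

end DGRing

namespace DGMod

variable {G : Type u} [AddCommGroup G] {Γ : DGRing G} {P Q R : DGMod Γ}

/-! ### Functoriality of the dual -/

lemma ev_castHom {i : ℤ} {g : G} (φ : P.dualHoms i g) {j j' k : ℤ} {h l : G} (hj : j = j')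
    (e : j' + i = k) (e' : j + i = k) (f : h + g = l) (x : P.X j h) :
    ev φ e f (P.castHom hj h x) = ev φ e' f x := by
  subst hj; rfl

lemma ev_d {i : ℤ} {g : G} (φ : P.dualHoms i g) {j j₁ j₂ k : ℤ} {h l : G} (e₁ : j₁ + i = k)
    (e₂ : j₂ + i = k) (f : h + g = l) (h₁ : j + 1 = j₁) (h₂ : j + 1 = j₂) (x : P.X j h) :
    ev φ e₁ f (P.d h₁ h x) = ev φ e₂ f (P.d h₂ h x) := by
  subst h₁ h₂; rfl

/-- Composition with a morphism. -/
def dualComp (f : P ⟶ Q) {i : ℤ} {g : G} (φ : Q.dualHoms i g) : P.dualHoms i g :=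
  mkDual (fun e e' ↦ (ev φ e e').comp (app f _ _)) (fun e e₁ e' e₁' hj hk hh hl x b ↦ by
    simp only [AddMonoidHom.coe_comp, Function.comp_apply, app_act]
    exact ev_act φ e e₁ e' e₁' hj hk hh hl _ b)

lemma ev_dualComp (f : P ⟶ Q) {i : ℤ} {g : G} (φ : Q.dualHoms i g) {j k : ℤ} {h l : G}
    (e : j + i = k) (e' : h + g = l) (x : P.X j h) :
    ev (dualComp f φ) e e' x = ev φ e e' (app f j h x) := rfl

/-- The morphism between duals induced by a morphism. -/
def dualMap (f : P ⟶ Q) : Q.dual ⟶ P.dual :=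
  mkHom (M := Q.dual) (N := P.dual)
    (fun _ _ ↦ AddMonoidHom.mk' (dualComp f) (fun _ _ ↦ dualHoms_ext (fun _ _ _ ↦ rfl)))
    (fun {i j} hi g (φ : Q.dualHoms i g) ↦ by
      refine dualHoms_ext (fun j h x ↦ ?_)
      change ev (dualD hi φ) rfl rfl (app f j h x) = ev (dualD hi (dualComp f φ)) rfl rfl x
      rw [ev_dualD, ev_dualD, ev_dualComp, ev_dualComp, app_d])
    (fun {i j k g h l} hi hg (φ : Q.dualHoms i g) (a : Γ.X j h) ↦ by
      refine dualHoms_ext (fun j h x ↦ ?_)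
      change ev (dualAct hi hg φ a) rfl rfl (app f j h x) =
        ev (dualAct hi hg (dualComp f φ) a) rfl rfl x
      rw [ev_dualAct hi hg _ _ _ _ rfl rfl, ev_dualAct hi hg _ _ _ _ rfl rfl, ev_dualComp])

lemma dualMap_id : dualMap (𝟙 P) = 𝟙 P.dual := rfl

lemma dualMap_comp (f : P ⟶ Q) (f' : Q ⟶ R) : dualMap (f ≫ f') = dualMap f' ≫ dualMap f := rfl

lemma dualMap_sub (f f' : P ⟶ Q) : dualMap (f - f') = dualMap f - dualMap f' := by
  refine hom_ext fun i g (φ : Q.dualHoms i g) ↦ dualHoms_ext fun j h x ↦ ?_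
  exact map_sub (ev φ rfl rfl) _ _

/-- Precomposition with the homotopy `s`, with the sign `(-1)^i` on maps of degree `i`, is a
homotopy between the duals. -/
lemma dualMap_mem_nullHomotopic {f : P ⟶ Q} (hf : f ∈ nullHomotopic P Q) :
    dualMap f ∈ nullHomotopic Q.dual P.dual := by
  obtain ⟨s, hs, hs'⟩ := hf
  let t {i j : ℤ} (hj : j + 1 = i) (g : G) (φ : Q.dualHoms i g) : P.dualHoms j g :=
    mkDual (fun {m k h l} e e' ↦ dgSign i • (ev φ (show m - 1 + i = k by omega) e').comp
      (s (show m - 1 + 1 = m by omega) h)) (fun {m k j' m₁ k₁ h l h' h₁ l₁} e e₁ e' e₁' hm hk hh hl x b ↦ by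
        simp only [AddMonoidHom.smul_apply, AddMonoidHom.coe_comp, Function.comp_apply, map_zsmul]
        rw [hs (i' := m - 1) (by omega) (by omega) hm (by omega),
          ev_act φ (show m - 1 + i = k by omega) _ e' e₁' (by omega) hk hh hl])
  have ht {i j : ℤ} (hj : j + 1 = i) (g : G) (φ : Q.dualHoms i g) {m m' k : ℤ} {h l : G}
      (hm : m' + 1 = m) (e : m + j = k) (e' : h + g = l) (x : P.X m h) :
      ev (t hj g φ) e e' x = dgSign i • ev φ (by omega) e' (s hm h x) := by
    obtain rfl : m' = m - 1 := by omega
    rfl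
  have hd {i : ℤ} {g : G} (φ : Q.dualHoms i g) {m k k' k'' : ℤ} {h l : G} (e : m + i = k)
      (e₁ : m + i = k') (e' : h + g = l) (hk : k + 1 = k'') (hk' : k' + 1 = k'') (x : Q.X m h) :
    Γ.d hk l (ev φ e e' x) = Γ.d hk' l (ev φ e₁ e' x) := d_ev φ e e₁ e' hk hk' x
  refine ⟨fun {i j} hj g ↦ AddMonoidHom.mk' (t hj g) (fun φ ψ ↦ dualHoms_ext fun m h x ↦ ?_), ?_, ?_⟩
  · exact smul_add (dgSign i) (ev φ _ _ (s _ h x)) (ev ψ _ _ (s _ h x))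
  · intro i i' j k k' g h l hi hk e e' hg (φ : Q.dualHoms i g) (a : Γ.X j h)
    refine dualHoms_ext fun m r x ↦ ?_
    change ev (t hk l (dualAct e hg φ a)) rfl rfl x = ev (dualAct e' hg (t hi g φ) a) rfl rfl x
    rw [ht hk l _ (show m - 1 + 1 = m by omega), ev_dualAct e' hg _ _ _ _ rfl rfl,
      ht hi g _ (show m - 1 + 1 = m by omega),
      ev_dualAct e hg _ _ _ _ (show m - 1 + i = m + i' by omega) rfl, map_zsmul, smul_smul,
      smul_smul]
    congr 1
    rw [← dgSign.add, ← dgSign.add]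
    subst e hi
    exact dgSign.congr j (by ring)
  · intro i j k hj hk g (φ : Q.dualHoms i g)
    refine dualHoms_ext fun m r x ↦ ?_
    change ev φ rfl rfl (app f m r x) = ev (dualD hj (t hj g φ)) rfl rfl x +
      ev (t hk g (dualD hk φ)) rfl rfl x
    rw [hs' (show m - 1 + 1 = m by omega) rfl, ev_dualD,
      ht hk g _ (show m - 1 + 1 = m by omega), ev_dualD, ht hj g _ (show m - 1 + 1 = m by omega),
      ht hj g _ rfl, map_add, map_zsmul,
      hd φ (show m - 1 + i = m + j by omega) rfl rfl (show m + j + 1 = m + i by omega)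
        (show m - 1 + i + 1 = m + i by omega),
      ev_d φ _ (show m - 1 + 1 + i = m + i by omega) rfl _ rfl]
    subst hj hk
    have key {A : Type u} [AddCommGroup A] (a b c : A) : a + b = dgSign (j + 1) • c -
        dgSign j • dgSign (j + 1) • b + dgSign (j + 1 + 1) • (c - dgSign (j + 1) • a) := by
      obtain h | h := dgSign.eq_or j <;>
      · simp only [dgSign.add_one, h, neg_smul, neg_neg, one_smul]
        abel
    exact key (A := Γ.X (m + (j + 1)) (r + g)) _ _ _

/-- The dual of a shift. -/
def dualShiftIso (P : DGMod Γ) (n : ℤ) : P.dual.shiftObj (-n) ≅ (P.shiftObj n).dual :=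
  isoOfInverse
    (mkHom (M := P.dual.shiftObj (-n)) (N := (P.shiftObj n).dual)
      (fun i g ↦ AddMonoidHom.mk' (fun φ : P.dualHoms (i + -n) g ↦
          -- The sign is forced: the differential of the shifted dual carries `(-1)^n`, so the signs
          -- `c_i` in degree `i` must satisfy `(-1)^n c_(i+1) = c_i`.
          (mkDual (fun {j k h l} e e' ↦ dgSign (n * i) • ev φ (show j + n + (i + -n) = k by omega) e')
            (fun e e₁ f f₁ hj hk hh hl x b ↦ (congrArg (dgSign (n * i) • ·)
                (ev_act φ (by omega) (by omega) f f₁ (by omega) hk hh hl x b)).trans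
              (DFunLike.congr_fun (map_zsmul (Γ.mul hk hl) _ _) b).symm) :
              (P.shiftObj n).dualHoms i g))
        (fun φ ψ ↦ dualHoms_ext fun j h x ↦ smul_add (dgSign (n * i))
          (ev φ (show j + n + (i + -n) = j + i by omega) rfl x) (ev ψ _ rfl x)))
      (fun {i i'} hi g (φ : P.dualHoms (i + -n) g) ↦ by
        refine dualHoms_ext fun j h (x : P.X (j + n) h) ↦ ?_
        change dgSign (n * i') • ev (dgSign (-n) • dualD (show i + -n + 1 = i' + -n by omega) φ)
            (show j + n + (i' + -n) = j + i' by omega) rfl x =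
          Γ.d (show j + i + 1 = j + i' by omega) _
            (dgSign (n * i) • ev φ (show j + n + (i + -n) = j + i by omega) rfl x) -
          dgSign i • dgSign (n * i) • ev φ (show j + 1 + n + (i + -n) = j + i' by omega) rfl
            (dgSign n • P.d (show j + n + 1 = j + 1 + n by omega) h x)
        rw [ev_zsmul, ev_dualD]
        simp only [map_zsmul, smul_sub, smul_smul, ← dgSign.add]
        rw [d_ev φ rfl (show j + n + (i + -n) = j + i by omega) rfl _
            (show j + i + 1 = j + i' by omega),
          ev_d φ _ (show j + 1 + n + (i + -n) = j + i' by omega) rfl _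
            (show j + n + 1 = j + 1 + n by omega),
          dgSign.congr (a := n * i' + -n) (b := n * i) 0 (by subst hi; ring),
          dgSign.congr (a := n * i' + (-n + (i + -n))) (b := i + (n * i + n)) (-n)
            (by subst hi; ring)])
      (fun {i j k g h l} hi hg (φ : P.dualHoms (i + -n) g) (a : Γ.X j h) ↦ by
        refine dualHoms_ext fun m r (x : P.X (m + n) r) ↦ ?_
        change dgSign (n * k) • ev (dualAct (show i + -n + j = k + -n by omega) hg φ a)
          (show m + n + (k + -n) = m + k by omega) rfl x = dgSign (i * j) •
            Γ.mul (show j + (m + i) = m + k by omega) (show h + (r + g) = r + l by rw [← hg]; abel) a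
              (dgSign (n * i) • ev φ (show m + n + (i + -n) = m + i by omega) rfl x)
        rw [ev_dualAct (e₁ := show m + n + (i + -n) = m + i by omega) (f₁ := rfl), map_zsmul,
          smul_smul, smul_smul, ← dgSign.add, ← dgSign.add]
        congr 1
        subst hi
        exact dgSign.congr 0 (by ring)))
    (fun i g (φ : (P.shiftObj n).dualHoms i g) ↦
      (mkDual (fun {j k h l} e e' ↦ dgSign (n * i) •
        (ev φ (show j - n + i = k by omega) e').comp (P.castHom (show j = j - n + n by omega) h))
        (fun {j k j' m₁ k₁ h l h' h₁ l₁} e e₁ e' e₁' hm hk hh hl x b ↦ by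
          change dgSign (n * i) • ev φ _ _ (P.castHom _ _ (P.act hm hh x b)) =
            Γ.mul hk hl (dgSign (n * i) • ev φ _ _ (P.castHom _ _ x)) b
          rw [P.castHom_act hm (show j - n + n + j' = m₁ - n + n by omega) (by omega)
            (by omega) hh, map_zsmul]
          exact congrArg (dgSign (n * i) • ·) (ev_act φ (show j - n + i = k by omega)
            (show m₁ - n + i = k₁ by omega) e' e₁' (by omega) hk hh hl _ b)) :
        P.dualHoms (i + -n) g))
    (fun i g (φ : P.dualHoms (i + -n) g) ↦ by
      refine dualHoms_ext fun j h (x : P.X j h) ↦ ?_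
      change dgSign (n * i) • dgSign (n * i) •
        ev φ (show j - n + n + (i + -n) = j + (i + -n) by omega) rfl (P.castHom _ h x) = ev φ rfl rfl x
      rw [smul_smul, dgSign.mul_self, one_smul, ev_castHom])
    (fun i g (φ : (P.shiftObj n).dualHoms i g) ↦ by
      refine dualHoms_ext fun j h (x : P.X (j + n) h) ↦ ?_
      change dgSign (n * i) • dgSign (n * i) •
        ev φ (show j + n - n + i = j + i by omega) rfl (P.castHom _ h x) = ev φ rfl rfl x
      rw [smul_smul, dgSign.mul_self, one_smul]
      exact (congrArg _ (castHom_shiftObj P n (show j = j + n - n by omega) h x)).symm.trans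
        (ev_castHom φ _ _ _ _ x))

/-- The dual of a cone is a shift of a cone. -/
def dualConeIso (f : P ⟶ Q) : cone (dualMap f) ≅ (cone f).dual.shiftObj 1 :=
  isoOfInverse
    (mkHom (M := cone (dualMap f)) (N := (cone f).dual.shiftObj 1)
      (fun i g ↦ AddMonoidHom.mk' (fun φ : P.dualHoms i g × Q.dualHoms (i + 1) g ↦
          -- A map of degree `i + 1` on `Q ⊕ P[1]` is a map of degree `i + 1` on `Q` and one of
          -- degree `i` on `P`. The sign `(-1)^i` on the latter compensates the signs depending on
          -- the degree in the differential of the dual.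
          (mkDual (fun {j k h l} e e' ↦ (ev φ.2 e e').coprod
            (dgSign i • ev φ.1 (show j + 1 + i = k by omega) e'))
            (fun {j k j' m₁ k₁ h l h' h₁ l₁} e e₁ e' e₁' hm hk hh hl x b ↦ by
              change ev φ.2 e₁ e₁' (Q.act hm hh x.1 b) + dgSign i • ev φ.1 _ e₁' (P.act _ hh x.2 b) =
                Γ.mul hk hl (ev φ.2 e e' x.1 + dgSign i • ev φ.1 _ e' x.2) b
              rw [map_add, map_zsmul, AddMonoidHom.add_apply, AddMonoidHom.smul_apply,
                ev_act φ.2 e e₁ e' e₁' hm hk hh hl,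
                ev_act φ.1 (show j + 1 + i = k by omega) (show m₁ + 1 + i = k₁ by omega) e' e₁'
                  (by omega) hk hh hl]) :
              (cone f).dualHoms (i + 1) g))
        (fun φ ψ ↦ dualHoms_ext fun j h (x : Q.X j h × P.X (j + 1) h) ↦ by
          have key {A : Type u} [AddCommGroup A] (a b c e : A) :
              a + b + dgSign i • (c + e) = a + dgSign i • c + (b + dgSign i • e) := by
            rw [smul_add, add_add_add_comm]
          exact key (ev φ.2 rfl rfl x.1) (ev ψ.2 rfl rfl x.1)
            (ev φ.1 (show j + 1 + i = j + (i + 1) by omega) rfl x.2) (ev ψ.1 _ rfl x.2)))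
      (fun {i i'} hi g (φ : P.dualHoms i g × Q.dualHoms (i + 1) g) ↦ by
        refine dualHoms_ext fun j h (x : Q.X j h × P.X (j + 1) h) ↦ ?_
        subst hi
        change -ev (dualD rfl φ.2) rfl rfl x.1 + dgSign (i + 1) •
            (ev (dualD rfl φ.1) (show j + 1 + (i + 1) = j + (i + 1 + 1) by omega) rfl x.2 +
              ev (dualComp f φ.2) (show j + 1 + (i + 1) = j + (i + 1 + 1) by omega) rfl x.2) =
          dgSign 1 • (Γ.d (show j + (i + 1) + 1 = j + (i + 1 + 1) by omega) _
              (ev φ.2 rfl rfl x.1 + dgSign i •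
                ev φ.1 (show j + 1 + i = j + (i + 1) by omega) rfl x.2) -
            dgSign (i + 1) • (ev φ.2 (show j + 1 + (i + 1) = j + (i + 1 + 1) by omega) rfl
                (Q.d rfl h x.1 + app f (j + 1) h x.2) +
              dgSign i • ev φ.1 (show j + 1 + 1 + i = j + (i + 1 + 1) by omega) rfl
                (-P.d rfl h x.2)))
        rw [ev_dualD, ev_dualD, ev_dualComp]
        simp only [map_add, map_neg, map_zsmul]
        rw [d_ev φ.1 (show j + 1 + i = j + (i + 1) by omega) rfl rfl _
          (show j + 1 + i + 1 = j + (i + 1 + 1) by omega)]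
        have key {A : Type u} [AddCommGroup A] (a b c e r : A) :
            -(a - dgSign (i + 1) • b) + dgSign (i + 1) • (c - dgSign i • e + r) =
              dgSign 1 • (a + dgSign i • c - dgSign (i + 1) • (b + r + dgSign i • -e)) := by
          obtain h | h := dgSign.eq_or i <;>
          · simp only [dgSign.add_one, dgSign.one, h, neg_smul, neg_neg, one_smul]
            abel
        exact key _ _ _ _ _)
      (fun {i j k g h l} hi hg (φ : P.dualHoms i g × Q.dualHoms (i + 1) g) (a : Γ.X j h) ↦ by
        refine dualHoms_ext fun m r (x : Q.X m r × P.X (m + 1) r) ↦ ?_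
        subst hi
        change ev (dualAct (show i + 1 + j = i + j + 1 by omega) hg φ.2 a) rfl rfl x.1 +
            dgSign (i + j) • ev (dualAct rfl hg φ.1 a)
              (show m + 1 + (i + j) = m + (i + j + 1) by omega) rfl x.2 =
          dgSign ((i + 1) * j) • Γ.mul (show j + (m + (i + 1)) = m + (i + j + 1) by omega)
            (show h + (r + g) = r + l by rw [← hg]; abel) a
            (ev φ.2 rfl rfl x.1 + dgSign i • ev φ.1 (show m + 1 + i = m + (i + 1) by omega) rfl x.2)
        rw [ev_dualAct _ hg φ.2 a _ _ rfl rfl,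
          ev_dualAct _ hg φ.1 a _ _ (show m + 1 + i = m + (i + 1) by omega) rfl, map_add,
          map_zsmul, smul_add, smul_smul, smul_smul, ← dgSign.add, ← dgSign.add,
          dgSign.congr (a := i + j + i * j) (b := (i + 1) * j + i) 0 (by ring)]))
    (fun i g (φ : (cone f).dualHoms (i + 1) g) ↦
      ((mkDual (fun {j k h l} e e' ↦ dgSign i • (ev φ (show j - 1 + (i + 1) = k by omega) e').comp
          ((AddMonoidHom.inr _ _).comp (P.castHom (show j = j - 1 + 1 by omega) h)))
        (fun {j k j' m₁ k₁ h l h' h₁ l₁} e e₁ e' e₁' hm hk hh hl x b ↦ by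
          have h₀ : (cone f).act (show j - 1 + j' = m₁ - 1 by omega) hh
              ((0, P.castHom (show j = j - 1 + 1 by omega) h x) : Q.X _ h × P.X _ h) b =
              ((0, P.castHom (by omega) _ (P.act hm hh x b)) : Q.X _ h₁ × P.X (m₁ - 1 + 1) h₁) := by
            refine Prod.ext (DFunLike.congr_fun (map_zero _) b) ?_
            exact (P.castHom_act hm (show j - 1 + 1 + j' = m₁ - 1 + 1 by omega) _ _ hh x b).symm
          have h₁ := ev_act φ (show j - 1 + (i + 1) = k by omega)
            (show m₁ - 1 + (i + 1) = k₁ by omega) e' e₁' (show j - 1 + j' = m₁ - 1 by omega) hk hh hl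
              ((0, P.castHom (show j = j - 1 + 1 by omega) h x) : Q.X _ h × P.X _ h) b
          exact (congrArg (dgSign i • ev φ _ _ ·) h₀).symm.trans ((congrArg (dgSign i • ·) h₁).trans
            (DFunLike.congr_fun (map_zsmul (Γ.mul hk hl) _ _) b).symm)) : P.dualHoms i g),
      (mkDual (fun {j k h l} e e' ↦ (ev φ e e').comp (AddMonoidHom.inl _ _))
        (fun {j k j' m₁ k₁ h l h' h₁ l₁} e e₁ e' e₁' hm hk hh hl x b ↦ by
          have h₀ : (cone f).act hm hh ((x, 0) : Q.X j h × P.X (j + 1) h) b =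
              ((Q.act hm hh x b, 0) : Q.X m₁ h₁ × P.X (m₁ + 1) h₁) :=
            Prod.ext rfl (DFunLike.congr_fun (map_zero (P.act _ hh)) b)
          exact (congrArg (ev φ e₁ e₁') h₀).symm.trans
            (ev_act φ e e₁ e' e₁' hm hk hh hl ((x, 0) : Q.X j h × P.X (j + 1) h) b)) :
        Q.dualHoms (i + 1) g)))
    (fun i g (φ : P.dualHoms i g × Q.dualHoms (i + 1) g) ↦ by
      refine Prod.ext (dualHoms_ext fun j h x ↦ ?_) (dualHoms_ext fun j h x ↦ ?_)
      · change dgSign i • (ev φ.2 _ rfl 0 + dgSign i • ev φ.1 _ rfl (P.castHom _ h x)) = _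
        rw [map_zero, zero_add, smul_smul, dgSign.mul_self, one_smul, ev_castHom]
      · change ev φ.2 rfl rfl x + dgSign i • ev φ.1 _ rfl 0 = _
        rw [map_zero, smul_zero, add_zero])
    (fun i g (φ : (cone f).dualHoms (i + 1) g) ↦ by
      refine dualHoms_ext fun j h (x : Q.X j h × P.X (j + 1) h) ↦ ?_
      change ev φ rfl rfl ((x.1, 0) : Q.X j h × P.X (j + 1) h) + dgSign i • dgSign i •
        ev φ (show j + 1 - 1 + (i + 1) = j + (i + 1) by omega) rfl
          ((0, P.castHom _ h x.2) : Q.X (j + 1 - 1) h × P.X (j + 1 - 1 + 1) h) = ev φ rfl rfl x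
      have h₀ : (cone f).castHom (show j = j + 1 - 1 by omega) h
          ((0, x.2) : Q.X j h × P.X (j + 1) h) =
          ((0, P.castHom (by omega) h x.2) : Q.X (j + 1 - 1) h × P.X (j + 1 - 1 + 1) h) := by
        have : ∀ {j' : ℤ} (e : j = j'), (cone f).castHom e h
          ((0, x.2) : Q.X j h × P.X (j + 1) h) = (0, P.castHom (by omega) h x.2) := by
          rintro _ rfl; rfl
        exact this _
      rw [smul_smul, dgSign.mul_self, one_smul, ← h₀, ev_castHom φ _ _ rfl]
      refine ((ev φ rfl rfl).map_add ((x.1, 0) : (cone f).X j h)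
        ((0, x.2) : (cone f).X j h)).symm.trans (congrArg _ (Prod.ext ?_ ?_))
      · exact add_zero _
      · exact zero_add _)

/-- The dual of a free dg module is free. -/
def dualFreeIso (Γ : DGRing G) (g : G) : (free Γ g).dual ≅ free Γ.op (-g) :=
  isoOfInverse
    (mkHom (M := (free Γ g).dual) (N := free Γ.op (-g))
      (fun i l ↦ AddMonoidHom.mk' (fun φ : (free Γ g).dualHoms i l ↦
        (ev φ (zero_add i) rfl (gen Γ g) : Γ.X i (-g + l))) (fun _ _ ↦ rfl))
      (fun {i i'} hi l (φ : (free Γ g).dualHoms i l) ↦ by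
        change ev (dualD hi φ) (zero_add i') rfl (gen Γ g) = Γ.d hi _ (ev φ (zero_add i) rfl (gen Γ g))
        rw [ev_dualD, d_gen, map_zero, smul_zero, sub_zero]
        exact d_ev φ _ _ _ _ _ _)
      (fun {i j k l h l'} hi hg (φ : (free Γ g).dualHoms i l) (a : Γ.X j h) ↦ by
        change ev (dualAct hi hg φ a) (zero_add k) rfl (gen Γ g) = dgSign (i * j) •
          Γ.mul _ _ a (ev φ (zero_add i) rfl (gen Γ g))
        rw [ev_dualAct]))
    (fun i l (c : Γ.X i (-g + l)) ↦ (mkDual (fun {j k h h'} e e' ↦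
      Γ.mul (show i + j = k by omega) (show -g + l + (g + h) = h' by rw [← e']; abel) c)
        (fun e e₁ f f₁ hj hk hh hl x b ↦
          (Γ.mul_assoc _ hj hk _ _ (by rw [add_assoc, hh]) hl _ c x b).symm) :
        (free Γ g).dualHoms i l))
    (fun i l (φ : (free Γ g).dualHoms i l) ↦ by
      refine dualHoms_ext fun j h (x : Γ.X j (g + h)) ↦ ?_
      change Γ.mul _ _ (ev φ (zero_add i) rfl (gen Γ g)) x = ev φ rfl rfl x
      have h₁ := ev_act φ (zero_add i) rfl rfl rfl (zero_add j) (add_comm i j)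
        (show -g + (g + h) = h by abel) (show -g + l + (g + h) = h + l by abel) (gen Γ g) x
      rw [gen_act] at h₁
      exact h₁.symm)
    (fun i l (c : Γ.X i (-g + l)) ↦ Γ.mul_oneOf _ _ c)

end DGMod

namespace DGMod

variable {G : Type u} [AddCommGroup G] {Γ : DGRing G} {P Q M N : DGMod Γ}

/-! ### Morphisms from a K-projective dg module to a free one -/

lemma app_castDeg (f : M ⟶ N) {i : ℤ} {g h : G} (e : g = h) (x : M.X i g) :
    app f i h (M.castDeg e x) = N.castDeg e (app f i g x) := by
  subst e; rfl

/-- Grading shifts by `g` and `-g` are inverse to each other, so homotopies can be moved from one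
side to the other; the transports only identify `g + (-g + l)` with `l`. -/
lemma mem_nullHomotopic_of_twist {g : G}
    (h : ∀ f' : P ⟶ N.twist (-g), f' ∈ nullHomotopic P (N.twist (-g))) (f : P.twist g ⟶ N) :
    f ∈ nullHomotopic (P.twist g) N := by
  have e (l : G) : l = g + (-g + l) := by abel
  have e' (l : G) : -g + (g + l) = l := by abel
  let f' : P ⟶ N.twist (-g) := mkHom (N := N.twist (-g))
    (fun i l ↦ (app f i (-g + l)).comp (P.castDeg (e l)))
    (fun hi l x ↦ (congrArg _ (P.castDeg_d (e l) hi x)).trans (app_d f hi (-g + l) _))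
    (fun {i j k g₁ h l} hi hg x a ↦ (congrArg _ (P.castDeg_act (e l) (e g₁) hi hg
      (by rw [add_assoc, add_assoc, hg]) x a)).trans (app_act f hi (by rw [add_assoc, hg]) _ a))
  obtain ⟨s, hs, hs'⟩ := h f'
  refine ⟨fun {i j} hj l ↦ (N.castDeg (e' l)).comp (s hj (g + l)), ?_, ?_⟩
  · intro i i' j k k' g₁ h l hi hk d d' hg x a
    exact (congrArg _ (hs hi hk d d' (by rw [add_assoc, hg]) x a)).trans
      (N.castDeg_act (e' l) (e' g₁) d' _ hg _ a)
  · intro i j k hj hk l x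
    let t {i j : ℤ} (hj : j + 1 = i) : P.X i (g + l) →+ N.X j (-g + (g + l)) := s hj (g + l)
    have h₁ : app f i (-g + (g + l)) (P.castDeg (e (g + l)) x) =
        N.d hj _ (t hj x) + t hk (P.d hk _ x) := hs' hj hk (g + l) x
    have h₂ := congrArg (N.castDeg (e' l)) h₁
    have h₃ : P.castDeg (e (g + l)) x = (P.twist g).castDeg (e' l).symm x := by
      have : ∀ {l' : G} (d : l = l') (d' : g + l = g + l'),
        P.castDeg d' x = (P.twist g).castDeg d x := by rintro _ rfl _; rfl
      exact this _ _
    rw [map_add, h₃, app_castDeg, castDeg_castDeg, castDeg_d] at h₂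
    exact h₂

lemma KProjective.twist (hP : P.KProjective) (g : G) : (P.twist g).KProjective :=
  fun _ hN f ↦ mem_nullHomotopic_of_twist
    (fun f' ↦ hP _ (IsExact.acyclic (Φ := twistFunctor Γ (-g)) hN) f') f

/-- After identifying `a + (b + r)` with `r + (a + b)`, such a morphism is a cocycle of degree `(n,
a + b)` in the dual of `P`. A cochain bounding it is a null-homotopy, up to the sign `(-1)^n` of the
shifted differential. -/
lemma mem_nullHomotopic_of_exactAt_dual {a b : G} (h : P.dual.ExactAt (a + b)) {n : ℤ}
    (f : P ⟶ ((free Γ a).shiftObj n).twist b) : f ∈ nullHomotopic P _ := by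
  have e {r l : G} (h : r + (a + b) = l) : a + (b + r) = l := by rw [← h]; abel
  let c {j k : ℤ} (h : j + n = k) {r l : G} (h' : r + (a + b) = l) :
      (((free Γ a).shiftObj n).twist b).X j r →+ Γ.X k l :=
    ((regular Γ).castHom h l).comp (Γ.castDeg (i := j + n) (e h'))
  have cd {j j' k k' : ℤ} (h : j + n = k) (h₁ : j' + n = k') {r l : G} (h' : r + (a + b) = l)
      (hj : j + 1 = j') (hk : k + 1 = k') (x : Γ.X (j + n) (a + (b + r))) :
      c h₁ h' (Γ.d (show j + n + 1 = j' + n by omega) _ x) = Γ.d hk l (c h h' x) := by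
    subst h h₁
    exact Γ.castDeg_d _ _ x
  have ca {j j' j₁ k k₁ : ℤ} (h : j + n = k) (h₁ : j₁ + n = k₁) {r l r' r₁ l₁ : G}
      (h' : r + (a + b) = l) (h₁' : r₁ + (a + b) = l₁) (hj : j + j' = j₁) (hk : k + j' = k₁)
      (hr : r + r' = r₁) (hl : l + r' = l₁)
      (x : Γ.X (j + n) (a + (b + r))) (y : Γ.X j' r') :
      c h₁ h₁' (Γ.mul (show j + n + j' = j₁ + n by omega)
        (show a + (b + r) + r' = a + (b + r₁) by rw [← hr]; abel) x y) =
        Γ.mul hk hl (c h h' x) y := by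
    subst h h₁
    exact Γ.castDeg_mul _ _ _ _ _ x y
  let F (j : ℤ) (r : G) : P.X j r →+ Γ.X (j + n) (a + (b + r)) := app f j r
  have hF {j j' : ℤ} (hj : j + 1 = j') (r : G) (x : P.X j r) : F j' r (P.d hj r x) =
    dgSign n • Γ.d (show j + n + 1 = j' + n by omega) _ (F j r x) := app_d f hj r x
  let φ : P.dualHoms n (a + b) := mkDual (fun {j k r l} h h' ↦ (c h h').comp (F j r))
    (fun {j k j' m₁ k₁ h l h' h₁ l₁} e e₁ e' e₁' hm hk hh hl x b ↦
      (congrArg (c e₁ e₁') (app_act f hm hh x b)).trans (ca e e₁ e' e₁' hm hk hh hl _ b))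
  -- Compatibility of `f` with the differentials of `P` and of the shift is exactly the cocycle
  -- condition for `φ`.
  obtain ⟨ψ, hψ⟩ := h (show n - 1 + 1 = n by omega) rfl φ (by
    refine dualHoms_ext fun j r x ↦ ?_
    change Γ.d (show j + n + 1 = j + (n + 1) by omega) _ (c rfl rfl (F j r x)) -
      dgSign n • c (show j + 1 + n = j + (n + 1) by omega) rfl (F (j + 1) r (P.d rfl r x)) = 0
    rw [hF, sub_eq_zero]
    refine (cd rfl (by omega) rfl rfl _ _).symm.trans ?_
    refine Eq.trans ?_ (congrArg (dgSign n • ·) (map_zsmul (c _ rfl) (dgSign n)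
      (Γ.d (show j + n + 1 = j + 1 + n by omega) _ (F j r x)))).symm
    exact ((smul_smul _ _ _).trans ((congrArg (· • _) (dgSign.mul_self n)).trans
      (one_smul _ _))).symm)
  refine ⟨fun {i j} hj r ↦ dgSign n • (Γ.castDeg (i := j + n) (e rfl).symm).comp
    (ev ψ (show i + (n - 1) = j + n by omega) rfl), ?_, ?_⟩
  · intro i i' j k k' g h l hi hk e₁ e₁' hg x y
    change dgSign n • Γ.castDeg _ (ev ψ _ rfl (P.act e₁ hg x y)) =
      Γ.mul _ _ (dgSign n • Γ.castDeg _ (ev ψ _ rfl x)) y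
    rw [ev_act ψ (show i + (n - 1) = i' + n by omega) (show k + (n - 1) = k' + n by omega) rfl rfl
      e₁ (show i' + n + j = k' + n by omega) hg (by rw [← hg]; abel), map_zsmul,
      Γ.castDeg_mul _ (e rfl).symm _ _ (by rw [← hg]; abel)]
    rfl
  · intro i j k hj hk r x
    subst hj hk
    have h₁ : Γ.d (show j + 1 + (n - 1) + 1 = j + 1 + n by omega) _ (ev ψ rfl rfl x) -
        dgSign (n - 1) • ev ψ (show j + 1 + 1 + (n - 1) = j + 1 + n by omega) rfl (P.d rfl r x) =
        Γ.castDeg (e rfl) (F (j + 1) r x) := congrArg (fun χ ↦ ev χ rfl rfl x) hψ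
    have h₂ := congrArg (Γ.castDeg (e rfl).symm) h₁
    rw [Γ.castDeg_castDeg, d_ev ψ rfl (show j + 1 + (n - 1) = j + n by omega) rfl _
      (show j + n + 1 = j + 1 + n by omega), map_sub, map_zsmul, Γ.castDeg_d,
      ← neg_eq_iff_eq_neg.2 (dgSign.add_one (n - 1)), sub_add_cancel, neg_smul, sub_neg_eq_add] at h₂
    refine h₂.symm.trans ?_
    change _ = dgSign n • Γ.d _ _ (dgSign n • Γ.castDeg _ (ev ψ _ rfl x)) +
      dgSign n • Γ.castDeg _ (ev ψ _ rfl (P.d rfl r x))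
    rw [map_zsmul, smul_smul, dgSign.mul_self, one_smul]
    rfl

/-- With the twist moved to the target, `f` becomes a class in the cohomology of the dual of `P` in
degree `g - h`. -/
lemma hom_twist_eq_zero (hP : P.KProjective) {g h : G} (H : P.dual.ExactAt (g - h)) (n : ℤ)
    (f : toD (P.twist (-g)) ⟶ (toD (free Γ (-h)))⟦n⟧) : f = 0 := by
  obtain ⟨f', hf'⟩ := (hP.twist (-g)).exists_map (f ≫ (toDShift (free Γ (-h)) n).inv)
  refine (cancel_mono (toDShift (free Γ (-h)) n).inv).1 (hf'.symm.trans (Eq.trans ?_ zero_comp.symm))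
  refine ((hP.twist (-g)).map_eq_zero_iff f').2 (mem_nullHomotopic_of_twist (fun f'' ↦ ?_) f')
  exact mem_nullHomotopic_of_exactAt_dual (by rwa [neg_neg, neg_add_eq_sub]) f''

/-! ### Duals of perfect dg modules -/

lemma toDer_map_eq_zero {f : M ⟶ N} (hf : f ∈ nullHomotopic M N) : (toDer Γ).map f = 0 :=
  (congrArg (verdierQ (acyclic Γ)).map ((toHo_map_eq_zero_iff f).2 hf)).trans
    ((verdierQ (acyclic Γ)).map_zero _ _)

/-- The objects of the derived category with a K-projective resolution whose dual belongs to
a given full subcategory. -/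
def dualProp (T : ObjectProperty (Derived Γ.op)) : ObjectProperty (Derived Γ) :=
  fun X ↦ ∃ P : DGMod Γ, P.KProjective ∧ Nonempty (toD P ≅ X) ∧ T (toD P.dual)

/-- Dualizing makes sense for maps of dg modules and their homotopies. K-projectivity represents the
retraction by such maps, whose composite is homotopic to the identity. -/
lemma KProjective.dual_of_retract {T : ObjectProperty (Derived Γ.op)} [T.IsStableUnderRetracts]
    (hP : P.KProjective) (hQ : Q.KProjective)
    (r : Retract (toD P) (toD Q)) (h : T (toD Q.dual)) : T (toD P.dual) := by
  obtain ⟨i, hi⟩ := hP.exists_map r.i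
  obtain ⟨p, hp⟩ := hQ.exists_map r.r
  have h₀ : i ≫ p - 𝟙 P ∈ nullHomotopic P P := by
    rw [← hP.map_eq_zero_iff, CategoryTheory.Functor.map_sub, CategoryTheory.Functor.map_comp, hi,
      hp, CategoryTheory.Functor.map_id, sub_eq_zero]
    exact r.retract
  have h₁ := toDer_map_eq_zero (dualMap_mem_nullHomotopic h₀)
  rw [dualMap_sub, CategoryTheory.Functor.map_sub, sub_eq_zero, dualMap_comp, dualMap_id,
    CategoryTheory.Functor.map_comp, CategoryTheory.Functor.map_id] at h₁
  exact T.prop_of_retract ⟨(toDer Γ.op).map (dualMap p), (toDer Γ.op).map (dualMap i), h₁⟩ h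

lemma KProjective.shiftObj (hP : P.KProjective) (n : ℤ) : (P.shiftObj n).KProjective :=
  (kProjective_iff _).2 ((acyclic Γ).leftOrthogonal.prop_of_iso
    (((toHo Γ).commShiftIso n).app P).symm
    ((acyclic Γ).leftOrthogonal.le_shift n _ ((kProjective_iff P).1 hP)))

lemma KProjective.cone (hP : P.KProjective) (hQ : Q.KProjective) (f : P ⟶ Q) :
    (cone f).KProjective :=
  (kProjective_iff _).2 (ObjectProperty.prop₃_of_distTriang (coneTriangle_mem f)
    ((kProjective_iff P).1 hP) ((kProjective_iff Q).1 hQ))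

/-- The triangle of the duals of the dg modules in a mapping cone triangle. -/
lemma exists_distTriang_dual (f : P ⟶ Q) :
    ∃ (k : toD P.dual ⟶ (toD (DGMod.cone f).dual)⟦(1 : ℤ)⟧) (l : _ ⟶ (toD Q.dual)⟦(1 : ℤ)⟧),
      Triangle.mk ((toDer Γ.op).map (dualMap f)) k l ∈ distTriang (Derived Γ.op) := by
  exact exists_distTriang_of_iso₃ (distTriang_map (verdierQ (acyclic Γ.op))
    (coneTriangle_mem (dualMap f))) ((toDer Γ.op).mapIso (dualConeIso f) ≪≫ toDShift _ 1)

variable {T : ObjectProperty (Derived Γ.op)} [T.IsTriangulated] [T.IsStableUnderRetracts]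

instance : (dualProp T).IsStableUnderRetracts where
  of_retract {X Y} r := by
    rintro ⟨Q, hQ, ⟨e⟩, h⟩
    obtain ⟨P, hP, ⟨e'⟩⟩ := (resolved_iff X).1 ((resolved Γ).prop_of_retract r
      ((resolved_iff Y).2 ⟨Q, hQ, ⟨e⟩⟩))
    exact ⟨P, hP, ⟨e'⟩, hP.dual_of_retract hQ
      ((Retract.ofIso e').trans (r.trans (Retract.ofIso e.symm))) h⟩

instance : (dualProp T).IsTriangulated where
  exists_zero := ⟨toD (zeroMod Γ), (toDer Γ).map_isZero (isZero_zeroMod Γ),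
    zeroMod Γ,
    fun _ _ f ↦ (isZero_zeroMod Γ).eq_of_src 0 f ▸ zero_mem _, ⟨Iso.refl _⟩,
    T.prop_of_isZero ((toDer Γ.op).map_isZero ((IsZero.iff_id_eq_zero _).2 (by
      rw [← dualMap_id, (isZero_zeroMod Γ).eq_of_src (𝟙 _) (𝟙 _ - 𝟙 _), dualMap_sub, sub_self])))⟩
  isStableUnderShiftBy n := ⟨by
    rintro X ⟨P, hP, ⟨e⟩, h⟩
    exact ⟨P.shiftObj n, hP.shiftObj n, ⟨toDShift P n ≪≫ (shiftFunctor _ n).mapIso e⟩,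
      T.prop_of_iso ((toDShift P.dual (-n)).symm ≪≫ (toDer Γ.op).mapIso (dualShiftIso P n))
        (T.le_shift (-n) _ h)⟩⟩
  toIsTriangulatedClosed₂ := isTriangulatedClosed₂_of (by
    rintro X Y Z f g k hT ⟨P, hP, ⟨e⟩, h⟩ ⟨Q, hQ, ⟨e'⟩, h'⟩
    -- `Y` is the cone of the map from `Z⟦-1⟧` to `X`. Represented by a map `φ` of K-projective
    -- modules, this gives the K-projective resolution `cone φ` of `Y`, whose dual sits in a
    -- triangle with the other two duals.
    obtain ⟨δ, k', hδ⟩ := exists_fiber hT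
    let e'' : toD (Q.shiftObj (-1)) ≅ Z⟦(-1 : ℤ)⟧ :=
      toDShift Q (-1) ≪≫ (shiftFunctor _ (-1 : ℤ)).mapIso e'
    obtain ⟨φ, hφ⟩ := (hQ.shiftObj (-1)).exists_map (e''.hom ≫ δ ≫ e.inv)
    have hc := distTriang_map (verdierQ (acyclic Γ)) (coneTriangle_mem φ)
    refine ⟨DGMod.cone φ, (hQ.shiftObj (-1)).cone hP φ,
      ⟨Triangle.π₃.mapIso (isoTriangleOfIso₁₂ _ _ hc hδ e'' e ?_)⟩, ?_⟩
    · change (toDer Γ).map φ ≫ e.hom = e''.hom ≫ δ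
      have h₁ : (e''.hom ≫ δ ≫ e.inv) ≫ e.hom = e''.hom ≫ δ := by simp
      exact (congrArg (· ≫ e.hom) hφ).trans h₁
    · obtain ⟨k, l, hd⟩ := exists_distTriang_dual φ
      have h₁ : T (toD (Q.shiftObj (-1)).dual) := T.prop_of_iso
        ((toDShift Q.dual (- -1)).symm ≪≫ (toDer Γ.op).mapIso (dualShiftIso Q (-1)))
        (T.le_shift (- -1) _ h')
      exact (T.prop_shift_iff_of_isStableUnderShift _ (1 : ℤ)).1
        (ObjectProperty.prop₃_of_distTriang hd h h₁))

/-- The dual of a perfect dg module is perfect. -/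
lemma per_le_dualProp (I : Set G) : Γ.per I ≤ dualProp (Γ.op.per ((fun g ↦ -g) '' I)) :=
  thick_le (by
    rintro _ ⟨g, hg, rfl⟩
    exact ⟨free Γ (-g), kProjective_free _, ⟨Iso.refl _⟩,
      (Γ.op.per _).prop_of_iso ((toDer Γ.op).mapIso (dualFreeIso Γ (-g))).symm
        (thickOn_toD_twist (regular Γ.op) ⟨g, hg, rfl⟩)⟩)

/-! ### Consequences of the Gorenstein property -/

variable [PartialOrder G] [IsOrderedAddMonoid G] {hΓ : Γ.IsNonneg} {p : G}

/-- If `P` is a K-projective resolution of `Γ_0`, the morphisms from `Γ_0(-g)` to shifts of `Γ(-l)`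
are controlled by the cohomology of the dual of `P` in degree `g - l`, which vanishes unless `g - l
= -p`. -/
lemma hom_degreeZero_per_eq_zero (hD : Γ.per Set.univ (toD (degreeZero Γ hΓ)))
    (hp : Γ.HasGorensteinParameter p) {I J : Set G} (h : ∀ g ∈ I, ∀ l ∈ J, l ≠ g + p)
    ⦃X Y : Derived Γ⦄ (hX : thickOn (degreeZero Γ hΓ) I X) (hY : Γ.per J Y) (f : X ⟶ Y) : f = 0 := by
  obtain ⟨P, hP, ⟨e⟩⟩ := (resolved_iff _).1 (per_le_resolved _ _ hD)
  have hP' : P.SupportedOn {0} := fun g hg ↦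
    exactAt_of_iso ((toDer Γ).mapIso (twistNegZero _) ≪≫ e.symm) (exactAt_degreeZero hΓ hg)
  refine thick_hom_eq_zero ?_ hX hY f
  rintro _ _ ⟨g, hg, rfl⟩ ⟨l, hl, rfl⟩ n f
  let e' : toD (P.twist (-g)) ≅ toD ((degreeZero Γ hΓ).twist (-g)) :=
    (mapDerivedObj (twistFunctor Γ (-g)) P).symm ≪≫ (mapDerived (twistFunctor Γ (-g))).mapIso e ≪≫
      mapDerivedObj (twistFunctor Γ (-g)) (degreeZero Γ hΓ)
  refine (cancel_epi e'.hom).1 ((hom_twist_eq_zero hP (hp P hP hP' _ fun e ↦ h g hg l hl ?_) n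
    (e'.hom ≫ f)).trans comp_zero.symm)
  rw [eq_add_neg_iff_add_eq.1 ((sub_eq_iff_eq_add.1 e).trans (add_comm _ _))]

/-- Obtained by dualizing, over the opposite ring, the triangle of `C`, the regular module and the
degree zero part. The dual of a free module is free, that of `C`, built from degrees `> 0`, is built
from degrees `< 0`, and that of the degree zero part is perfect with cohomology in degree `-p`. -/
lemma exists_distTriang_of_gorenstein (hD : Γ.op.per Set.univ (toD (degreeZero Γ.op hΓ.op)))
    (hp : Γ.op.HasGorensteinParameter p) :
    ∃ (S Y : Derived Γ) (f : S ⟶ toD (free Γ (-0))) (k : toD (free Γ (-0)) ⟶ Y)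
      (l : Y ⟶ S⟦(1 : ℤ)⟧), Triangle.mk f k l ∈ distTriang (Derived Γ) ∧
      Γ.per Set.univ S ∧ Γ.per (Set.Iio 0) Y ∧
      ∀ g ≠ -p, ∀ (n : ℤ) (f : toD (free Γ (-g)) ⟶ S⟦n⟧), f = 0 := by
  -- The duals are modules over the double opposite; with a variable ring, the equality with `Γ` can
  -- be substituted once for the whole statement.
  suffices key : ∀ Γ' : DGRing G, Γ' = Γ.op.op →
      ∃ (S Y : Derived Γ') (f : S ⟶ toD (free Γ' (-0))) (k : toD (free Γ' (-0)) ⟶ Y)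
        (l : Y ⟶ S⟦(1 : ℤ)⟧), Triangle.mk f k l ∈ distTriang (Derived Γ') ∧
        Γ'.per Set.univ S ∧ Γ'.per (Set.Iio 0) Y ∧
        ∀ g ≠ -p, ∀ (n : ℤ) (f : toD (free Γ' (-g)) ⟶ S⟦n⟧), f = 0 from key Γ Γ.op_op.symm
  rintro _ rfl
  obtain ⟨C, f, k, l, hT, hC⟩ := exists_distTriang_degreeZero hD 0
  obtain ⟨Q, hQ, ⟨e⟩, h⟩ := per_le_dualProp _ _ hC
  obtain ⟨φ, hφ⟩ := hQ.exists_map (e.hom ≫ f)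
  have hc := distTriang_map (verdierQ (acyclic Γ.op)) (coneTriangle_mem φ)
  -- The cone of the lift `φ` is a K-projective resolution of the degree zero part, so the
  -- Gorenstein condition applies to it.
  let e' : toD (cone φ) ≅ toD ((degreeZero Γ.op hΓ.op).twist (-0)) :=
    Triangle.π₃.mapIso (isoTriangleOfIso₁₂ _ _ hc hT e (Iso.refl _)
      ((Category.comp_id _).trans hφ))
  have hS := hp (cone φ) (hQ.cone (kProjective_free _) φ)
    (fun g hg ↦ exactAt_of_iso e'.symm (exactAt_degreeZero hΓ.op hg))
  obtain ⟨k', l', hd⟩ := exists_distTriang_dual φ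
  let e₀ : toD (free Γ.op (-0)).dual ≅ toD (free Γ.op.op (-0)) :=
    (toDer Γ.op.op).mapIso (dualFreeIso Γ.op (-0) ≪≫ eqToIso (by rw [neg_neg, neg_zero]))
  have h₀ : Γ.op.op.per Set.univ ((toD (cone φ).dual)⟦(1 : ℤ)⟧) :=
    ObjectProperty.prop₃_of_distTriang hd
      ((Γ.op.op.per _).prop_of_iso e₀.symm (thickOn_toD_twist (regular Γ.op.op) trivial))
      (thickOn_mono _ (Set.subset_univ _) _ h)
  obtain ⟨δ, k₁, hδ⟩ := exists_fiber hd
  obtain ⟨f₂, k₂, l₂, h₂⟩ := exists_distTriang_of_iso hδ (Iso.refl _) e₀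
  refine ⟨_, _, f₂, k₂, l₂, h₂, (Γ.op.op.per _).le_shift (-1) _ h₀, thickOn_mono _ ?_ _ h,
    fun g hg n f ↦ ?_⟩
  · rintro _ ⟨g, hg, rfl⟩
    exact neg_neg_of_pos hg
  · exact (cancel_mono (((shiftShiftNeg (toD (cone φ).dual) (1 : ℤ)).hom)⟦n⟧')).1
      (((free_hom_eq_zero_iff g _).2 (hS g hg) n _).trans zero_comp.symm)

/-- The shifts of the canonical triangle obtained from the Gorenstein property. -/
lemma exists_distTriang_free (hD : Γ.per Set.univ (toD (degreeZero Γ hΓ)))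
    (hD' : Γ.op.per Set.univ (toD (degreeZero Γ.op hΓ.op)))
    (hp : Γ.op.HasGorensteinParameter p) (g : G) :
    ∃ (S Y : Derived Γ) (f : S ⟶ toD (free Γ (-g))) (k : toD (free Γ (-g)) ⟶ Y)
      (l : Y ⟶ S⟦(1 : ℤ)⟧), Triangle.mk f k l ∈ distTriang (Derived Γ) ∧
      thickOn (degreeZero Γ hΓ) {g - p} S ∧ Γ.per (Set.Iio g) Y := by
  obtain ⟨S, Y, f, k, l, hT, hS, hY, h⟩ := exists_distTriang_of_gorenstein (hΓ := hΓ) hD' hp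
  obtain ⟨f', k', l', hT'⟩ := exists_distTriang_of_iso
    (distTriang_map (mapDerived (twistFunctor Γ (-g))) hT) (Iso.refl _)
    (mapDerivedObj (twistFunctor Γ (-g)) (free Γ (-0)) ≪≫
      (toDer Γ).mapIso ((twistFunctor Γ (-g)).mapIso (regular Γ).twistNegZero))
  refine ⟨_, _, f', k', l', hT', thickOn_mono _ ?_ _
    (thickOn_twist (thickOn_degreeZero_singleton hD hS h) g), thickOn_mono _ ?_ _
    (thickOn_twist hY g)⟩
  · rw [Set.image_singleton, neg_add_eq_sub]
  · rintro _ ⟨h, hh, rfl⟩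
    exact add_lt_of_neg_left g hh

/-- The semi-orthogonal decomposition of `per^G Γ` into `thick^I Γ_0` and `per^(Iᶜ + p) Γ`. -/
lemma per_univ_le_thickOn_degreeZero (hD : Γ.per Set.univ (toD (degreeZero Γ hΓ)))
    (hD' : Γ.op.per Set.univ (toD (degreeZero Γ.op hΓ.op)))
    (hp : Γ.HasGorensteinParameter p) (hp' : Γ.op.HasGorensteinParameter p) {I : Set G}
    (hI : IsUpperSet I) (hfin : ∀ g, {h | h ≤ g ∧ h - p ∈ I}.Finite) : Γ.per Set.univ ≤
      (thickOn (degreeZero Γ hΓ) I).extensionProduct (Γ.per {h | h - p ∉ I}) := by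
  have h₀ : ∀ ⦃X Y⦄, thickOn (degreeZero Γ hΓ) I X → Γ.per {h | h - p ∉ I} Y →
      ∀ f : X ⟶ Y, f = 0 :=
    hom_degreeZero_per_eq_zero hD hp (by rintro g hg _ hl rfl; simp [hg] at hl)
  have := ObjectProperty.isTriangulated_extensionProduct h₀
  have := ObjectProperty.isStableUnderRetracts_extensionProduct h₀
    ((splitsIdempotents_per I).mono (thickOn_degreeZero_le_per hD hI))
  -- Induction on the number of `h ≤ g` with `h - p ∈ I`. If `g - p ∈ I`, the triangle with first
  -- term in `thick^{g-p} Γ_0` leads to elements below `g`, and `g` itself leaves the count.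
  suffices key : ∀ (n : ℕ) (g : G), {h | h ≤ g ∧ h - p ∈ I}.ncard = n →
      (thickOn (degreeZero Γ hΓ) I).extensionProduct (Γ.per {h | h - p ∉ I}) (toD (free Γ (-g))) from
    thick_le (by rintro _ ⟨g, -, rfl⟩; exact key _ g rfl)
  intro n
  induction n using Nat.strong_induction_on with
  | _ n ih =>
    rintro g rfl
    by_cases hg : g - p ∈ I
    · obtain ⟨S, Y, f, k, l, hT, hS, hY⟩ := exists_distTriang_free hD hD' hp' g
      refine ObjectProperty.prop₂_of_distTriang hT (ObjectProperty.le_extensionProduct_left _ _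
        (thickOn_mono _ (Set.singleton_subset_iff.2 hg) _ hS)) (thick_le ?_ _ hY)
      rintro _ ⟨h, hh, rfl⟩
      refine ih _ (Set.ncard_lt_ncard ?_ (hfin g)) h rfl
      exact ⟨fun x hx ↦ ⟨hx.1.trans hh.le, hx.2⟩, fun H ↦ hh.not_ge (H ⟨le_rfl, hg⟩).1⟩
    · exact ObjectProperty.le_extensionProduct_right _ _
        (thickOn_toD_twist (I := {h | h - p ∉ I}) _ hg)

end DGMod

end

/-! ### Reflection of upper sets -/

section

variable {G : Type u} [AddCommGroup G] {I : Set G} {p : G}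

/-- The image of the complement of `I` under the reflection `x ↦ -x - p`. -/
def reflect (I : Set G) (p : G) : Set G := {x | -x - p ∉ I}

lemma reflect_nonempty (h : I ≠ Set.univ) : (reflect I p).Nonempty := by
  obtain ⟨x, hx⟩ := (Set.ne_univ_iff_exists_notMem I).1 h
  exact ⟨-x - p, by simpa [reflect] using hx⟩

lemma reflect_ne_univ (h : I.Nonempty) : reflect I p ≠ Set.univ := by
  obtain ⟨x, hx⟩ := h
  exact (Set.ne_univ_iff_exists_notMem _).2 ⟨-x - p, by simpa [reflect] using hx⟩

lemma upperGap_eq : upperGap I p = I ∩ {h | h - p ∉ I} := by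
  ext h
  refine and_congr_right fun _ ↦ ⟨?_, fun h' ↦ ⟨h - p, h', sub_add_cancel h p⟩⟩
  rintro ⟨x, hx, rfl⟩
  simpa using hx

/-- The reflection exchanges the two defining conditions: `h` is in the reflected set when `-h - p ∉
I`, and `h - p` is not when `-h ∈ I`. This makes the negated index set another instance of the
construction. -/
lemma upperGap_reflect : upperGap (reflect I p) p = (fun g ↦ -g) '' upperGap I p := by
  ext h
  rw [Set.image_neg_eq_neg, Set.mem_neg, upperGap_eq, upperGap_eq]
  simp [reflect, and_comm]

lemma isUpperSet_reflect [PartialOrder G] [IsOrderedAddMonoid G] (hI : IsUpperSet I) :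
    IsUpperSet (reflect I p) := fun _ _ h hx hy ↦ hx (hI (by gcongr) hy)

end

/-! ### Finiteness in a group of rank one -/

section

variable {G : Type u} [AddCommGroup G] [PartialOrder G] [IsOrderedAddMonoid G] {p : G}

lemma eq_zero_of_zsmul_eq_zero (hp : 0 < p) {n : ℤ} (h : n • p = 0) : n = 0 := by
  obtain h' | h' | h' := lt_trichotomy n 0
  · exact absurd h (smul_neg_of_neg_of_pos h' hp).ne
  · exact h'
  · exact absurd h (zsmul_pos hp h').ne'

variable [AddGroup.FG G]

/-- In rank one `x` and `p` are linearly dependent, and as `p` is not torsion the coefficient of `x`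
is nonzero. -/
lemma exists_zsmul_eq (hrank : Module.finrank ℤ G = 1) (hp : 0 < p) (x : G) :
    ∃ (m n : ℤ), m ≠ 0 ∧ m • x = n • p := by
  have : Module.Finite ℤ G := Module.Finite.iff_addGroup_fg.2 ‹_›
  by_contra! H
  have : LinearIndependent ℤ ![x, p] := LinearIndependent.pair_iff.2 fun s t h ↦ by
    have hs : s = 0 := by
      by_contra hs
      exact H s (-t) hs (by rw [neg_smul]; exact eq_neg_of_add_eq_zero_left h)
    subst hs
    rw [zero_smul, zero_add] at h
    exact ⟨rfl, eq_zero_of_zsmul_eq_zero hp h⟩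
  have := this.fintype_card_le_finrank
  rw [hrank, Fintype.card_fin] at this
  omega

lemma finite_quotient_zmultiples (hrank : Module.finrank ℤ G = 1) (hp : 0 < p) :
    Finite (G ⧸ AddSubgroup.zmultiples p) := by
  have : Module.Finite ℤ G := Module.Finite.iff_addGroup_fg.2 ‹_›
  have : Module.Finite ℤ (G ⧸ AddSubgroup.zmultiples p) :=
    Module.Finite.of_surjective (QuotientAddGroup.mk' (AddSubgroup.zmultiples p)).toIntLinearMap
      (QuotientAddGroup.mk'_surjective _)
  refine Module.finite_of_fg_torsion _ fun x ↦ ?_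
  induction x using QuotientAddGroup.induction_on with
  | _ x =>
    obtain ⟨m, n, hm, h⟩ := exists_zsmul_eq hrank hp x
    refine ⟨⟨m, mem_nonZeroDivisors_of_ne_zero hm⟩, ?_⟩
    exact (QuotientAddGroup.eq_zero_iff (m • x)).2 ⟨n, h.symm⟩

/-- A generator `a ≥ 0` satisfies `m • a = n • p` with `m ≠ 0`, so `a ≤ |m| • a ≤ |n| • p`. Such
bounds add up, and the group is generated by these elements. -/
lemma exists_le_nsmul (hrank : Module.finrank ℤ G = 1)
    (hG : AddSubgroup.closure {g : G | 0 ≤ g} = ⊤) (hp : 0 < p) (x : G) : ∃ k : ℕ, x ≤ k • p := by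
  -- Bounding `-x` as well lets the induction pass through inverses.
  suffices h : ∃ k : ℕ, x ≤ k • p ∧ -x ≤ k • p from h.imp fun _ h ↦ h.1
  have hx : x ∈ AddSubgroup.closure {g : G | 0 ≤ g} := hG ▸ trivial
  induction hx using AddSubgroup.closure_induction with
  | mem a ha =>
    obtain ⟨m, n, hm, h⟩ := exists_zsmul_eq hrank hp a
    have h₁ : |m| • a ≤ |n| • p := by
      obtain e | e := abs_choice m <;> rw [e]
      · rw [h]; exact zsmul_le_zsmul_left hp.le (le_abs_self n)
      · rw [neg_smul, h, ← neg_smul]; exact zsmul_le_zsmul_left hp.le (neg_le_abs n)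
    refine ⟨n.natAbs, ?_, (neg_nonpos.2 ha).trans (nsmul_nonneg hp.le _)⟩
    rw [← natCast_zsmul, Int.natCast_natAbs]
    refine le_trans ?_ h₁
    simpa using zsmul_le_zsmul_left ha (show 1 ≤ |m| from Int.one_le_abs hm)
  | zero => exact ⟨0, by simp⟩
  | add x y _ _ hx hy =>
    obtain ⟨k, hk, hk'⟩ := hx
    obtain ⟨l, hl, hl'⟩ := hy
    refine ⟨k + l, ?_, ?_⟩
    · rw [add_nsmul]; exact add_le_add hk hl
    · rw [add_nsmul, neg_add]; exact add_le_add hk' hl'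
  | neg x _ hx =>
    obtain ⟨k, hk, hk'⟩ := hx
    exact ⟨k, hk', by rwa [neg_neg]⟩

variable {I : Set G}

/-- There are finitely many cosets of `ℤp`. In the coset of `x`, the element `x + n • p` lies above
a fixed `a ∈ I` once `n ≥ k`, and fails to lie above `g` once `n < -l`. -/
lemma finite_le_notMem (hrank : Module.finrank ℤ G = 1)
    (hG : AddSubgroup.closure {g : G | 0 ≤ g} = ⊤) (hp : 0 < p) (hI : IsUpperSet I)
    (hI' : I.Nonempty) (g : G) : {h | g ≤ h ∧ h ∉ I}.Finite := by
  have := finite_quotient_zmultiples hrank hp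
  obtain ⟨a, ha⟩ := hI'
  refine Set.Finite.of_finite_fibers (QuotientAddGroup.mk (s := AddSubgroup.zmultiples p))
    (Set.toFinite _) ?_
  rintro _ ⟨x, -, rfl⟩
  obtain ⟨k, hk⟩ := exists_le_nsmul hrank hG hp (a - x)
  obtain ⟨l, hl⟩ := exists_le_nsmul hrank hG hp (x - g)
  refine ((Set.finite_Icc (-l : ℤ) k).image (fun n ↦ x + n • p)).subset ?_
  rintro y ⟨⟨hy, hy'⟩, e⟩
  obtain ⟨n, hn⟩ : ∃ n : ℤ, n • p = -x + y := QuotientAddGroup.eq.1 (Eq.symm e)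
  have hn' : x + n • p = y := by rw [hn]; abel
  refine ⟨n, ⟨?_, ?_⟩, hn'⟩
  · by_contra! H
    have h₁ : (l + n) • p < 0 := smul_neg_of_neg_of_pos (by omega) hp
    rw [add_smul, natCast_zsmul, hn] at h₁
    have : (0 : G) ≤ y - g := sub_nonneg.2 hy
    have h₂ : y - g ≤ l • p + (-x + y) := by
      calc y - g = (x - g) + (-x + y) := by abel
        _ ≤ _ := by gcongr
    exact (this.trans h₂).not_gt h₁
  · by_contra! H
    refine hy' (hI ?_ ha)
    calc a = x + (a - x) := by abel
      _ ≤ x + (k : ℤ) • p := by rw [natCast_zsmul]; gcongr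
      _ ≤ x + n • p := by gcongr
      _ = y := hn'

/-- Negation turns this into the preceding finiteness for the reflected upper set. -/
lemma finite_ge_mem (hrank : Module.finrank ℤ G = 1)
    (hG : AddSubgroup.closure {g : G | 0 ≤ g} = ⊤) (hp : 0 < p) (hI : IsUpperSet I)
    (hI' : I ≠ Set.univ) (g : G) : {h | h ≤ g ∧ h - p ∈ I}.Finite := by
  refine ((finite_le_notMem hrank hG hp (isUpperSet_reflect hI (p := p)) (reflect_nonempty hI')
    (-g)).image (fun x ↦ -x)).subset ?_
  rintro h ⟨h₁, h₂⟩
  exact ⟨-h, ⟨neg_le_neg h₁, by simpa [reflect] using h₂⟩, neg_neg h⟩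

/-- Each of the finitely many cosets of `ℤp` meets the set at most once: if `x ∈ I` and `y = x + n •
p` with `n ≥ 1`, then `y - p ≥ x` lies in `I`. -/
lemma finite_upperGap (hrank : Module.finrank ℤ G = 1) (hp : 0 < p) (hI : IsUpperSet I) :
    (upperGap I p).Finite := by
  have := finite_quotient_zmultiples hrank hp
  rw [upperGap_eq]
  refine Set.Finite.of_injOn (f := QuotientAddGroup.mk (s := AddSubgroup.zmultiples p))
    (t := Set.univ) (fun _ _ ↦ trivial) ?_ (Set.toFinite _)
  have key : ∀ x ∈ I, ∀ y, y - p ∉ I → ∀ n : ℤ, n • p = -x + y → n ≤ 0 := by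
    intro x hx y hy n hn
    by_contra! H
    refine hy (hI ?_ hx)
    have h₁ : y - p = x + (n - 1) • p := by rw [sub_smul, hn, one_smul]; abel
    rw [h₁]
    exact le_add_of_nonneg_right (zsmul_nonneg hp.le (by omega))
  rintro x ⟨hx, hx'⟩ y ⟨hy, hy'⟩ e
  obtain ⟨n, hn⟩ : ∃ n : ℤ, n • p = -x + y := QuotientAddGroup.eq.1 e
  have h₁ := key x hx y hy' n hn
  have h₂ := key y hy x hx' (-n) (by rw [neg_smul, hn]; abel)
  obtain rfl : n = 0 := by omega
  rw [zero_smul] at hn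
  exact (neg_add_eq_zero.1 hn.symm)

/-! ### The semi-orthogonal decomposition and the cluster category -/

open CategoryTheory.ObjectProperty DGMod

variable {G : Type u} [AddCommGroup G] [PartialOrder G] [IsOrderedAddMonoid G] {Γ : DGRing G}
  {hΓ : Γ.IsNonneg} {I : Set G} {p : G}

lemma hom_thickOn_degreeZero_eq_zero (hD : Γ.per Set.univ (toD (degreeZero Γ hΓ)))
    (hI : IsUpperSet I) ⦃X Y : Derived Γ⦄ (hX : thickOn (degreeZero Γ hΓ) I X)
    (hY : thickOn (degreeZero Γ hΓ) Iᶜ Y) (f : X ⟶ Y) : f = 0 :=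
  hom_degreeZero_eq_zero disjoint_compl_right (thickOn_degreeZero_le_per hD hI _ hX) hY f

lemma hom_thickOn_per_upperGap_eq_zero (hD : Γ.per Set.univ (toD (degreeZero Γ hΓ)))
    (hp : Γ.HasGorensteinParameter p) ⦃X Y : Derived Γ⦄ (hX : thickOn (degreeZero Γ hΓ) I X)
    (hY : Γ.per (upperGap I p) Y) (f : X ⟶ Y) : f = 0 :=
  hom_degreeZero_per_eq_zero hD hp (by
    rintro g hg l hl rfl
    rw [upperGap_eq] at hl
    exact hl.2 (by simpa using hg)) hX hY f

lemma hom_per_upperGap_eq_zero ⦃X Y : Derived Γ⦄ (hX : Γ.per (upperGap I p) X)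
    (hY : thickOn (degreeZero Γ hΓ) Iᶜ Y) (f : X ⟶ Y) : f = 0 :=
  hom_degreeZero_eq_zero (disjoint_compl_right.mono_left Set.inter_subset_left) hX hY f

/-- The two triangles which decompose a perfect dg module. -/
lemma exists_decomposition (hD : Γ.DegreeZeroPerfect hΓ)
    (hp : Γ.HasGorensteinParameter p) (hp' : Γ.op.HasGorensteinParameter p) (hI : IsUpperSet I)
    (hfin : ∀ g, {h | g ≤ h ∧ h ∉ I}.Finite) (hfin' : ∀ g, {h | h ≤ g ∧ h - p ∈ I}.Finite)
    {E : Derived Γ} (hE : Γ.per Set.univ E) :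
    ∃ (X S Y T : Derived Γ) (f : X ⟶ E) (g : E ⟶ T) (k : T ⟶ X⟦(1 : ℤ)⟧) (f' : S ⟶ X) (g' : X ⟶ Y)
      (k' : Y ⟶ S⟦(1 : ℤ)⟧), Triangle.mk f g k ∈ distTriang (Derived Γ) ∧
      Triangle.mk f' g' k' ∈ distTriang (Derived Γ) ∧ thickOn (degreeZero Γ hΓ) I S ∧
      Γ.per (upperGap I p) Y ∧ thickOn (degreeZero Γ hΓ) Iᶜ T := by
  obtain ⟨X, T, f, g, k, hT, hX, hT'⟩ := per_univ_le hD.1 hfin _ hE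
  obtain ⟨S, Y, f', g', k', hS, hS', hY⟩ := per_univ_le_thickOn_degreeZero hD.1 hD.2 hp hp' hI hfin' _
    (thickOn_mono _ (Set.subset_univ _) _ hX)
  refine ⟨X, S, Y, T, f, g, k, f', g', k', hT, hS, hS', ?_, hT'⟩
  rw [upperGap_eq, Set.inter_comm]
  -- `S` and `X` lie in `per^I Γ`, hence so does `Y`, which thus has no cohomology outside `I`.
  -- Being also generated in degrees `h` with `h - p ∉ I`, it is generated in the intersection.
  have hY' : Γ.per I Y := prop₃_of_distTriang hS (thickOn_degreeZero_le_per hD.1 hI _ hS') hX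
  exact per_inter_of_hom_eq_zero hΓ hI hY fun g hg ↦ shift_hom_eq_zero
    (hom_per_eq_zero (I := Iᶜ) hΓ fun _ hg _ hl h ↦ hg (hI h hl)) hY' g hg.2

theorem isWeakSOD_per (hD : Γ.DegreeZeroPerfect hΓ)
    (hp : Γ.HasGorensteinParameter p) (hp' : Γ.op.HasGorensteinParameter p) (hI : IsUpperSet I)
    (hfin : ∀ g, {h | g ≤ h ∧ h ∉ I}.Finite) (hfin' : ∀ g, {h | h ≤ g ∧ h - p ∈ I}.Finite) :
    IsWeakSOD (Γ.per Set.univ) (thickOn (degreeZero Γ hΓ) I) (Γ.per (upperGap I p))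
      (thickOn (degreeZero Γ hΓ) Iᶜ) where
  isTriangulated₁ := inferInstance
  isTriangulated₂ := inferInstance
  isTriangulated₃ := inferInstance
  isStableUnderRetracts₁ := inferInstance
  isStableUnderRetracts₂ := inferInstance
  isStableUnderRetracts₃ := inferInstance
  hom_eq_zero₁₂ hX hY := hom_thickOn_per_upperGap_eq_zero hD.1 hp hX hY
  hom_eq_zero₁₃ hX hY := hom_thickOn_degreeZero_eq_zero hD.1 hI hX hY
  hom_eq_zero₂₃ hX hY := hom_per_upperGap_eq_zero hX hY
  eq_extensionProduct := by
    have h (J : Set G) : thickOn (degreeZero Γ hΓ) J ≤ Γ.per Set.univ :=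
      (thickOn_mono _ (Set.subset_univ _)).trans (thickOn_degreeZero_le_per hD.1 isUpperSet_univ)
    refine le_antisymm (fun E hE ↦ ?_) ?_
    · obtain ⟨X, S, Y, T, f, g, k, f', g', k', hT, hT', hS, hY, hT₀⟩ :=
        exists_decomposition hD hp hp' hI hfin hfin' hE
      exact ⟨_, _, _, _, _, hT, ⟨_, _, _, _, _, hT', hS, hY⟩, hT₀⟩
    · rintro E ⟨X, T, f, g, k, hT, ⟨S, Y, f', g', k', hT', hS, hY⟩, hT₀⟩
      exact prop₂_of_distTriang hT (prop₂_of_distTriang hT' (h _ _ hS)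
        (thickOn_mono _ (Set.subset_univ _) _ hY)) (h _ _ hT₀)

instance (J : Set G) : (Γ.perToCluster hΓ J).IsTriangulated := inferInstance

instance (J : Set G) : (Γ.perInclusion J).Full :=
  inferInstanceAs ((Γ.per Set.univ).lift (Γ.per J).ι _).Full

instance (J : Set G) : (Γ.perInclusion J).Faithful :=
  inferInstanceAs ((Γ.per Set.univ).lift (Γ.per J).ι _).Faithful

/-- A triangle of perfect dg modules is distinguished in the category of perfect dg modules. -/
lemma exists_distTriang_fullSubcategory {C : Type*} [Category C] [HasZeroObject C] [HasShift C ℤ]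
    [Preadditive C] [∀ n : ℤ, (shiftFunctor C n).Additive] [Pretriangulated C]
    {P : ObjectProperty C} [P.IsTriangulated] {X Y Z : C} {f : X ⟶ Y} {g : Y ⟶ Z}
    {k : Z ⟶ X⟦(1 : ℤ)⟧} (hT : Triangle.mk f g k ∈ distTriang C) (hX : P X) (hY : P Y) (hZ : P Z) :
    ∃ k' : (⟨Z, hZ⟩ : P.FullSubcategory) ⟶ (⟨X, hX⟩ : P.FullSubcategory)⟦(1 : ℤ)⟧,
      Triangle.mk (homMk f : (⟨X, hX⟩ : P.FullSubcategory) ⟶ ⟨Y, hY⟩)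
        (homMk g : _ ⟶ (⟨Z, hZ⟩ : P.FullSubcategory)) k' ∈ distTriang P.FullSubcategory := by
  obtain ⟨k₀, rfl⟩ : ∃ k₀ : Z ⟶ P.ι.obj ((⟨X, hX⟩ : P.FullSubcategory)⟦(1 : ℤ)⟧),
      k = k₀ ≫ (P.ι.commShiftIso (1 : ℤ)).hom.app ⟨X, hX⟩ :=
    ⟨k ≫ (P.ι.commShiftIso (1 : ℤ)).inv.app ⟨X, hX⟩,
      ((Category.assoc _ _ _).trans ((congrArg (k ≫ ·) (Iso.inv_hom_id_app
        (P.ι.commShiftIso (1 : ℤ)) ⟨X, hX⟩)).trans (Category.comp_id k))).symm⟩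
  exact ⟨homMk k₀, hT⟩

/-- Full faithfulness holds because `thick^G Γ_0` is an extension of a part receiving nothing from
`per^J(I) Γ` by a part mapping trivially to it; essential surjectivity comes from the decomposition
of perfect objects. -/
theorem perToCluster_isEquivalence (hD : Γ.DegreeZeroPerfect hΓ)
    (hp : Γ.HasGorensteinParameter p) (hp' : Γ.op.HasGorensteinParameter p) (hI : IsUpperSet I)
    (hfin : ∀ g, {h | g ≤ h ∧ h ∉ I}.Finite) (hfin' : ∀ g, {h | h ≤ g ∧ h - p ∈ I}.Finite) :
    (Γ.perToCluster hΓ (upperGap I p)).IsEquivalence := by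
  have h (J : Set G) : thickOn (degreeZero Γ hΓ) J ≤ Γ.per Set.univ :=
    (thickOn_mono _ (Set.subset_univ _)).trans (thickOn_degreeZero_le_per hD.1 isUpperSet_univ)
  let N (J : Set G) : ObjectProperty Γ.Per := (thickOn (degreeZero Γ hΓ) J).inverseImage (Γ.per Set.univ).ι
  have hN : Γ.thickDegreeZero hΓ ≤ (N I).extensionProduct (N Iᶜ) := by
    rintro ⟨E, hE⟩ hE'
    obtain ⟨X, T, f, g, k, hT, hX, hT'⟩ := thickOn_degreeZero_univ_le hD.1 hI _ hE'
    obtain ⟨k', hk⟩ := exists_distTriang_fullSubcategory hT (h _ _ hX) hE (h _ _ hT')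
    exact ⟨_, _, _, _, _, hk, hX, hT'⟩
  have hN₁ : N I ≤ Γ.thickDegreeZero hΓ := fun X hX ↦ thickOn_mono _ (Set.subset_univ I) _ hX
  have h₁ ⦃X : Γ.Per⦄ (hX : N I X) (Y : (Γ.per (upperGap I p)).FullSubcategory) (n : ℤ)
      (f : X ⟶ ((Γ.perInclusion _).obj Y)⟦n⟧) : f = 0 := by
    ext
    exact hom_thickOn_per_upperGap_eq_zero hD.1 hp hX ((Γ.per _).prop_of_iso
      (((Γ.per Set.univ).ι.commShiftIso n).app ((Γ.perInclusion _).obj Y)).symm ((Γ.per _).le_shift n _ Y.2)) f.hom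
  have h₁' ⦃X : Γ.Per⦄ (hX : N I X) (Y : (Γ.per (upperGap I p)).FullSubcategory)
      (f : X ⟶ (Γ.perInclusion _).obj Y) : f = 0 := by
    ext
    exact hom_thickOn_per_upperGap_eq_zero hD.1 hp hX Y.2 f.hom
  have h₂ ⦃X : Γ.Per⦄ (hX : N Iᶜ X) (Y : (Γ.per (upperGap I p)).FullSubcategory)
      (f : (Γ.perInclusion _).obj Y ⟶ X) : f = 0 := by
    ext
    exact hom_per_upperGap_eq_zero Y.2 hX f.hom
  have := verdierQ_comp_faithful (Γ.thickDegreeZero hΓ) (F := Γ.perInclusion (upperGap I p)) hN h₁' h₂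
  have := verdierQ_comp_full (Γ.thickDegreeZero hΓ) (F := Γ.perInclusion (upperGap I p)) hN hN₁ h₁ h₂
  -- The map from `X` to `E` has cone `T` and the map from `X` to `Y` has fibre `S`, both in
  -- `thick^G Γ_0`, so `E` and `Y` become isomorphic in the quotient.
  have := verdierQ_comp_essSurj (Γ.thickDegreeZero hΓ) (F := Γ.perInclusion (upperGap I p)) (by
    rintro ⟨E, hE⟩
    obtain ⟨X, S, Y, T, f, g, k, f', g', k', hT, hT', hS, hY, hT₀⟩ :=
      exists_decomposition hD hp hp' hI hfin hfin' hE
    have hY' := thickOn_mono _ (Set.subset_univ _) _ hY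
    have hX := prop₂_of_distTriang hT' (h _ _ hS) hY'
    obtain ⟨l, hl⟩ := exists_distTriang_fullSubcategory hT hX hE (h _ _ hT₀)
    obtain ⟨l', hl'⟩ := exists_distTriang_fullSubcategory hT' (h _ _ hS) hX hY'
    have hT₁ : Γ.thickDegreeZero hΓ ⟨T, h _ _ hT₀⟩ := thickOn_mono _ (Set.subset_univ _) _ hT₀
    have hS₁ : Γ.thickDegreeZero hΓ ⟨S, h _ _ hS⟩ := thickOn_mono _ (Set.subset_univ _) _ hS
    exact ⟨⟨X, hX⟩, ⟨Y, hY⟩, homMk f, homMk g', ⟨_, _, _, hl, hT₁⟩,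
      (trW_iff' _ _).2 ⟨_, _, _, hl', hS₁⟩⟩)
  exact {}

/-- The inverse of a triangle equivalence is a triangle equivalence. -/
lemma triangleEquivalent_of_isEquivalence {C D E : Type*} [Category C] [HasZeroObject C]
    [HasShift C ℤ] [Preadditive C] [∀ n : ℤ, (shiftFunctor C n).Additive] [Pretriangulated C]
    [Category D] [HasZeroObject D] [HasShift D ℤ] [Preadditive D]
    [∀ n : ℤ, (shiftFunctor D n).Additive] [Pretriangulated D] [Category E] [HasZeroObject E]
    [HasShift E ℤ] [Preadditive E] [∀ n : ℤ, (shiftFunctor E n).Additive] [Pretriangulated E]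
    (F : C ⥤ D) [F.CommShift ℤ] [F.IsTriangulated] [F.IsEquivalence] (h : TriangleEquivalent C E) :
    TriangleEquivalent D E := by
  obtain ⟨H, _, _, _⟩ := h
  let : F.asEquivalence.functor.CommShift ℤ := ‹F.CommShift ℤ›
  let : F.asEquivalence.functor.IsTriangulated := ‹F.IsTriangulated›
  let := F.asEquivalence.commShiftInverse ℤ
  have := F.asEquivalence.commShift_of_functor ℤ
  have := F.asEquivalence.toAdjunction.isTriangulated_rightAdjoint
  exact ⟨F.asEquivalence.inverse ⋙ H, inferInstance, inferInstance, inferInstance⟩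

theorem theorem3p5 {G : Type u} [AddCommGroup G] [AddGroup.FG G] (hrank : Module.finrank ℤ G = 1)
    [PartialOrder G] [IsOrderedAddMonoid G]
    (hG : AddSubgroup.closure {g : G | 0 ≤ g} = ⊤)
    (Γ : DGRing G) (hΓ : Γ.IsNonneg)
    (hD1 : Γ.DegreeZeroPerfect hΓ)
    (p : G) (hp : 0 < p)
    (hD2 : Γ.HasGorensteinParameter p ∧ Γ.op.HasGorensteinParameter p)
    (I : Set G) (hI : IsUpperSet I) (hI_nonempty : I.Nonempty) (hI_ne_univ : I ≠ Set.univ) :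
    IsWeakSOD (Γ.per Set.univ) (DGMod.thickOn (DGMod.degreeZero Γ hΓ) I) (Γ.per (upperGap I p))
      (DGMod.thickOn (DGMod.degreeZero Γ hΓ) Iᶜ) ∧
    (Γ.perToCluster hΓ (upperGap I p)).IsTriangulated ∧
    (Γ.perToCluster hΓ (upperGap I p)).IsEquivalence ∧
    ∃ hJ : (upperGap I p).Finite,
      TriangleEquivalent (Γ.Cluster hΓ) (Γ.matrix hJ.toFinset (fun g ↦ g)).Per ∧
      TriangleEquivalent (Γ.Cluster hΓ) (Γ.matrix hJ.toFinset (fun g ↦ -g)).Per := by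
  have hfin := finite_le_notMem hrank hG hp hI hI_nonempty
  have hfin' := finite_ge_mem hrank hG hp hI hI_ne_univ
  have hR : IsUpperSet (reflect I p) := isUpperSet_reflect hI
  have := perToCluster_isEquivalence hD1 hD2.1 hD2.2 hI hfin hfin'
  -- The reflected upper set describes the same cluster category, but its index set is `-J(I)`, as
  -- required by the matrix ring with weights `w g = g`.
  have := perToCluster_isEquivalence hD1 hD2.1 hD2.2 hR
    (finite_le_notMem hrank hG hp hR (reflect_nonempty hI_ne_univ))
    (finite_ge_mem hrank hG hp hR (reflect_ne_univ hI_nonempty))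
  refine ⟨isWeakSOD_per hD1 hD2.1 hD2.2 hI hfin hfin', inferInstance, inferInstance,
    finite_upperGap hrank hp hI, ?_, ?_⟩
  · exact triangleEquivalent_of_isEquivalence (Γ.perToCluster hΓ (upperGap (reflect I p) p))
      (triangleEquivalent_matrix Γ _ _ (by rw [Set.Finite.coe_toFinset, upperGap_reflect]))
  · exact triangleEquivalent_of_isEquivalence (Γ.perToCluster hΓ (upperGap I p))
      (triangleEquivalent_matrix Γ _ _ (by simp))

end
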